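/- A boolean circuit consists of AND, OR and NOT gates (fan-in at most 2); its size is its number of gates. Write $\log=\log_2$, let $\log^{(c)}$ denote the $c$-fold iterated logarithm, and let $\log^* m$ be the smallest $i\in\mathbb{N}$ with $\log^{(i)} m\le 1$. A tight compaction circuit for $n$ elements of $w$ bits takes as input any array of $n$ elements, each consisting of a $w$-bit payload and a 1-bit key, and outputs a permutation of this array (each payload staying with its key) in which all elements with key 0 precede all elements with key 1; stability is not required. There is a universal constant $K$ such that for every $\epsilon>0$ there is a family of tight compaction circuits $\Phi_{n,w}$ for $n$ elements of $w$ bits ($n\ge 0$, $w\ge 1$), in which every input wire and every gate output has fan-out at most $K$, with $$\mathrm{size}(\Phi_{n,w}) = O(nw)\cdot\min\left(\max\left(1,(\log^* n-\log^* w)^{2+\epsilon}\right),\ \frac{2^w}{w}\right),$$ where the constant in $O(\cdot)$ depends only on $\epsilon$, and where the maximum is read as $1$ if $\log^* n\le\log^* w$. In particular, for every constant $c\ge 1$, the size is $O(nw)$ over all $n,w$ with $w\ge\log^{(c)} n$ (the condition being regarded as satisfied when $\log^{(c)}n$ is undefined), with a constant depending only on $\epsilon$ and $c$; and for every constant $w_0$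 the size is $O(nw)$ over all $n$ and all $w\le w_0$, with a constant depending only on $\epsilon$ and $w_0$. -/

import Mathlib

/-! ### Boolean circuits over AND, OR and NOT -/

/-- A boolean gate reading its inputs from the wires in `W`; its fan-in is at most two. -/
inductive BoolGate (W : Type) where
  | and (a b : W) : BoolGate W
  | or (a b : W) : BoolGate W
  | not (a : W) : BoolGate W

namespace BoolGate

/-- The wires read by a gate, with multiplicity. -/
def inputs {W : Type} : BoolGate W → List W
  | .and a b => [a, b]
  | .or a b => [a, b]
  | .not a => [a]

/-- The bit computed by a gate, given the bits on all wires. -/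
def eval {W : Type} (v : W → Bool) : BoolGate W → Bool
  | .and a b => v a && v b
  | .or a b => v a || v b
  | .not a => !(v a)

theorem eval_congr {W : Type} (u v : W → Bool) (g : BoolGate W)
    (h : ∀ a ∈ g.inputs, u a = v a) : g.eval u = g.eval v := by
  cases g <;> simp_all [inputs, eval]

end BoolGate

/-- A boolean circuit with input wires `ι` and output positions `o`.
The wires are the input wires and the outputs of the gates. The gates are listed in a
topological order of the underlying directed acyclic graph. -/
structure BoolCircuit (ι o : Type) where
  /-- the size of the circuit: its number of gates -/
  size : ℕ
  /-- the gates -/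
  gate : Fin size → BoolGate (ι ⊕ Fin size)
  /-- a gate reads only input wires and outputs of earlier gates -/
  acyclic : ∀ i j : Fin size, Sum.inr j ∈ (gate i).inputs → j < i
  /-- the wire carrying each output bit -/
  output : o → ι ⊕ Fin size

namespace BoolCircuit

variable {ι o : Type}

/-- The bit computed by the gate `k` on the input `x`. The default value `false` is never used,
see `gateVal_eq`. -/
def gateVal (c : BoolCircuit ι o) (x : ι → Bool) (k : Fin c.size) : Bool :=
  (c.gate k).eval (Sum.elim x (fun j => if _h : j < k then c.gateVal x j else false))
termination_by k.val

/-- The bit carried by a wire on the input `x`. -/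
def wireVal (c : BoolCircuit ι o) (x : ι → Bool) : ι ⊕ Fin c.size → Bool :=
  Sum.elim x (c.gateVal x)

/-- The output of the circuit on the input `x`. -/
def eval (c : BoolCircuit ι o) (x : ι → Bool) : o → Bool :=
  fun q => c.wireVal x (c.output q)

/-- Every gate computes its operation on the bits carried by the wires it reads. -/
theorem gateVal_eq (c : BoolCircuit ι o) (x : ι → Bool) (k : Fin c.size) :
    c.gateVal x k = (c.gate k).eval (c.wireVal x) := by
  rw [gateVal]
  apply BoolGate.eval_congr
  rintro (a | j) ha
  · rfl
  · simp [wireVal, c.acyclic k j ha]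

/-- The fan-out of a wire (a circuit input or the output of a gate): the number of gate inputs and
of circuit outputs that it feeds. -/
def fanOut [DecidableEq ι] [Fintype o] (c : BoolCircuit ι o) (s : ι ⊕ Fin c.size) : ℕ :=
  (∑ i : Fin c.size, (c.gate i).inputs.count s) + Fintype.card {q : o // c.output q = s}

end BoolCircuit

/-! ### Sorting elements that carry a one-bit key -/

/-- An element: a one-bit key together with a `w`-bit payload. -/
abbrev KeyedElement (w : ℕ) : Type := Bool × (Fin w → Bool)

/-- The names of the `n * (w + 1)` bits of an array of `n` elements: `(i, none)` is the key of the
`i`-th element, and `(i, some j)` is the `j`-th bit of its payload. -/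
abbrev ArrayBit (n w : ℕ) : Type := Fin n × Option (Fin w)

/-- The bits of an array. -/
def arrayToBits {n w : ℕ} (A : Fin n → KeyedElement w) : ArrayBit n w → Bool
  | (i, none) => (A i).1
  | (i, some j) => (A i).2 j

/-- A tight compaction circuit: on every input array it outputs a rearrangement of the array (each
element being moved together with its key) in which all elements with key 0 precede all elements
with key 1. Stability is not required. -/
def IsTightCompactor {n w : ℕ} (c : BoolCircuit (ArrayBit n w) (ArrayBit n w)) : Prop :=
  ∀ A : Fin n → KeyedElement w, ∃ σ : Equiv.Perm (Fin n),
    c.eval (arrayToBits A) = arrayToBits (fun i => A (σ i)) ∧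
    Monotone (fun i => (A (σ i)).1)

/-! ### Iterated logarithms -/

/-- The `c`-fold iterated binary logarithm of `x`. Negative values are replaced by `0` (and the
logarithm of `0` is `0`); so this is the usual iterated logarithm whenever that one is
defined and nonnegative, and it is `0` for all other `x ≥ 0` if `c ≥ 1`. -/
noncomputable def iterLog (c : ℕ) (x : ℝ) : ℝ := (fun y : ℝ => max 0 (Real.logb 2 y))^[c] x

theorem exists_iterLog_le_one (x : ℝ) : ∃ i : ℕ, iterLog i x ≤ 1 := by
  have step : ∀ y : ℝ, max 0 (Real.logb 2 y) ≤ max 1 (|y| - 1) := by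
    intro y
    refine max_le (le_max_of_le_left zero_le_one) ?_
    rcases le_or_gt |y| 2 with h | h
    · refine le_max_of_le_left ?_
      rw [← Real.logb_abs]
      rcases (abs_nonneg y).eq_or_lt with h0 | h0
      · simp [← h0]
      · rw [Real.logb_le_iff_le_rpow (by norm_num) h0]; simpa using h
    · refine le_max_of_le_right ?_
      rw [← Real.logb_abs, Real.logb_le_iff_le_rpow (by norm_num) (by linarith)]
      have := one_add_mul_self_le_rpow_one_add (s := 1) (by norm_num) (p := |y| - 1) (by linarith)
      norm_num at this
      simpa using this
  have key : ∀ k : ℕ, |iterLog k x| ≤ max 1 (|x| - k) := by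
    intro k
    induction k with
    | zero => simp [iterLog]
    | succ k ih =>
      have e : iterLog (k + 1) x = max 0 (Real.logb 2 (iterLog k x)) := by
        simp only [iterLog, Function.iterate_succ_apply']
      rw [e, abs_of_nonneg (le_max_left _ _)]
      refine (step _).trans (max_le (le_max_left _ _) ?_)
      push_cast
      rcases le_max_iff.1 ih with h | h
      · exact le_max_of_le_left (by linarith)
      · exact le_max_of_le_right (by linarith)
  obtain ⟨k, hk⟩ := exists_nat_ge |x|
  exact ⟨k, (le_abs_self _).trans ((key k).trans (max_le le_rfl (by linarith)))⟩

/-- `log* x`: the smallest `i` such that the `i`-fold iterated binary logarithm of `x` is at most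
one; it exists by `exists_iterLog_le_one`. -/
noncomputable def logStar (x : ℝ) : ℕ := sInf {i : ℕ | iterLog i x ≤ 1}

/-- `max(1, (log* n - log* w)^(2 + ε))`, which is `1` when the difference is not positive. -/
noncomputable def logStarFactor (ε : ℝ) (n w : ℕ) : ℝ :=
  max 1 ((max 0 ((logStar n : ℝ) - (logStar w : ℝ))) ^ (2 + ε))

/-!
Compaction is carried out by a list of controlled swaps: the controls are computed from the keys
alone, and each swap costs `O(w)` gates on the payload. So it suffices to use `O(n)` swaps whose
controls are computed with `O(nw)` gates, up to the factor claimed.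

Count the keys in linear size; the compacted array must then match a known pattern of keys. One
pass along a mixing list of linearly many pairs, exchanging two misplaced elements whenever that
repairs both, leaves only a small fraction of the elements misplaced. Loose compaction gathers
these in a smaller array, where the matching problem is solved recursively, and is then undone;
the sizes of the recursive problems decrease geometrically.

Suppose that compaction needs about `α n (1 + f n)` gates and `β n` swaps, where `f` is an iterated
logarithm. To compact few marked elements loosely, arrange all elements in a grid with rows of
length `f n + 1`, compact every row, and sort the rows by whether they hold many marks. As the rows
are short and sorting them has only `n / (f n + 1)` keys, the logarithm is now iterated twice as
often. The two passes and their reversals multiply `β` by `4`, and the geometric series by a factor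
as close to `1` as desired. Hence, for any `ρ > 4`, compaction with `2 ^ k` iterations of the
logarithm has `α` and `β` of order `ρ ^ k`. The recursion starts from loose compaction along an
expander, where logarithmically many rounds of local choices match the marked elements to distinct
places.

Now `2 ^ k ≥ log* n - log* w` brings the iterated logarithm below `w`, and with `ρ = 2 ^ (2 + ε)`
the factor `ρ ^ k` is of order `(log* n - log* w) ^ (2 + ε)`. Elements of few bits are sorted by
counting each of the `2 ^ (w + 1)` values instead. Chains of relays finally bound the fan-out.
-/

open scoped Finset

/-! ### Straight-line programs -/

namespace BoolGate

variable {V W : Type}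

/-- The gate with its wires renamed. -/
def map (f : V → W) : BoolGate V → BoolGate W
  | .and a b => .and (f a) (f b)
  | .or a b => .or (f a) (f b)
  | .not a => .not (f a)

theorem inputs_map (f : V → W) (g : BoolGate V) : (g.map f).inputs = g.inputs.map f := by
  cases g <;> rfl

theorem eval_map (f : V → W) (g : BoolGate V) (v : W → Bool) :
    (g.map f).eval v = g.eval (v ∘ f) := by
  cases g <;> rfl

end BoolGate

section Programs

variable {Ω Ω' : Type}

/-- `f` is the output of a gate that reads wires in `S`. Here and below, a wire is identified with
the bit that it carries, as a function of the input `ω : Ω` of the computation. -/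
def IsGateOver (S : Set (Ω → Bool)) (f : Ω → Bool) : Prop :=
  ∃ g : BoolGate (Ω → Bool), (∀ a ∈ g.inputs, a ∈ S) ∧ f = fun ω => g.eval fun a => a ω

/-- A straight-line program over the wires in `S`: a list of gate outputs, the latest first, each
reading wires in `S` or earlier outputs. -/
inductive GateProgram (S : Set (Ω → Bool)) : List (Ω → Bool) → Prop
  | nil : GateProgram S []
  | cons {f : Ω → Bool} {l : List (Ω → Bool)} : GateProgram S l →
      IsGateOver (S ∪ {g | g ∈ l}) f → GateProgram S (f :: l)

/-- All wires in `T` can be obtained from those in `S` with at most `k` gates. -/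
def Computes (S : Set (Ω → Bool)) (k : ℕ) (T : Set (Ω → Bool)) : Prop :=
  ∃ l, GateProgram S l ∧ l.length ≤ k ∧ T ⊆ S ∪ {g | g ∈ l}

theorem IsGateOver.mono {S T : Set (Ω → Bool)} (h : S ⊆ T) {f : Ω → Bool}
    (hf : IsGateOver S f) : IsGateOver T f := by
  obtain ⟨g, hg, rfl⟩ := hf
  exact ⟨g, fun a ha => h (hg a ha), rfl⟩

theorem IsGateOver.comp (φ : Ω' → Ω) {S : Set (Ω → Bool)} {f : Ω → Bool} (hf : IsGateOver S f) :
    IsGateOver ((· ∘ φ) '' S) (f ∘ φ) := by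
  obtain ⟨g, hg, rfl⟩ := hf
  refine ⟨g.map (· ∘ φ), fun a ha => ?_, funext fun ω => (g.eval_map (· ∘ φ) (· ω)).symm⟩
  rw [BoolGate.inputs_map, List.mem_map] at ha
  exact ha.imp fun b hb => ⟨hg b hb.1, hb.2⟩

namespace GateProgram

theorem mono {S S' : Set (Ω → Bool)} (h : S ⊆ S') {l : List (Ω → Bool)}
    (hl : GateProgram S l) : GateProgram S' l := by
  induction hl with
  | nil => exact .nil
  | cons _ hf ih => exact .cons ih (hf.mono (Set.union_subset_union_left _ h))

theorem append {S : Set (Ω → Bool)} {l l' : List (Ω → Bool)} (hl : GateProgram S l)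
    (hl' : GateProgram (S ∪ {g | g ∈ l}) l') : GateProgram S (l' ++ l) := by
  induction hl' with
  | nil => exact hl
  | cons _ hf ih =>
    refine .cons ih (hf.mono ?_)
    rintro g ((hg | hg) | hg)
    · exact .inl hg
    · exact .inr (List.mem_append_right _ hg)
    · exact .inr (List.mem_append_left _ hg)

theorem image_comp_union_subset (φ : Ω' → Ω) (S : Set (Ω → Bool)) (l : List (Ω → Bool)) :
    (· ∘ φ) '' (S ∪ {g | g ∈ l}) ⊆ (· ∘ φ) '' S ∪ {g | g ∈ l.map (· ∘ φ)} := by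
  rintro _ ⟨g, hg | hg, rfl⟩
  · exact .inl ⟨g, hg, rfl⟩
  · exact .inr (List.mem_map.2 ⟨g, hg, rfl⟩)

theorem comp (φ : Ω' → Ω) {S : Set (Ω → Bool)} {l : List (Ω → Bool)} (hl : GateProgram S l) :
    GateProgram ((· ∘ φ) '' S) (l.map (· ∘ φ)) := by
  induction hl with
  | nil => exact .nil
  | cons _ hf ih => exact .cons ih ((hf.comp φ).mono (image_comp_union_subset φ _ _))

theorem exists_family {S : Set (Ω → Bool)} {l : List (Ω → Bool)} (hl : GateProgram S l) :
    ∃ F : Fin l.length → Ω → Bool,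
      (∀ i, IsGateOver (S ∪ {g | ∃ j < i, F j = g}) (F i)) ∧ ∀ g ∈ l, ∃ i, F i = g := by
  induction hl with
  | nil => exact ⟨fun i => i.elim0, fun i => i.elim0, by simp⟩
  | @cons f l _ hf ih =>
    obtain ⟨F, hF, hsurj⟩ := ih
    refine ⟨Fin.snoc (α := fun _ => Ω → Bool) F f, fun i => ?_, fun g hg => ?_⟩
    · induction i using Fin.lastCases with
      | last =>
        rw [Fin.snoc_last]
        refine hf.mono (Set.union_subset_union_right _ fun g hg => ?_)
        obtain ⟨j, rfl⟩ := hsurj g hg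
        exact ⟨j.castSucc, Fin.castSucc_lt_last j, Fin.snoc_castSucc ..⟩
      | cast i =>
        rw [Fin.snoc_castSucc]
        refine (hF i).mono (Set.union_subset_union_right _ ?_)
        rintro g ⟨j, hj, rfl⟩
        exact ⟨j.castSucc, Fin.castSucc_lt_castSucc_iff.2 hj, Fin.snoc_castSucc ..⟩
    · rcases List.mem_cons.1 hg with rfl | hg
      · exact ⟨Fin.last _, Fin.snoc_last ..⟩
      · obtain ⟨j, rfl⟩ := hsurj g hg
        exact ⟨j.castSucc, Fin.snoc_castSucc ..⟩

end GateProgram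

namespace Computes

variable {S S' T T' U : Set (Ω → Bool)} {k l m : ℕ} {c f g : Ω → Bool}

theorem mono (h : Computes S k T) (hS : S ⊆ S') (hk : k ≤ l) (hT : T' ⊆ T) :
    Computes S' l T' := by
  obtain ⟨p, hp, hl, hsub⟩ := h
  exact ⟨p, hp.mono hS, hl.trans hk,
    (hT.trans hsub).trans (Set.union_subset_union_left _ hS)⟩

theorem mono_left (h : Computes S k T) (hS : S ⊆ S') : Computes S' k T :=
  h.mono hS le_rfl subset_rfl

theorem mono_cost (h : Computes S k T) (hk : k ≤ l) : Computes S l T :=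
  h.mono subset_rfl hk subset_rfl

theorem mono_right (h : Computes S k T) (hT : T' ⊆ T) : Computes S k T' :=
  h.mono subset_rfl le_rfl hT

theorem of_subset (h : T ⊆ S) : Computes S k T :=
  ⟨[], .nil, Nat.zero_le _, h.trans Set.subset_union_left⟩

theorem of_mem (h : f ∈ S) : Computes S 0 {f} := of_subset (Set.singleton_subset_iff.2 h)

theorem of_gate (h : IsGateOver S f) : Computes S 1 {f} :=
  ⟨[f], .cons .nil (h.mono Set.subset_union_left), le_rfl, by simp⟩

theorem extend (h : Computes S k T) (h' : Computes (S ∪ T) l U) :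
    Computes S (k + l) (T ∪ U) := by
  obtain ⟨p, hp, hpl, hpT⟩ := h
  obtain ⟨q, hq, hql, hqU⟩ := h'
  have hST : S ∪ T ⊆ S ∪ {g | g ∈ p} := Set.union_subset Set.subset_union_left hpT
  refine ⟨q ++ p, hp.append (hq.mono hST), by rw [List.length_append]; omega, ?_⟩
  have hqp : S ∪ T ∪ {g | g ∈ q} ⊆ S ∪ {g | g ∈ q ++ p} := by
    intro g hg
    have := @hST g
    simp only [Set.mem_union, Set.mem_ofPred_eq, List.mem_append] at hg this ⊢
    tauto
  exact Set.union_subset ((Set.subset_union_right.trans Set.subset_union_left).trans hqp)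
    (hqU.trans hqp)

theorem trans (h : Computes S k T) (h' : Computes (S ∪ T) l U) : Computes S (k + l) U :=
  (h.extend h').mono_right Set.subset_union_right

theorem union (h : Computes S k T) (h' : Computes S l U) : Computes S (k + l) (T ∪ U) :=
  h.extend (h'.mono_left Set.subset_union_left)

theorem biUnion {ι : Type*} (s : Finset ι) {k : ι → ℕ} {T : ι → Set (Ω → Bool)}
    (h : ∀ i ∈ s, Computes S (k i) (T i)) : Computes S (∑ i ∈ s, k i) (⋃ i ∈ s, T i) := by
  classical
  induction s using Finset.induction_on with
  | empty => exact of_subset (by simp)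
  | insert a s ha ih =>
    rw [Finset.sum_insert ha, Finset.set_biUnion_insert]
    exact (h a (Finset.mem_insert_self _ _)).union
      (ih fun i hi => h i (Finset.mem_insert_of_mem hi))

theorem iUnion {ι : Type*} [Fintype ι] {k : ι → ℕ} {T : ι → Set (Ω → Bool)}
    (h : ∀ i, Computes S (k i) (T i)) : Computes S (∑ i, k i) (⋃ i, T i) := by
  simpa using biUnion Finset.univ fun i _ => h i

theorem range {ι : Type*} [Fintype ι] {F : ι → Ω → Bool} (h : ∀ i, Computes S k {F i}) :
    Computes S (Fintype.card ι * k) (Set.range F) := by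
  simpa [Set.iUnion_singleton_eq_range] using iUnion h

theorem comp (φ : Ω' → Ω) (h : Computes S k T) :
    Computes ((· ∘ φ) '' S) k ((· ∘ φ) '' T) := by
  obtain ⟨p, hp, hpl, hpT⟩ := h
  exact ⟨p.map (· ∘ φ), hp.comp φ, by rwa [List.length_map],
    (Set.image_mono hpT).trans (GateProgram.image_comp_union_subset φ S p)⟩

theorem and (hf : Computes S k {f}) (hg : Computes S l {g}) :
    Computes S (k + l + 1) {fun ω => f ω && g ω} :=
  (hf.union hg).trans (of_gate ⟨.and f g, by simp [BoolGate.inputs], rfl⟩)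

theorem or (hf : Computes S k {f}) (hg : Computes S l {g}) :
    Computes S (k + l + 1) {fun ω => f ω || g ω} :=
  (hf.union hg).trans (of_gate ⟨.or f g, by simp [BoolGate.inputs], rfl⟩)

theorem not (hf : Computes S k {f}) : Computes S (k + 1) {fun ω => !(f ω)} :=
  hf.trans (of_gate ⟨.not f, by simp [BoolGate.inputs], rfl⟩)

theorem xor (hf : Computes S k {f}) (hg : Computes S l {g}) :
    Computes S (k + l + 4) {fun ω => f ω ^^ g ω} := by
  have hf' : Computes (S ∪ ({f} ∪ {g})) 0 {f} := of_mem (by simp)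
  have hg' : Computes (S ∪ ({f} ∪ {g})) 0 {g} := of_mem (by simp)
  have hfg : (fun ω => f ω ^^ g ω) = fun ω => (f ω || g ω) && !(f ω && g ω) := by
    funext ω; cases f ω <;> cases g ω <;> rfl
  exact hfg ▸ (hf.union hg).trans ((hf'.or hg').and (hf'.and hg').not)

theorem ite (hc : Computes S m {c}) (hf : Computes S k {f}) (hg : Computes S l {g}) :
    Computes S (m + k + l + 4) {fun ω => if c ω then f ω else g ω} := by
  have hc' : Computes (S ∪ ({c} ∪ {f} ∪ {g})) 0 {c} := of_mem (by simp)
  have hf' : Computes (S ∪ ({c} ∪ {f} ∪ {g})) 0 {f} := of_mem (by simp)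
  have hg' : Computes (S ∪ ({c} ∪ {f} ∪ {g})) 0 {g} := of_mem (by simp)
  have hcfg : (fun ω => if c ω then f ω else g ω) =
      fun ω => (c ω && f ω) || (!(c ω) && g ω) := by
    funext ω; cases c ω <;> simp
  exact hcfg ▸ ((hc.union hf).union hg).trans ((hc'.and hf').or (hc'.not.and hg'))

theorem any {ι : Type*} (L : List ι) (F : ι → Ω → Bool) (hfalse : (fun _ => false) ∈ S)
    (h : ∀ i ∈ L, Computes S k {F i}) :
    Computes S (L.length * (k + 1)) {fun ω => L.any fun i => F i ω} := by
  induction L with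
  | nil => exact of_subset (Set.singleton_subset_iff.2 hfalse)
  | cons a L ih =>
    simp only [List.any_cons, List.length_cons]
    exact ((h a List.mem_cons_self).or (ih fun i hi => h i (List.mem_cons_of_mem _ hi))).mono_cost
      (by ring_nf; omega)

end Computes

/-- The two constant wires. -/
def constWires (Ω : Type) : Set (Ω → Bool) := {fun _ => false, fun _ => true}

theorem false_mem_constWires : (fun _ => false) ∈ constWires Ω := Or.inl rfl

theorem true_mem_constWires : (fun _ => true) ∈ constWires Ω := Or.inr rfl

theorem comp_mem_constWires (φ : Ω' → Ω) {f : Ω → Bool} (h : f ∈ constWires Ω) :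
    f ∘ φ ∈ constWires Ω' := by
  rcases h with rfl | rfl
  · exact false_mem_constWires
  · exact true_mem_constWires

theorem Computes.constWires {S : Set (Ω → Bool)} (h : S.Nonempty) :
    Computes S 5 (constWires Ω) := by
  obtain ⟨f, hf⟩ := h
  have hf := Computes.of_mem hf
  refine ((hf.and hf.not).union (hf.or hf.not)).mono subset_rfl (by norm_num) ?_
  rintro g (rfl | rfl)
  · left; funext ω; simp
  · right; funext ω; simp

end Programs

namespace BoolCircuit

variable {ι o : Type}

theorem gateVal_unique (c : BoolCircuit ι o) (x : ι → Bool) (v : Fin c.size → Bool)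
    (hv : ∀ k, v k = (c.gate k).eval (Sum.elim x v)) : c.gateVal x = v := by
  funext k
  induction k using WellFoundedLT.induction with
  | _ k ih =>
    rw [c.gateVal_eq, hv]
    refine BoolGate.eval_congr _ _ _ ?_
    rintro (a | j) ha
    · rfl
    · exact ih j (c.acyclic k j ha)

/-- A circuit can be read off a family of wires `F` in which each member is the output of a gate
that reads inputs and earlier members. -/
theorem exists_of_family {N : ℕ} (F : Fin N → (ι → Bool) → Bool)
    (hF : ∀ i, IsGateOver ((Set.range fun p x => x p) ∪ {g | ∃ j < i, F j = g}) (F i))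
    (f : (ι → Bool) → o → Bool)
    (hf : ∀ q, (fun x => f x q) ∈ (Set.range fun p (x : ι → Bool) => x p) ∪ Set.range F) :
    ∃ c : BoolCircuit ι o, c.size = N ∧ ∀ x, c.eval x = f x := by
  have hwire : ∀ (P : Fin N → Prop) (g : (ι → Bool) → Bool),
      g ∈ (Set.range fun p x => x p) ∪ {g | ∃ j, P j ∧ F j = g} →
      ∃ a : ι ⊕ Fin N, (∀ j, a = .inr j → P j) ∧ ∀ x, Sum.elim x (F · x) a = g x := by
    rintro P _ (⟨p, rfl⟩ | ⟨j, hj, rfl⟩)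
    · exact ⟨.inl p, by simp, fun x => rfl⟩
    · exact ⟨.inr j, by simpa using hj, fun x => rfl⟩
  have hgate : ∀ i, ∃ g : BoolGate (ι ⊕ Fin N),
      (∀ j, .inr j ∈ g.inputs → j < i) ∧ ∀ x, F i x = g.eval (Sum.elim x (F · x)) := by
    intro i
    obtain ⟨g, hg, hFi⟩ := hF i
    have : Nonempty (ι ⊕ Fin N) := ⟨.inr i⟩
    choose! a ha hax using fun b hb => hwire (· < i) b (hg b hb)
    refine ⟨g.map a, fun j hj => ?_, fun x => ?_⟩
    · rw [BoolGate.inputs_map, List.mem_map] at hj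
      obtain ⟨b, hb, hbj⟩ := hj
      exact ha b hb j hbj
    · rw [hFi, BoolGate.eval_map]
      exact BoolGate.eval_congr _ _ _ fun b hb => (hax b hb x).symm
  have hout : ∀ q, ∃ a : ι ⊕ Fin N, ∀ x, Sum.elim x (F · x) a = f x q := fun q => by
    obtain ⟨a, -, ha⟩ := hwire (fun _ => True) _ (by simpa using hf q)
    exact ⟨a, ha⟩
  choose gate hacyc hgate using hgate
  choose out hout using hout
  let c : BoolCircuit ι o := ⟨N, gate, hacyc, out⟩
  refine ⟨c, rfl, fun x => funext fun q => ?_⟩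
  rw [← hout q x, ← c.gateVal_unique x (F · x) fun k => hgate k x]
  rfl

end BoolCircuit

theorem Computes.exists_circuit {ι o : Type} {k : ℕ} (f : (ι → Bool) → o → Bool)
    (h : Computes (Set.range fun p (x : ι → Bool) => x p) k
      (Set.range fun q (x : ι → Bool) => f x q)) :
    ∃ c : BoolCircuit ι o, c.size ≤ k ∧ ∀ x, c.eval x = f x := by
  obtain ⟨l, hl, hk, hsub⟩ := h
  obtain ⟨F, hF, hsurj⟩ := hl.exists_family
  obtain ⟨c, hc, hcf⟩ := BoolCircuit.exists_of_family F hF f fun q =>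
    Set.union_subset_union_right _ hsurj (hsub ⟨q, rfl⟩)
  exact ⟨c, hc.trans_le hk, hcf⟩

/-! ### Reducing the fan-out -/

instance lawfulBEqSum {α β : Type*} [BEq α] [LawfulBEq α] [BEq β] [LawfulBEq β] :
    LawfulBEq (α ⊕ β) where
  eq_of_beq {a b} h := by
    rcases a with a | a <;> rcases b with b | b
    · exact congrArg _ (eq_of_beq (α := α) h)
    · exact absurd h Bool.false_ne_true
    · exact absurd h Bool.false_ne_true
    · exact congrArg _ (eq_of_beq (α := β) h)
  rfl {a} := by
    rcases a with a | a
    · exact beq_self_eq_true (α := α) a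
    · exact beq_self_eq_true (α := β) a

namespace BoolGate

variable {V W : Type}

/-- The wire read at each of the two input positions of a gate; a negation reads its wire at both
positions. -/
def source : BoolGate W → Bool → W
  | .and a b => fun t => if t then b else a
  | .or a b => fun t => if t then b else a
  | .not a => fun _ => a

theorem source_mem_inputs (g : BoolGate W) (t : Bool) : g.source t ∈ g.inputs := by
  cases g <;> cases t <;> simp [source, inputs]

/-- The gate reading the wire `f t` at each input position `t`. -/
def rewire (f : Bool → W) : BoolGate V → BoolGate W
  | .and _ _ => .and (f false) (f true)
  | .or _ _ => .or (f false) (f true)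
  | .not _ => .not (f false)

theorem exists_of_mem_inputs_rewire {f : Bool → W} {g : BoolGate V} {a : W}
    (h : a ∈ (g.rewire f).inputs) : ∃ t, a = f t := by
  cases g <;> simp only [rewire, inputs, List.mem_cons, List.not_mem_nil, or_false] at h
  · rcases h with h | h <;> exact ⟨_, h⟩
  · rcases h with h | h <;> exact ⟨_, h⟩
  · exact ⟨_, h⟩

theorem count_inputs_rewire_le [BEq W] [LawfulBEq W] [DecidableEq W] (f : Bool → W)
    (g : BoolGate V) (a : W) :
    (g.rewire f).inputs.count a ≤ ∑ t, if f t = a then 1 else 0 := by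
  rw [Fintype.sum_bool]
  cases g <;> simp [rewire, inputs, List.count_cons, add_comm]

theorem eval_rewire (f : Bool → W) (g : BoolGate V) (v : V → Bool) (w : W → Bool)
    (h : ∀ t, w (f t) = v (g.source t)) : (g.rewire f).eval w = g.eval v := by
  cases g <;> simp [rewire, eval, h, source]

end BoolGate

theorem exists_equiv_fin_of_rank {G : Type*} [Fintype G] (rank : G → ℕ) :
    ∃ e : G ≃ Fin (Fintype.card G), ∀ g h, rank g < rank h → e g < e h := by
  let e₀ := Fintype.equivFin G
  let σ := Tuple.sort (rank ∘ e₀.symm)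
  have hσ : Monotone ((rank ∘ e₀.symm) ∘ σ) := Tuple.monotone_sort _
  refine ⟨e₀.trans σ.symm, fun g h hgh => lt_of_not_ge fun hle => hgh.not_ge ?_⟩
  simpa using hσ hle

/-- The consumers of each wire form a chain, in which every consumer is served either by the wire
itself or by an earlier consumer of the same wire, and nothing serves two consumers. -/
theorem exists_chain {κ W : Type*} [LinearOrder κ] [Finite κ] (wire : κ → W) :
    ∃ src : κ → W ⊕ κ, Function.Injective src ∧
      ∀ k, src k = .inl (wire k) ∨ ∃ l < k, src k = .inr l ∧ wire l = wire k := by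
  let P k := {l | wire l = wire k ∧ l < k}
  have key : ∀ k, ∃ s : W ⊕ κ, (s = .inl (wire k) ∧ P k = ∅) ∨
      ∃ l, s = .inr l ∧ IsGreatest (P k) l := by
    intro k
    rcases (P k).eq_empty_or_nonempty with h | h
    · exact ⟨_, .inl ⟨rfl, h⟩⟩
    · obtain ⟨l, hl, hmax⟩ := Set.exists_max_image (P k) id (Set.toFinite _) h
      exact ⟨_, .inr ⟨l, rfl, hl, hmax⟩⟩
  choose src hsrc using key
  have hserve : ∀ k, src k = .inl (wire k) ∨ ∃ l < k, src k = .inr l ∧ wire l = wire k :=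
    fun k => (hsrc k).imp And.left fun ⟨l, hl, hg⟩ => ⟨l, hg.1.2, hl, hg.1.1⟩
  have hne : ∀ k l, k < l → src k ≠ src l := by
    intro k l hkl heq
    have hwire : wire k = wire l := by
      rcases hserve k with h | ⟨p, -, h, hp⟩ <;> rcases hserve l with h' | ⟨q, -, h', hq⟩ <;>
        simp_all
    have hk : k ∈ P l := ⟨hwire, hkl⟩
    rcases hsrc l with ⟨-, h⟩ | ⟨p, h, hp⟩
    · exact (h ▸ hk : k ∈ (∅ : Set κ))
    · rcases hserve k with h' | ⟨q, hq, h', -⟩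
      · simp_all
      · obtain rfl : q = p := by simp_all
        exact (hp.2 hk).not_gt hq
  refine ⟨src, fun k l h => ?_, hserve⟩
  by_contra hkl
  exact (Ne.lt_or_gt hkl).elim (hne _ _ · h) (hne _ _ · h.symm)

theorem sum_ite_eq_le_one {κ W : Type*} [Fintype κ] [DecidableEq W] {F : κ → W}
    (hF : Function.Injective F) (a : W) : (∑ k, if F k = a then 1 else 0) ≤ 1 := by
  rw [← Finset.card_filter, Finset.card_le_one]
  simp only [Finset.mem_filter, Finset.mem_univ, true_and]
  exact fun x hx y hy => hF (hx.trans hy.symm)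

namespace BoolCircuit

variable {ι o G : Type} {N : ℕ}

/-- The circuit with gates indexed by `G`, listed in the order given by `e`. -/
def ofEquiv (e : G ≃ Fin N) (gate : G → BoolGate (ι ⊕ G))
    (hacyc : ∀ g h, .inr h ∈ (gate g).inputs → e h < e g) (out : o → ι ⊕ G) :
    BoolCircuit ι o where
  size := N
  gate i := (gate (e.symm i)).map (Sum.map id e)
  acyclic i j hj := by
    rw [BoolGate.inputs_map, List.mem_map] at hj
    obtain ⟨a | h, ha, haj⟩ := hj
    · simp at haj
    · obtain rfl : e h = j := by simpa using haj
      simpa using hacyc _ _ ha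
  output q := Sum.map id e (out q)

section OfEquiv

variable (e : G ≃ Fin N) (gate : G → BoolGate (ι ⊕ G))
  (hacyc : ∀ g h, .inr h ∈ (gate g).inputs → e h < e g) (out : o → ι ⊕ G)

theorem eval_ofEquiv (x : ι → Bool) (v : G → Bool)
    (hv : ∀ g, v g = (gate g).eval (Sum.elim x v)) :
    (ofEquiv e gate hacyc out).eval x = fun q => Sum.elim x v (out q) := by
  have helim : Sum.elim x (v ∘ e.symm) ∘ Sum.map id e = Sum.elim x v := by
    funext a; rcases a with a | a <;> simp
  have hval : (ofEquiv e gate hacyc out).gateVal x = v ∘ e.symm := by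
    refine gateVal_unique (ofEquiv e gate hacyc out) x (v ∘ e.symm) fun k => ?_
    exact (hv _).trans (helim ▸ (BoolGate.eval_map _ _ _).symm)
  funext q
  rw [← helim, eval, wireVal, hval]
  rfl

theorem fanOut_ofEquiv [Fintype G] [DecidableEq ι] [DecidableEq G] [BEq G] [LawfulBEq G]
    [Fintype o] (s : ι ⊕ G) :
    (ofEquiv e gate hacyc out).fanOut (Sum.map id e s) =
      ∑ g, (gate g).inputs.count s + ∑ q, if out q = s then 1 else 0 := by
  have hinj : Function.Injective (Sum.map (id : ι → ι) e) :=
    Function.injective_id.sumMap e.injective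
  rw [fanOut, ← Finset.card_filter, ← Fintype.card_subtype]
  congr 1
  · refine (Fintype.sum_equiv e _ _ fun g => ?_).symm
    simp only [ofEquiv, BoolGate.inputs_map, Equiv.symm_apply_apply]
    exact (List.count_map_of_injective _ _ hinj _).symm
  · exact Fintype.card_congr (Equiv.subtypeEquivRight fun q => hinj.eq_iff)

end OfEquiv

section Relay

variable (c : BoolCircuit ι o)

/-- The places at which wires of a circuit are read: the two input positions of every gate, and the
outputs. -/
abbrev Port : Type := (Fin c.size × Bool) ⊕ o

/-- The wire read at a port. -/
def portWire : c.Port → ι ⊕ Fin c.size :=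
  Sum.elim (fun p => (c.gate p.1).source p.2) c.output

/-- The wire, in the circuit with one relay per port, that stands for a wire or a relay. -/
def relayWire : (ι ⊕ Fin c.size) ⊕ c.Port → ι ⊕ (c.Port ⊕ Fin c.size) :=
  Sum.elim (Sum.map id Sum.inr) fun p => .inr (.inl p)

/-- The gates of the circuit with one relay per port: the relay of `p` copies `src p`, and every
gate reads the relays of its own ports. -/
def relayGate (src : c.Port → (ι ⊕ Fin c.size) ⊕ c.Port) :
    c.Port ⊕ Fin c.size → BoolGate (ι ⊕ (c.Port ⊕ Fin c.size)) :=
  Sum.elim (fun p => .and (c.relayWire (src p)) (c.relayWire (src p)))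
    fun i => (c.gate i).rewire fun t => .inr (.inl (.inl (i, t)))

/-- A ranking in which every gate comes after the relays that it reads and before those that read
its output. -/
def relayRank : c.Port ⊕ Fin c.size → ℕ :=
  Sum.elim (Sum.elim (fun p => 2 * p.1) fun _ => 2 * c.size) fun i => 2 * i + 1

theorem relayRank_lt_of_portWire_eq {p : c.Port} {j : Fin c.size} (h : c.portWire p = .inr j) :
    c.relayRank (.inr j) < c.relayRank (.inl p) := by
  rcases p with ⟨i, t⟩ | q
  · have : j < i := c.acyclic i j (h ▸ BoolGate.source_mem_inputs _ t)
    simp only [relayRank, Sum.elim_inl, Sum.elim_inr]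
    omega
  · simp only [relayRank, Sum.elim_inl, Sum.elim_inr]
    omega

variable {c} {src : c.Port → (ι ⊕ Fin c.size) ⊕ c.Port}

theorem relayWire_injective : Function.Injective c.relayWire := by
  rintro ((a | a) | a) ((b | b) | b) h <;> simp_all [relayWire]

theorem relayGate_acyclic {e : c.Port ⊕ Fin c.size ≃ Fin N}
    (he : ∀ g h, c.relayRank g < c.relayRank h → e g < e h)
    (hsrc : ∀ p, src p = .inl (c.portWire p) ∨
      ∃ l, e (.inl l) < e (.inl p) ∧ src p = .inr l ∧ c.portWire l = c.portWire p)
    (g h : c.Port ⊕ Fin c.size) (hh : .inr h ∈ (c.relayGate src g).inputs) : e h < e g := by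
  rcases g with p | i
  · have hp : c.relayWire (src p) = .inr h := by
      simpa [relayGate, BoolGate.inputs, eq_comm] using hh
    rcases hsrc p with hs | ⟨l, hl, hs, -⟩
    · rw [hs] at hp
      rcases ha : c.portWire p with a | j
      · simp [ha, relayWire] at hp
      · obtain rfl : .inr j = h := by simpa [ha, relayWire] using hp
        exact he _ _ (c.relayRank_lt_of_portWire_eq ha)
    · obtain rfl : .inl l = h := by simpa [hs, relayWire] using hp
      exact hl
  · obtain ⟨t, ht⟩ := BoolGate.exists_of_mem_inputs_rewire
      (f := fun t => Sum.inr (Sum.inl (Sum.inl (i, t)))) (g := c.gate i) hh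
    obtain rfl := Sum.inr_injective ht
    exact he _ _ (by simp [relayRank])

theorem relayGate_eval (hsrc : ∀ p, src p = .inl (c.portWire p) ∨
      ∃ l, src p = .inr l ∧ c.portWire l = c.portWire p)
    (x : ι → Bool) {v : c.Port ⊕ Fin c.size → Bool}
    (hv : v = Sum.elim (fun p => c.wireVal x (c.portWire p)) (c.gateVal x))
    (g : c.Port ⊕ Fin c.size) : v g = (c.relayGate src g).eval (Sum.elim x v) := by
  subst hv
  rcases g with p | i
  · simp only [relayGate, Sum.elim_inl, BoolGate.eval, Bool.and_self]
    rcases hsrc p with h | ⟨l, h, hl⟩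
    · rw [h]
      rcases c.portWire p with a | j <;> rfl
    · rw [h, ← hl]
      rfl
  · refine (c.gateVal_eq x i).trans
      (BoolGate.eval_rewire (fun t => Sum.inr (Sum.inl (Sum.inl (i, t)))) (c.gate i) _ _
        fun t => rfl).symm

/-- A wire feeds at most one relay, twice, and besides a relay feeds at most the port it serves. -/
theorem relayGate_fanOut_le [DecidableEq ι] [DecidableEq o] [Fintype o]
    (hsrc : Function.Injective src) (s : ι ⊕ (c.Port ⊕ Fin c.size)) :
    (∑ g, (c.relayGate src g).inputs.count s +
      ∑ q : o, if (.inr (.inl (.inr q)) : ι ⊕ (c.Port ⊕ Fin c.size)) = s then 1 else 0) ≤ 3 := by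
  have hrelay : ∑ p : c.Port, (c.relayGate src (.inl p)).inputs.count s ≤ 2 := by
    have hp : ∀ p, (c.relayGate src (.inl p)).inputs.count s =
        2 * if c.relayWire (src p) = s then 1 else 0 := by
      intro p
      by_cases h : c.relayWire (src p) = s <;> simp [relayGate, BoolGate.inputs, h]
    simp only [hp, ← Finset.mul_sum]
    have := sum_ite_eq_le_one (relayWire_injective.comp hsrc) s
    simp only [Function.comp_apply] at this
    omega
  have hgate : ∑ i : Fin c.size, (c.relayGate src (.inr i)).inputs.count s ≤
      ∑ p : Fin c.size × Bool,
        if (.inr (.inl (.inl p)) : ι ⊕ (c.Port ⊕ Fin c.size)) = s then 1 else 0 := by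
    rw [Fintype.sum_prod_type]
    exact Finset.sum_le_sum fun i _ =>
      BoolGate.count_inputs_rewire_le (fun t => Sum.inr (Sum.inl (Sum.inl (i, t)))) (c.gate i) _
  have hport := sum_ite_eq_le_one
    (F := fun p : c.Port => (.inr (.inl p) : ι ⊕ (c.Port ⊕ Fin c.size)))
    (fun a b h => by simpa using h) s
  rw [Fintype.sum_sum_type] at hport ⊢
  omega

end Relay

/-- Every port receives its bit from a relay of its own, the relays of a wire being chained. -/
theorem exists_fanOut_le [DecidableEq ι] [Fintype o] (c : BoolCircuit ι o) :
    ∃ c' : BoolCircuit ι o, c'.size = 3 * c.size + Fintype.card o ∧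
      (∀ x, c'.eval x = c.eval x) ∧ ∀ s, c'.fanOut s ≤ 3 := by
  classical
  obtain ⟨e, he⟩ := exists_equiv_fin_of_rank c.relayRank
  let _ : LinearOrder c.Port := LinearOrder.lift' (e ∘ .inl) (e.injective.comp Sum.inl_injective)
  obtain ⟨src, hinj, hsrc⟩ := exists_chain c.portWire
  have hacyc := relayGate_acyclic he hsrc
  refine ⟨ofEquiv e (c.relayGate src) hacyc fun q => .inr (.inl (.inr q)), ?_, fun x => ?_,
    fun s => ?_⟩
  · simp only [ofEquiv, Fintype.card_sum, Fintype.card_prod, Fintype.card_fin, Fintype.card_bool]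
    ring
  · rw [eval_ofEquiv _ _ _ _ x _
      (relayGate_eval (fun p => (hsrc p).imp_right fun ⟨l, hl⟩ => ⟨l, hl.2⟩) x rfl)]
    rfl
  · obtain ⟨s, rfl⟩ := ((Equiv.refl ι).sumCongr e).surjective s
    exact (fanOut_ofEquiv e _ hacyc _ s).trans_le (relayGate_fanOut_le hinj s)

end BoolCircuit

/-! ### Networks of controlled swaps -/

section CondSwap

variable {ι Ω : Type} [DecidableEq ι]

/-- The permutation, depending on the input `ω`, that swaps `e.1` and `e.2` if the control wire `c`
carries `true`. -/
def condSwap (e : ι × ι) (c : Ω → Bool) (ω : Ω) : Equiv.Perm ι :=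
  if c ω then Equiv.swap e.1 e.2 else 1

theorem condSwap_of_true {e : ι × ι} {c : Ω → Bool} {ω : Ω} (h : c ω = true) :
    condSwap e c ω = Equiv.swap e.1 e.2 := if_pos h

theorem condSwap_of_false {e : ι × ι} {c : Ω → Bool} {ω : Ω} (h : c ω = false) :
    condSwap e c ω = 1 := if_neg (by simp [h])

theorem condSwap_inv (e : ι × ι) (c : Ω → Bool) (ω : Ω) :
    (condSwap e c ω)⁻¹ = condSwap e c ω := by
  cases h : c ω
  · rw [condSwap_of_false h, inv_one]
  · rw [condSwap_of_true h, Equiv.swap_inv]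

theorem condSwap_apply_of_ne_of_ne {e : ι × ι} {p : ι} (h₁ : p ≠ e.1) (h₂ : p ≠ e.2)
    (c : Ω → Bool) (ω : Ω) : condSwap e c ω p = p := by
  cases h : c ω
  · rw [condSwap_of_false h, Equiv.Perm.one_apply]
  · rw [condSwap_of_true h, Equiv.swap_apply_of_ne_of_ne h₁ h₂]

theorem computes_condSwap (e : ι × ι) {c : Ω → Bool} {X : ι → Ω → Bool} {S : Set (Ω → Bool)}
    (hc : c ∈ S) (hX : ∀ p, X p ∈ S) :
    Computes S 8 (Set.range fun p ω => X (condSwap e c ω p) ω) := by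
  have hX (p) : Computes S 0 {X p} := .of_mem (hX p)
  have hc := Computes.of_mem hc
  refine ((Computes.of_subset (k := 0) subset_rfl).union
    ((hc.ite (hX e.2) (hX e.1)).union (hc.ite (hX e.1) (hX e.2)))).mono subset_rfl
    (by norm_num) ?_
  rintro _ ⟨p, rfl⟩
  by_cases h₁ : p = e.1
  · right; left
    funext ω
    cases h : c ω <;> simp [condSwap, h, h₁]
  by_cases h₂ : p = e.2
  · right; right
    funext ω
    cases h : c ω <;> simp [condSwap, h, h₂]
  · left
    simp only [condSwap_apply_of_ne_of_ne h₁ h₂]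
    exact ‹∀ p, X p ∈ S› p

end CondSwap

/-- A list of controlled swaps: each swaps two positions if its control wire carries `true`. -/
abbrev SwapNet (ι Ω : Type) : Type := List ((ι × ι) × (Ω → Bool))

namespace SwapNet

variable {ι κ Ω Ω' : Type}

/-- The wires controlling the swaps. -/
def controls (N : SwapNet ι Ω) : Set (Ω → Bool) := {c | ∃ s ∈ N, s.2 = c}

/-- The network with positions renamed, reading its input through `φ`. -/
def map (f : ι → κ) (φ : Ω' → Ω) (N : SwapNet ι Ω) : SwapNet κ Ω' :=
  List.map (fun s => ((f s.1.1, f s.1.2), s.2 ∘ φ)) N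

theorem length_map (f : ι → κ) (φ : Ω' → Ω) (N : SwapNet ι Ω) :
    List.length (N.map f φ) = List.length N := List.length_map _

theorem controls_nil : controls ([] : SwapNet ι Ω) = ∅ := by simp [controls]

theorem controls_map (f : ι → κ) (φ : Ω' → Ω) (N : SwapNet ι Ω) :
    (N.map f φ).controls = (· ∘ φ) '' N.controls := by
  ext c
  simp only [controls, map, List.mem_map, Set.mem_ofPred_eq, Set.mem_image]
  aesop

theorem controls_append (N N' : SwapNet ι Ω) :
    controls (N ++ N') = N.controls ∪ N'.controls := by
  ext c; simp [controls, or_and_right, exists_or]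

theorem controls_cons (s : (ι × ι) × (Ω → Bool)) (N : SwapNet ι Ω) :
    controls (s :: N) = {s.2} ∪ controls N := by
  ext c; simp [controls, eq_comm]

theorem controls_reverse (N : SwapNet ι Ω) : controls (List.reverse N) = controls N := by
  ext c; simp [controls]

variable [DecidableEq ι] [DecidableEq κ]

/-- The permutation realized on the input `ω`: after the network has been applied, position `p`
holds what was at position `N.perm ω p` before. -/
def perm : SwapNet ι Ω → Ω → Equiv.Perm ι
  | [], _ => 1
  | s :: N, ω => condSwap s.1 s.2 ω * perm N ω

theorem perm_nil (ω : Ω) : perm ([] : SwapNet ι Ω) ω = 1 := rfl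

theorem perm_cons (s : (ι × ι) × (Ω → Bool)) (N : SwapNet ι Ω) (ω : Ω) :
    perm (s :: N) ω = condSwap s.1 s.2 ω * perm N ω := rfl

theorem perm_append (N N' : SwapNet ι Ω) (ω : Ω) :
    perm (N ++ N') ω = perm N ω * perm N' ω := by
  induction N with
  | nil => rw [List.nil_append, perm_nil, one_mul]
  | cons s N ih => rw [List.cons_append, perm_cons, perm_cons, ih, mul_assoc]

theorem perm_reverse (N : SwapNet ι Ω) (ω : Ω) :
    perm (List.reverse N) ω = (perm N ω)⁻¹ := by
  induction N with
  | nil => rw [List.reverse_nil, perm_nil, inv_one]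
  | cons s N ih =>
    rw [List.reverse_cons, perm_append, ih, perm_cons, perm_cons, perm_nil, mul_one, mul_inv_rev,
      condSwap_inv]

theorem perm_map_apply {f : ι → κ} (hf : Function.Injective f) (φ : Ω' → Ω) (N : SwapNet ι Ω)
    (ω : Ω') (p : ι) : (N.map f φ).perm ω (f p) = f (N.perm (φ ω) p) := by
  induction N with
  | nil => rfl
  | cons s N ih =>
    change condSwap (f s.1.1, f s.1.2) (s.2 ∘ φ) ω ((SwapNet.map f φ N).perm ω (f p)) =
      f (condSwap s.1 s.2 (φ ω) (perm N (φ ω) p))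
    rw [ih]
    simp only [condSwap, Function.comp_apply]
    split_ifs
    · exact (hf.map_swap _ _ _).symm
    · rfl

omit [DecidableEq ι] in
theorem perm_map_of_notMem {f : ι → κ} (φ : Ω' → Ω) (N : SwapNet ι Ω) (ω : Ω') {p : κ}
    (hp : p ∉ Set.range f) : (N.map f φ).perm ω p = p := by
  induction N with
  | nil => rfl
  | cons s N ih =>
    change condSwap (f s.1.1, f s.1.2) (s.2 ∘ φ) ω ((SwapNet.map f φ N).perm ω p) = p
    rw [ih]
    exact condSwap_apply_of_ne_of_ne (fun h => hp ⟨_, h.symm⟩) (fun h => hp ⟨_, h.symm⟩) _ _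

omit [DecidableEq ι] [DecidableEq κ] in
theorem computes_controls_map {N : SwapNet ι Ω} {S : Set (Ω → Bool)} {S' : Set (Ω' → Bool)} {k : ℕ}
    (hN : Computes S k N.controls) (f : ι → κ) (φ : Ω' → Ω) (hS : ∀ h ∈ S, h ∘ φ ∈ S') :
    Computes S' k (N.map f φ).controls := by
  rw [controls_map]
  exact (hN.comp φ).mono_left (Set.image_subset_iff.2 hS)

theorem computes_apply (N : SwapNet ι Ω) (X : ι → Ω → Bool) {S : Set (Ω → Bool)}
    (hc : N.controls ⊆ S) (hX : ∀ p, X p ∈ S) :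
    Computes S (8 * List.length N) (Set.range fun p ω => X (N.perm ω p) ω) := by
  induction N generalizing X S with
  | nil => exact .of_subset (Set.range_subset_iff.2 hX)
  | cons s N ih =>
    rw [controls_cons, Set.union_subset_iff, Set.singleton_subset_iff] at hc
    refine ((computes_condSwap s.1 hc.1 hX).trans
      (ih (fun p ω => X (condSwap s.1 s.2 ω p) ω) (hc.2.trans Set.subset_union_left)
        fun p => .inr ⟨p, rfl⟩)).mono_cost ?_
    rw [List.length_cons]
    ring_nf
    rfl

end SwapNet

/-! ### Routing problems -/

/-- The positions of `n` elements, and infinitely many dummy positions. -/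
abbrev Slot (n : ℕ) : Type := Fin n ⊕ ℕ

/-- An array of bits, extended by zeros to the dummy positions. -/
def extendBits {n : ℕ} (x : Fin n → Bool) : Slot n → Bool := Sum.elim x fun _ => false

/-- The input wires carrying an array of `n` bits, and the constant wires. -/
def bitWires (n : ℕ) : Set ((Fin n → Bool) → Bool) :=
  constWires _ ∪ Set.range fun i x => x i

/-- Pairs of arrays of `n` bits: in a matching problem, the keys and the desired pattern. -/
abbrev BitsPair (n : ℕ) : Type := (Fin n → Bool) × (Fin n → Bool)

/-- The input wires carrying two arrays of `n` bits, and the constant wires. -/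
def pairWires (n : ℕ) : Set (BitsPair n → Bool) :=
  constWires _ ∪ ((Set.range fun i ω => ω.1 i) ∪ Set.range fun i ω => ω.2 i)

/-- Tight compaction of `n` elements by a network of at most `b` swaps whose controls are computed
from the keys with at most `a` gates. -/
def HasCompaction (n a b : ℕ) : Prop :=
  ∃ N : SwapNet (Slot n) (Fin n → Bool), List.length N ≤ b ∧
    Computes (bitWires n) a N.controls ∧
    ∀ x, ∃ σ : Equiv.Perm (Fin n), N.perm x = σ.sumCongr 1 ∧ Monotone (x ∘ σ)

/-- The permutation `π` brings elements with keys `x` into the pattern `t` and leaves the elements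
whose keys agree with the pattern in place. -/
def Repairs {ι : Type} (π : Equiv.Perm ι) (x t : ι → Bool) : Prop :=
  (∀ i, x (π i) = t i) ∧ ∀ i, x i = t i → π i = i

/-- Rearranging `n` elements such that their keys form a prescribed pattern with the right number
of ones, by a network of at most `b` swaps whose controls are computed from the keys and the pattern
with at most `a` gates. -/
def HasMatching (n a b : ℕ) : Prop :=
  ∃ N : SwapNet (Slot n) (BitsPair n), List.length N ≤ b ∧
    Computes (pairWires n) a N.controls ∧
    ∀ x t : Fin n → Bool, #{i | x i} = #{i | t i} →
      ∃ σ : Equiv.Perm (Fin n), N.perm (x, t) = σ.sumCongr 1 ∧ Repairs σ x t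

/-- Like `HasMatching`, for inputs where at most `M` keys disagree with the pattern. -/
def HasSparseMatching (n M a b : ℕ) : Prop :=
  ∃ N : SwapNet (Slot n) (BitsPair n), List.length N ≤ b ∧
    Computes (pairWires n) a N.controls ∧
    ∀ x t : Fin n → Bool, #{i | x i} = #{i | t i} → #{i | x i ^^ t i} ≤ M →
      ∃ σ : Equiv.Perm (Fin n), N.perm (x, t) = σ.sumCongr 1 ∧ Repairs σ x t

/-- Loose compaction: moving the at most `M` marked ones among `n` elements to `n'` fixed positions,
by a network of at most `b` swaps whose controls are computed from the marks with at most `a`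
gates. -/
def HasLooseCompaction (n M n' a b : ℕ) : Prop :=
  ∃ N : SwapNet (Slot n) (Fin n → Bool), List.length N ≤ b ∧
    Computes (bitWires n) a N.controls ∧
    ∃ g : Slot n' → Slot n, Function.Injective g ∧
    ∀ m : Fin n → Bool, #{i | m i} ≤ M →
      ∀ p, (∀ i, p ≠ g (.inl i)) → extendBits m (N.perm m p) = false

/-! ### Swapping misplaced elements -/

section SwapPass

variable {ι Ω : Type} [DecidableEq ι]

/-- The control of a swap that repairs two misplaced elements with different keys. -/
def repairControl (T X : ι → Ω → Bool) (e : ι × ι) (ω : Ω) : Bool :=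
  (X e.1 ω ^^ X e.2 ω) && ((X e.1 ω ^^ T e.1 ω) && (X e.2 ω ^^ T e.2 ω))

/-- The swap of two misplaced elements whenever this puts both of them in a right place. -/
def repairSwap (T X : ι → Ω → Bool) (e : ι × ι) : Ω → Equiv.Perm ι :=
  condSwap e (repairControl T X e)

/-- One pass over a list of pairs that swaps two misplaced elements whenever this puts both of them
in a right place; `X` are the keys and `T` is the desired pattern. -/
def swapPass (T : ι → Ω → Bool) : List (ι × ι) → (ι → Ω → Bool) → SwapNet ι Ω
  | [], _ => []
  | e :: E, X => (e, repairControl T X e) :: swapPass T E fun i ω => X (repairSwap T X e ω i) ω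

theorem length_swapPass (T : ι → Ω → Bool) (E : List (ι × ι)) (X : ι → Ω → Bool) :
    List.length (swapPass T E X) = E.length := by
  induction E generalizing X with
  | nil => rfl
  | cons e E ih => simp [swapPass, ih]

theorem perm_swapPass_cons (T : ι → Ω → Bool) (e : ι × ι) (E : List (ι × ι)) (X : ι → Ω → Bool)
    (ω : Ω) (i : ι) : (swapPass T (e :: E) X).perm ω i = repairSwap T X e ω
      ((swapPass T E fun i ω => X (repairSwap T X e ω i) ω).perm ω i) := rfl

variable {T X : ι → Ω → Bool} {e : ι × ι} {E : List (ι × ι)} {ω : Ω} {i : ι}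

theorem repairSwap_cases (T X : ι → Ω → Bool) (e : ι × ι) (ω : Ω) :
    (repairSwap T X e ω = 1 ∧
      (X e.1 ω ≠ T e.1 ω → X e.2 ω ≠ T e.2 ω → X e.1 ω = X e.2 ω)) ∨
    (repairSwap T X e ω = Equiv.swap e.1 e.2 ∧
      X e.1 ω ≠ X e.2 ω ∧ X e.1 ω ≠ T e.1 ω ∧ X e.2 ω ≠ T e.2 ω) := by
  cases h : repairControl T X e ω
  · refine .inl ⟨condSwap_of_false h, fun h₁ h₂ => ?_⟩
    by_contra h₀
    simp [repairControl, h₀, h₁, h₂] at h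
  · refine .inr ⟨condSwap_of_true h, ?_⟩
    simpa [repairControl] using h

theorem repairSwap_apply_of_eq (hi : X i ω = T i ω) : repairSwap T X e ω i = i := by
  rcases repairSwap_cases T X e ω with ⟨h, -⟩ | ⟨h, -, h₁, h₂⟩
  · rw [h, Equiv.Perm.one_apply]
  · rw [h, Equiv.swap_apply_of_ne_of_ne]
    · rintro rfl; exact h₁ hi
    · rintro rfl; exact h₂ hi

theorem repairSwap_apply_of_ne (hi : X (repairSwap T X e ω i) ω ≠ T i ω) :
    repairSwap T X e ω i = i := by
  rcases repairSwap_cases T X e ω with ⟨h, -⟩ | ⟨h, h₀, h₁, h₂⟩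
  · rw [h, Equiv.Perm.one_apply]
  · rw [h] at hi ⊢
    refine Equiv.swap_apply_of_ne_of_ne ?_ ?_
    · rintro rfl
      rw [Equiv.swap_apply_left] at hi
      exact hi ((Bool.eq_not_of_ne h₀.symm).trans (Bool.eq_not_of_ne h₁.symm).symm)
    · rintro rfl
      rw [Equiv.swap_apply_right] at hi
      exact hi ((Bool.eq_not_of_ne h₀).trans (Bool.eq_not_of_ne h₂.symm).symm)

theorem perm_swapPass_apply_of_eq (hi : X i ω = T i ω) :
    (swapPass T E X).perm ω i = i := by
  induction E generalizing X with
  | nil => rfl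
  | cons e E ih =>
    have hs : repairSwap T X e ω i = i := repairSwap_apply_of_eq hi
    rw [perm_swapPass_cons, ih (by simpa only [hs] using hi), hs]

theorem perm_swapPass_cons_of_ne (ih : ∀ X : ι → Ω → Bool,
      X ((swapPass T E X).perm ω i) ω ≠ T i ω → (swapPass T E X).perm ω i = i)
    (hi : X ((swapPass T (e :: E) X).perm ω i) ω ≠ T i ω) :
    (swapPass T E fun i ω => X (repairSwap T X e ω i) ω).perm ω i = i ∧
      repairSwap T X e ω i = i := by
  rw [perm_swapPass_cons] at hi
  have h := ih (fun i ω => X (repairSwap T X e ω i) ω) hi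
  exact ⟨h, repairSwap_apply_of_ne (by rwa [h] at hi)⟩

theorem perm_swapPass_apply_of_ne (hi : X ((swapPass T E X).perm ω i) ω ≠ T i ω) :
    (swapPass T E X).perm ω i = i := by
  induction E generalizing X with
  | nil => rfl
  | cons e E ih =>
    obtain ⟨h₁, h₂⟩ := perm_swapPass_cons_of_ne (fun _ => ih) hi
    rw [perm_swapPass_cons, h₁, h₂]

theorem eq_of_swapPass_ne (he : e ∈ E) (h₁ : X ((swapPass T E X).perm ω e.1) ω ≠ T e.1 ω)
    (h₂ : X ((swapPass T E X).perm ω e.2) ω ≠ T e.2 ω) : X e.1 ω = X e.2 ω := by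
  induction E generalizing X with
  | nil => simp at he
  | cons f E ih =>
    obtain ⟨h₃, h₄⟩ := perm_swapPass_cons_of_ne (fun _ => perm_swapPass_apply_of_ne) h₁
    obtain ⟨h₅, h₆⟩ := perm_swapPass_cons_of_ne (fun _ => perm_swapPass_apply_of_ne) h₂
    rcases List.mem_cons.1 he with rfl | he
    · rw [perm_swapPass_cons, h₃, h₄] at h₁
      rw [perm_swapPass_cons, h₅, h₆] at h₂
      rcases repairSwap_cases T X e ω with ⟨-, h⟩ | ⟨h, h', -⟩
      · exact h h₁ h₂
      · rw [h, Equiv.swap_apply_left] at h₄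
        exact absurd (congrArg (X · ω) h₄.symm) h'
    · simpa only [h₄, h₆] using ih (X := fun i ω => X (repairSwap T X f ω i) ω) he h₁ h₂

theorem computes_swapPass (T : ι → Ω → Bool) (E : List (ι × ι)) (X : ι → Ω → Bool)
    {S : Set (Ω → Bool)} (hT : ∀ i, T i ∈ S) (hX : ∀ i, X i ∈ S) :
    Computes S (22 * E.length) ((swapPass T E X).controls ∪
      Set.range fun i ω => X ((swapPass T E X).perm ω i) ω) := by
  induction E generalizing X S with
  | nil =>
    rw [swapPass, SwapNet.controls_nil, Set.empty_union]
    exact .of_subset (Set.range_subset_iff.2 hX)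
  | cons e E ih =>
    have mX (i) : Computes S 0 {X i} := .of_mem (hX i)
    have mT (i) : Computes S 0 {T i} := .of_mem (hT i)
    have hcontrol : Computes S 14 {repairControl T X e} :=
      ((mX e.1).xor (mX e.2)).and (((mX e.1).xor (mT e.1)).and ((mX e.2).xor (mT e.2)))
    have hswap : Computes (S ∪ {repairControl T X e}) 8
        (Set.range fun i ω => X (repairSwap T X e ω i) ω) :=
      computes_condSwap e (.inr rfl) fun i => .inl (hX i)
    have hrest := ih (fun i ω => X (repairSwap T X e ω i) ω) (S := S ∪ ({repairControl T X e} ∪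
      Set.range fun i ω => X (repairSwap T X e ω i) ω)) (fun i => .inl (hT i))
      fun i => .inr (.inr ⟨i, rfl⟩)
    refine ((hcontrol.extend hswap).extend hrest).mono subset_rfl
      (by rw [List.length_cons]; omega) ?_
    rw [swapPass, SwapNet.controls_cons, Set.union_assoc]
    exact Set.union_subset_union Set.subset_union_left subset_rfl

end SwapPass

section CardFilter

variable {α β γ : Type*} [Fintype α] [Fintype β]

theorem card_filter_eq_iff (x t : α → Bool) :
    #{i | x i} = #{i | t i} ↔ #{i | x i ∧ ¬ t i} = #{i | t i ∧ ¬ x i} := by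
  have h₁ := Finset.card_filter_add_card_filter_not (s := {i | x i}) (fun i => t i = true)
  have h₂ := Finset.card_filter_add_card_filter_not (s := {i | t i}) (fun i => x i = true)
  simp only [Finset.filter_filter] at h₁ h₂
  simp only [and_comm (a := t _ = true) (b := x _ = true)] at h₂
  omega

theorem card_filter_and_not_comp {u v : γ → Bool} (j : α ↪ γ)
    (hj : ∀ c ∉ Set.range j, u c = v c) :
    #{a | u (j a) ∧ ¬ v (j a)} = {c | u c ∧ ¬ v c}.ncard := by
  rw [← Set.ncard_coe_finset, ← Set.ncard_image_of_injective _ j.injective]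
  congr 1
  ext c
  simp only [Finset.coe_filter, Finset.mem_univ, true_and, Set.mem_image, Set.mem_ofPred_eq]
  refine ⟨?_, fun hc => ?_⟩
  · rintro ⟨a, ha, rfl⟩
    exact ha
  · by_cases hcj : c ∈ Set.range j
    · obtain ⟨a, rfl⟩ := hcj
      exact ⟨a, hc, rfl⟩
    · exact absurd (hj c hcj ▸ hc.1) hc.2

/-- Each side says that `u` and `v` have equally many ones at the positions where they differ. -/
theorem card_filter_comp_eq_iff {u v : γ → Bool} (j : α ↪ γ) (k : β ↪ γ)
    (hj : ∀ c ∉ Set.range j, u c = v c) (hk : ∀ c ∉ Set.range k, u c = v c) :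
    #{a | u (j a)} = #{a | v (j a)} ↔ #{b | u (k b)} = #{b | v (k b)} := by
  rw [card_filter_eq_iff, card_filter_eq_iff, card_filter_and_not_comp j hj,
    card_filter_and_not_comp k hk, card_filter_and_not_comp j fun c hc => (hj c hc).symm,
    card_filter_and_not_comp k fun c hc => (hk c hc).symm]

theorem card_filter_comp_perm (x : α → Bool) (σ : Equiv.Perm α) :
    #{i | x (σ i)} = #{i | x i} :=
  Finset.card_bij (fun i _ => σ i) (by simp) (fun _ _ _ _ h => σ.injective h)
    fun b hb => ⟨σ.symm b, by simpa using hb, by simp⟩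

end CardFilter

theorem exists_eq_sumCongr_one {α β : Type*} (π : Equiv.Perm (α ⊕ β))
    (hπ : ∀ b, π (.inr b) = .inr b) : ∃ σ : Equiv.Perm α, π = σ.sumCongr 1 := by
  have mapsTo_inl (ρ : Equiv.Perm (α ⊕ β)) (hρ : ∀ b, ρ (.inr b) = .inr b) (a : α) :
      ∃ a', ρ (.inl a) = .inl a' := by
    rcases h : ρ (.inl a) with a' | b
    · exact ⟨a', rfl⟩
    · cases ρ.injective (h.trans (hρ b).symm)
  choose f hf using mapsTo_inl π hπ
  have hf_bij : Function.Bijective f := by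
    refine ⟨fun a a' h => Sum.inl_injective (π.injective ?_), fun a => ?_⟩
    · rw [hf, hf, h]
    · obtain ⟨a', ha'⟩ := mapsTo_inl π.symm (fun b => by rw [Equiv.symm_apply_eq, hπ]) a
      exact ⟨a', Sum.inl_injective (by rw [← hf, ← ha', Equiv.apply_symm_apply])⟩
  refine ⟨Equiv.ofBijective f hf_bij, Equiv.ext ?_⟩
  rintro (a | b)
  · exact hf a
  · exact hπ b

namespace Repairs

variable {ι κ : Type} {x t : ι → Bool} {π ρ σ : Equiv.Perm ι}

theorem mul (hσ : ∀ i, x i = t i → σ i = i) (hρ : Repairs ρ (x ∘ σ) t) : Repairs (σ * ρ) x t := by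
  refine ⟨hρ.1, fun i hi => ?_⟩
  rw [Equiv.Perm.mul_apply, hρ.2 i (by rwa [Function.comp_apply, hσ i hi]), hσ i hi]

theorem conj (hρ : Repairs ρ (x ∘ π) (t ∘ π)) : Repairs (π * ρ * π⁻¹) x t := by
  refine ⟨fun i => ?_, fun i hi => ?_⟩
  · simpa using hρ.1 (π⁻¹ i)
  · simpa using congrArg π (hρ.2 (π⁻¹ i) (by simpa using hi))

theorem of_embedding {τ : Equiv.Perm κ} (j : κ ↪ ι) (hτ : Repairs τ (x ∘ j) (t ∘ j))
    (hj : ∀ i, ρ (j i) = j (τ i)) (hρ : ∀ p ∉ Set.range j, ρ p = p)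
    (hxt : ∀ p ∉ Set.range j, x p = t p) : Repairs ρ x t := by
  refine ⟨fun p => ?_, fun p hp => ?_⟩ <;> by_cases h : p ∈ Set.range j
  · obtain ⟨i, rfl⟩ := h
    rw [hj]
    exact hτ.1 i
  · rw [hρ p h, hxt p h]
  · obtain ⟨i, rfl⟩ := h
    rw [hj, hτ.2 i hp]
  · exact hρ p h

theorem exists_eq_sumCongr {n : ℕ} {x t : Fin n → Bool} {π : Equiv.Perm (Slot n)}
    (hπ : Repairs π (extendBits x) (extendBits t)) :
    ∃ σ : Equiv.Perm (Fin n), π = σ.sumCongr 1 ∧ Repairs σ x t := by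
  obtain ⟨σ, rfl⟩ := exists_eq_sumCongr_one π fun d => hπ.2 _ rfl
  exact ⟨σ, rfl, fun i => hπ.1 (.inl i), fun i hi => Sum.inl_injective (hπ.2 (.inl i) hi)⟩

end Repairs

/-! ### Matching through loose compaction of the misplaced elements -/

section SparseMatching

variable {n n' : ℕ}

/-- The marks of the positions where a pair of arrays of bits differs. -/
def differences (ω : BitsPair n) (i : Fin n) : Bool := ω.1 i ^^ ω.2 i

theorem computes_differences :
    Computes (pairWires n) (n * 4) (Set.range fun i ω => differences (n := n) ω i) := by
  simpa using Computes.range (S := pairWires n) (k := 4) (F := fun i ω => differences (n := n) ω i)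
    fun i => (Computes.of_mem (.inr (.inl ⟨i, rfl⟩))).xor (.of_mem (.inr (.inr ⟨i, rfl⟩)))

variable (N₁ : SwapNet (Slot n) (Fin n → Bool)) (N₂ : SwapNet (Slot n') (BitsPair n'))
  (g : Slot n' → Slot n)

/-- The keys and the pattern at the positions `g` after the differences have been compacted. -/
def compactedPair (ω : BitsPair n) : BitsPair n' :=
  (fun i => extendBits ω.1 (N₁.perm (differences ω) (g (.inl i))),
    fun i => extendBits ω.2 (N₁.perm (differences ω) (g (.inl i))))

/-- Compact the differences with `N₁`, match the compacted array with `N₂`, and undo the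
compaction. -/
def sparseMatchingNet : SwapNet (Slot n) (BitsPair n) :=
  N₁.map id differences ++
    (N₂.map g (compactedPair N₁ g) ++ List.reverse (N₁.map id differences))

theorem length_sparseMatchingNet :
    List.length (sparseMatchingNet N₁ N₂ g) = 2 * List.length N₁ + List.length N₂ := by
  simp only [sparseMatchingNet, List.length_append, List.length_reverse, SwapNet.length_map]
  ring

theorem perm_map_differences (ω : BitsPair n) :
    (N₁.map id differences).perm ω = N₁.perm (differences ω) :=
  Equiv.ext fun p => SwapNet.perm_map_apply Function.injective_id differences N₁ ω p

theorem perm_sparseMatchingNet (ω : BitsPair n) :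
    (sparseMatchingNet N₁ N₂ g).perm ω = N₁.perm (differences ω) *
      (N₂.map g (compactedPair N₁ g)).perm ω * (N₁.perm (differences ω))⁻¹ := by
  rw [sparseMatchingNet, SwapNet.perm_append, SwapNet.perm_append, SwapNet.perm_reverse,
    perm_map_differences, mul_assoc]

variable {N₁ N₂ g}

theorem computes_compactedPair {a : ℕ} (hN₁ : Computes (bitWires n) a N₁.controls) :
    Computes (pairWires n) (4 * n + a + 16 * List.length N₁) ((N₁.map id differences).controls ∪
      ((Set.range fun i ω => (compactedPair N₁ g ω).1 i) ∪
        Set.range fun i ω => (compactedPair N₁ g ω).2 i)) := by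
  have hcompact : Computes (pairWires n ∪ Set.range fun i ω => differences ω i) a
      (N₁.map id differences).controls := by
    refine SwapNet.computes_controls_map hN₁ id differences ?_
    rintro f (hf | ⟨i, rfl⟩)
    · exact .inl (.inl (comp_mem_constWires differences hf))
    · exact .inr ⟨i, rfl⟩
  have hmove {u : BitsPair n → Fin n → Bool}
      (hu : ∀ i, (fun ω => u ω i) ∈ pairWires n) :=
    (N₁.map id differences).computes_apply (fun p ω => extendBits (u ω) p)
      (S := (pairWires n ∪ Set.range fun i ω => differences ω i) ∪
        (N₁.map id differences).controls) Set.subset_union_right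
      (by rintro (i | d); exacts [.inl (.inl (hu i)), .inl (.inl (.inl false_mem_constWires))])
  have hkeys := hmove (u := Prod.fst) fun i => .inr (.inl ⟨i, rfl⟩)
  have hpattern := hmove (u := Prod.snd) fun i => .inr (.inr ⟨i, rfl⟩)
  refine (computes_differences.trans (hcompact.extend (hkeys.union hpattern))).mono subset_rfl
    (by rw [SwapNet.length_map]; omega) ?_
  simp only [perm_map_differences]
  refine Set.union_subset_union subset_rfl (Set.union_subset_union ?_ ?_) <;>
  · rintro _ ⟨i, rfl⟩
    exact ⟨g (.inl i), rfl⟩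

theorem computes_sparseMatchingNet {a₁ a₂ : ℕ} (hN₁ : Computes (bitWires n) a₁ N₁.controls)
    (hN₂ : Computes (pairWires n') a₂ N₂.controls) :
    Computes (pairWires n) (4 * n + a₁ + 16 * List.length N₁ + a₂)
      (sparseMatchingNet N₁ N₂ g).controls := by
  refine ((computes_compactedPair (g := g) hN₁).extend
    (SwapNet.computes_controls_map hN₂ g (compactedPair N₁ g) ?_)).mono_right ?_
  · rintro f (hf | ⟨i, rfl⟩ | ⟨i, rfl⟩)
    · exact .inl (.inl (comp_mem_constWires _ hf))
    · exact .inr (.inr (.inl ⟨i, rfl⟩))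
    · exact .inr (.inr (.inr ⟨i, rfl⟩))
  · rw [sparseMatchingNet, SwapNet.controls_append, SwapNet.controls_append,
      SwapNet.controls_reverse]
    rintro f (hf | hf | hf)
    exacts [.inl (.inl hf), .inr hf, .inl (.inl hf)]

theorem perm_map_of_sumCongr (hg : Function.Injective g) {φ : BitsPair n →
      BitsPair n'} {ω : BitsPair n}
    {τ : Equiv.Perm (Fin n')} (hτ : N₂.perm (φ ω) = τ.sumCongr 1) :
    (∀ i, (N₂.map g φ).perm ω (g (.inl i)) = g (.inl (τ i))) ∧
      ∀ p ∉ Set.range (g ∘ Sum.inl), (N₂.map g φ).perm ω p = p := by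
  refine ⟨fun i => ?_, fun p hp => ?_⟩
  · rw [SwapNet.perm_map_apply hg, hτ]
    rfl
  · by_cases hpg : p ∈ Set.range g
    · obtain ⟨i | d, rfl⟩ := hpg
      · exact absurd ⟨i, rfl⟩ hp
      · rw [SwapNet.perm_map_apply hg, hτ]
        rfl
    · exact SwapNet.perm_map_of_notMem _ _ _ hpg

theorem extendBits_eq_of_differences {ω : BitsPair n} {p : Slot n}
    (hp : extendBits (differences ω) p = false) : extendBits ω.1 p = extendBits ω.2 p := by
  rcases p with i | d
  · simpa [extendBits, differences] using hp
  · rfl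

theorem repairs_sparseMatchingNet {M : ℕ} (hg : Function.Injective g)
    (hN₁ : ∀ m : Fin n → Bool, #{i | m i} ≤ M →
      ∀ p, (∀ i, p ≠ g (.inl i)) → extendBits m (N₁.perm m p) = false)
    (hN₂ : ∀ x t : Fin n' → Bool, #{i | x i} = #{i | t i} →
      ∃ σ : Equiv.Perm (Fin n'), N₂.perm (x, t) = σ.sumCongr 1 ∧ Repairs σ x t)
    {x t : Fin n → Bool} (hxt : #{i | x i} = #{i | t i}) (hM : #{i | x i ^^ t i} ≤ M) :
    Repairs ((sparseMatchingNet N₁ N₂ g).perm (x, t)) (extendBits x) (extendBits t) := by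
  set π := N₁.perm (differences (x, t))
  let j : Fin n' ↪ Slot n := ⟨g ∘ Sum.inl, hg.comp Sum.inl_injective⟩
  have agree_outside : ∀ p ∉ Set.range j, extendBits x (π p) = extendBits t (π p) := fun p hp =>
    extendBits_eq_of_differences (hN₁ (differences (x, t)) hM p fun i h => hp ⟨i, h.symm⟩)
  have card_compacted : #{i | extendBits x (π (j i))} = #{i | extendBits t (π (j i))} := by
    refine (card_filter_comp_eq_iff (u := extendBits x ∘ π) (v := extendBits t ∘ π) j
      (Function.Embedding.inl.trans π.symm.toEmbedding) agree_outside ?_).2 ?_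
    · intro p hp
      rcases h : π p with i | d
      · exact absurd ⟨i, by simp [← h]⟩ hp
      · simp [h, extendBits]
    · simpa [extendBits] using hxt
  obtain ⟨τ, hτ, hτ_repairs⟩ := hN₂ _ _ card_compacted
  obtain ⟨on_range, off_range⟩ :=
    perm_map_of_sumCongr (φ := compactedPair N₁ g) (ω := (x, t)) hg hτ
  rw [perm_sparseMatchingNet]
  exact (hτ_repairs.of_embedding j on_range off_range agree_outside).conj

end SparseMatching

theorem HasLooseCompaction.hasSparseMatching {n n' M a₁ b₁ a₂ b₂ : ℕ}
    (h₁ : HasLooseCompaction n M n' a₁ b₁) (h₂ : HasMatching n' a₂ b₂) :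
    HasSparseMatching n M (4 * n + a₁ + 16 * b₁ + a₂) (2 * b₁ + b₂) := by
  obtain ⟨N₁, hb₁, ha₁, g, hg, hN₁⟩ := h₁
  obtain ⟨N₂, hb₂, ha₂, hN₂⟩ := h₂
  refine ⟨sparseMatchingNet N₁ N₂ g, ?_, (computes_sparseMatchingNet ha₁ ha₂).mono_cost (by gcongr),
    fun x t hxt hM => (repairs_sparseMatchingNet hg hN₁ hN₂ hxt hM).exists_eq_sumCongr⟩
  rw [length_sparseMatchingNet]
  gcongr

/-! ### Few misplaced elements remain after a pass over a mixing list of pairs -/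

/-- Every two sets with equally many, but more than `μ`, elements are joined by a pair in `E`. -/
def IsMixing {ι : Type} (E : List (ι × ι)) (μ : ℕ) : Prop :=
  ∀ R B : Finset ι, #R = #B → μ < #R → ∃ e ∈ E, e.1 ∈ R ∧ e.2 ∈ B

theorem IsMixing.card_misplaced_le {ι : Type} [Fintype ι] {μ : ℕ} {E : List (ι × ι)}
    (hE : IsMixing E μ) {y t : ι → Bool} (hcard : #{i | y i} = #{i | t i})
    (hpass : ∀ e ∈ E, y e.1 ≠ t e.1 → y e.2 ≠ t e.2 → y e.1 = y e.2) :
    #{i | y i ^^ t i} ≤ 2 * μ := by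
  classical
  rw [card_filter_eq_iff] at hcard
  have few_wrong_ones : #{i | y i ∧ ¬ t i} ≤ μ := by
    by_contra! hlt
    obtain ⟨e, he, h₁, h₂⟩ := hE _ _ hcard hlt
    simp only [Finset.mem_filter_univ, Bool.not_eq_true] at h₁ h₂
    have := hpass e he (by simp [h₁]) (by simp [h₂])
    simp [h₁, h₂] at this
  have misplaced_subset : ({i | y i ^^ t i} : Finset ι) ⊆
      ({i | y i ∧ ¬ t i} : Finset ι) ∪ ({i | t i ∧ ¬ y i} : Finset ι) := by
    intro i
    simp only [Finset.mem_union, Finset.mem_filter_univ]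
    cases y i <;> cases t i <;> simp
  have := (Finset.card_le_card misplaced_subset).trans (Finset.card_union_le _ _)
  omega

section MatchingOfMixing

variable {n : ℕ}

/-- A pass over the pairs `E` that repairs the keys of a matching problem. -/
def repairPass (E : List (Fin n × Fin n)) : SwapNet (Fin n) (BitsPair n) :=
  swapPass (fun i ω => ω.2 i) E fun i ω => ω.1 i

/-- The matching problem left by the pass over the pairs `E`. -/
def repairedPair (E : List (Fin n × Fin n)) (ω : BitsPair n) :
    BitsPair n :=
  (fun i => ω.1 ((repairPass E).perm ω i), ω.2)

theorem computes_repairPass_append {a : ℕ} (E : List (Fin n × Fin n))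
    {N : SwapNet (Slot n) (BitsPair n)}
    (hN : Computes (pairWires n) a N.controls) :
    Computes (pairWires n) (22 * E.length + a)
      (SwapNet.controls ((repairPass E).map Sum.inl id ++ N.map id (repairedPair E))) := by
  have hpass := computes_swapPass (S := pairWires n) (fun i ω => ω.2 i) E (fun i ω => ω.1 i)
    (fun i => .inr (.inr ⟨i, rfl⟩)) fun i => .inr (.inl ⟨i, rfl⟩)
  rw [SwapNet.controls_append, SwapNet.controls_map Sum.inl]
  refine (hpass.extend (SwapNet.computes_controls_map hN id (repairedPair E) ?_)).mono_right ?_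
  · rintro f (hf | ⟨i, rfl⟩ | ⟨i, rfl⟩)
    · exact .inl (.inl (comp_mem_constWires _ hf))
    · exact .inr (.inr ⟨i, rfl⟩)
    · exact .inl (.inr (.inr ⟨i, rfl⟩))
  · refine Set.union_subset_union ?_ subset_rfl
    rintro _ ⟨f, hf, rfl⟩
    exact .inl hf

theorem perm_repairPass_append (E : List (Fin n × Fin n))
    (N : SwapNet (Slot n) (BitsPair n))
    (ω : BitsPair n) :
    SwapNet.perm ((repairPass E).map Sum.inl id ++ N.map id (repairedPair E)) ω =
      ((repairPass E).perm ω).sumCongr 1 * N.perm (repairedPair E ω) := by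
  rw [SwapNet.perm_append]
  congr 1 <;> refine Equiv.ext fun p => ?_
  · rcases p with i | d
    · exact SwapNet.perm_map_apply Sum.inl_injective id (repairPass E) ω i
    · exact SwapNet.perm_map_of_notMem id (repairPass E) ω (by simp)
  · exact SwapNet.perm_map_apply Function.injective_id (repairedPair E) N ω p

theorem card_repairedPair_le {μ : ℕ} {E : List (Fin n × Fin n)} (hE : IsMixing E μ)
    {x t : Fin n → Bool} (hcard : #{i | (repairedPair E (x, t)).1 i} = #{i | t i}) :
    #{i | (repairedPair E (x, t)).1 i ^^ t i} ≤ 2 * μ := by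
  have stay {i} (hi : (repairedPair E (x, t)).1 i ≠ t i) : (repairedPair E (x, t)).1 i = x i :=
    congrArg x (perm_swapPass_apply_of_ne hi)
  refine hE.card_misplaced_le hcard fun e he h₁ h₂ => ?_
  rw [stay h₁, stay h₂]
  exact eq_of_swapPass_ne (T := fun i ω => ω.2 i) (X := fun i ω => ω.1 i) (ω := (x, t)) he h₁ h₂

theorem HasSparseMatching.hasMatching {a b μ : ℕ} {E : List (Fin n × Fin n)} (hE : IsMixing E μ)
    (h : HasSparseMatching n (2 * μ) a b) :
    HasMatching n (22 * E.length + a) (E.length + b) := by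
  obtain ⟨N, hb, ha, hN⟩ := h
  refine ⟨(repairPass E).map Sum.inl id ++ N.map id (repairedPair E), ?_,
    computes_repairPass_append E ha, fun x t hxt => ?_⟩
  · rw [List.length_append, SwapNet.length_map, SwapNet.length_map, repairPass, length_swapPass]
    gcongr
  · have hcard : #{i | (repairedPair E (x, t)).1 i} = #{i | t i} :=
      (card_filter_comp_perm x _).trans hxt
    obtain ⟨σ, hσ, hσ_repairs⟩ := hN _ _ hcard (card_repairedPair_le hE hcard)
    refine ⟨(repairPass E).perm (x, t) * σ, ?_, .mul (fun i hi => ?_) hσ_repairs⟩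
    · rw [perm_repairPass_append]
      change _ * N.perm ((repairedPair E (x, t)).1, t) = _
      rw [hσ, Equiv.Perm.sumCongr_mul, one_mul]
    · exact perm_swapPass_apply_of_eq hi

theorem HasMatching.of_hasLooseCompaction {n' μ a₁ b₁ a₂ b₂ : ℕ} {E : List (Fin n × Fin n)}
    (hE : IsMixing E μ) (h₁ : HasLooseCompaction n (2 * μ) n' a₁ b₁) (h₂ : HasMatching n' a₂ b₂) :
    HasMatching n (22 * E.length + (4 * n + a₁ + 16 * b₁ + a₂)) (E.length + (2 * b₁ + b₂)) :=
  (h₁.hasSparseMatching h₂).hasMatching hE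

end MatchingOfMixing

/-! ### Counting with linearly many gates -/

section Counting

variable {Ω : Type}

/-- The number of wires in a list that carry `true`. -/
def countWires (l : List (Ω → Bool)) (ω : Ω) : ℕ := l.countP fun f => f ω

theorem countWires_nil (ω : Ω) : countWires [] ω = 0 := rfl

theorem countWires_cons (x : Ω → Bool) (l : List (Ω → Bool)) (ω : Ω) :
    countWires (x :: l) ω = (x ω).toNat + countWires l ω := by
  simp only [countWires, List.countP_cons]
  cases x ω <;> simp [add_comm]

theorem countWires_le (l : List (Ω → Bool)) (ω : Ω) : countWires l ω ≤ l.length :=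
  List.countP_le_length

theorem countWires_map_toList {κ : Type*} (s : Finset κ) (F : κ → Ω → Bool) (ω : Ω) :
    countWires (s.toList.map F) ω = #{e ∈ s | F e ω} := by
  rw [countWires, List.countP_map, List.countP_eq_length_filter, Finset.card_def,
    Finset.filter_val, ← Finset.coe_toList s, Multiset.filter_coe, Multiset.coe_card]
  simp [Function.comp_def]

/-- A chain of full adders: it adds the bits of a list to `s`, and returns the last bit of the sum
and the carries. -/
def adderChain : (Ω → Bool) → List (Ω → Bool) → (Ω → Bool) × List (Ω → Bool)
  | s, [] => (s, [])
  | s, [x] => (fun ω => s ω ^^ x ω, [fun ω => s ω && x ω])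
  | s, x :: y :: l =>
    ((adderChain (fun ω => s ω ^^ (x ω ^^ y ω)) l).1,
      (fun ω => if x ω ^^ y ω then s ω else x ω) ::
        (adderChain (fun ω => s ω ^^ (x ω ^^ y ω)) l).2)

theorem countWires_cons_eq_adderChain (s : Ω → Bool) (l : List (Ω → Bool)) (ω : Ω) :
    countWires (s :: l) ω =
      ((adderChain s l).1 ω).toNat + 2 * countWires (adderChain s l).2 ω := by
  rw [countWires_cons]
  induction s, l using adderChain.induct with
  | case1 s => rfl
  | case2 s x =>
    simp only [adderChain, countWires_cons, countWires_nil]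
    cases s ω <;> cases x ω <;> rfl
  | case3 s x y l ih =>
    simp only [adderChain, countWires_cons]
    change (s ω ^^ (x ω ^^ y ω)).toNat + countWires l ω = _ at ih
    revert ih
    generalize ((adderChain (fun ω => s ω ^^ (x ω ^^ y ω)) l).1 ω).toNat = u
    cases s ω <;> cases x ω <;> cases y ω <;> simp <;> omega

theorem length_adderChain_snd (s : Ω → Bool) (l : List (Ω → Bool)) :
    2 * (adderChain s l).2.length ≤ l.length + 1 := by
  induction s, l using adderChain.induct with
  | case1 s => simp [adderChain]
  | case2 s x => simp [adderChain]
  | case3 s x y l ih =>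
    simp only [adderChain, List.length_cons]
    omega

theorem computes_fullAdder {s x y : Ω → Bool} {S : Set (Ω → Bool)} (hs : s ∈ S) (hx : x ∈ S)
    (hy : y ∈ S) : Computes S 12
      {fun ω => s ω ^^ (x ω ^^ y ω), fun ω => if x ω ^^ y ω then s ω else x ω} := by
  have hxy : Computes (S ∪ {fun ω => x ω ^^ y ω}) 0 {fun ω => x ω ^^ y ω} := .of_mem (.inr rfl)
  exact ((Computes.of_mem hx).xor (.of_mem hy)).trans
    (((Computes.of_mem (.inl hs)).xor hxy).union
      (hxy.ite (.of_mem (.inl hs)) (.of_mem (.inl hx))))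

theorem computes_adderChain (s : Ω → Bool) (l : List (Ω → Bool)) {S : Set (Ω → Bool)}
    (hs : s ∈ S) (hl : ∀ f ∈ l, f ∈ S) :
    Computes S (6 * l.length) ({(adderChain s l).1} ∪ {f | f ∈ (adderChain s l).2}) := by
  induction s, l using adderChain.induct generalizing S with
  | case1 s =>
    refine .of_subset (Set.union_subset (Set.singleton_subset_iff.2 hs) fun f hf => ?_)
    exact absurd hf List.not_mem_nil
  | case2 s x =>
    have hx := Computes.of_mem (hl x (by simp))
    refine (((Computes.of_mem hs).xor hx).union ((Computes.of_mem hs).and hx)).mono subset_rfl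
      (by simp) (Set.union_subset_union subset_rfl fun f hf => ?_)
    exact List.mem_singleton.1 hf
  | case3 s x y l ih =>
    refine ((computes_fullAdder hs (hl x (by simp)) (hl y (by simp))).extend
      (ih (.inr (.inl rfl)) fun f hf => .inl (hl f (by simp [hf])))).mono subset_rfl
        (by simp only [List.length_cons]; omega) ?_
    rintro f (hf | hf)
    · exact .inr (.inl hf)
    · exact (List.mem_cons.1 hf).imp .inr .inr

/-- The wires of the unary representation of the number `c`. -/
def thresholds (c : Ω → ℕ) : Set (Ω → Bool) := Set.range fun (i : ℕ) ω => decide (i < c ω)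

theorem mem_thresholds (c : Ω → ℕ) (i : ℕ) : (fun ω => decide (i < c ω)) ∈ thresholds c := ⟨i, rfl⟩

theorem decide_odd_lt (u : Bool) (i m : ℕ) :
    decide (2 * i + 1 < u.toNat + 2 * m) = decide (i < m) := by
  rw [decide_eq_decide]
  have := u.toNat_le
  omega

theorem decide_even_lt (u : Bool) (i m : ℕ) :
    decide (2 * i < u.toNat + 2 * m) = (decide (i < m) || (u && decide (i ≤ m))) := by
  rw [Bool.eq_iff_iff]
  cases u
  · simp
  · simp only [Bool.toNat_true, Bool.true_and, Bool.or_eq_true, decide_eq_true_eq]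
    omega

theorem decide_le_mem_of_thresholds_subset {m : Ω → ℕ} {S : Set (Ω → Bool)}
    (hc : constWires Ω ⊆ S) (hm : thresholds m ⊆ S) (i : ℕ) :
    (fun ω => decide (i ≤ m ω)) ∈ S := by
  rcases i with _ | i
  · simpa using hc true_mem_constWires
  · exact hm (mem_thresholds m i)

theorem computes_thresholds_toNat_add_two_mul {u : Ω → Bool} {c m : Ω → ℕ} {k : ℕ}
    {S : Set (Ω → Bool)} (hS : constWires Ω ⊆ S) (hu : u ∈ S) (hm : thresholds m ⊆ S)
    (hc : ∀ ω, c ω = (u ω).toNat + 2 * m ω) (hk : ∀ ω, c ω ≤ k) :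
    Computes S (k + 1) (thresholds c) := by
  have heven (i : Fin ((k + 1) / 2)) : Computes S 2 {fun ω => decide (2 * i.1 < c ω)} := by
    simp only [hc, decide_even_lt]
    exact (Computes.of_mem (hm (mem_thresholds m i))).or
      ((Computes.of_mem hu).and (.of_mem (decide_le_mem_of_thresholds_subset hS hm i)))
  refine (((Computes.of_subset (k := 0) subset_rfl).union (.range heven))).mono subset_rfl
    (by rw [Fintype.card_fin]; omega) ?_
  rintro _ ⟨i, rfl⟩
  by_cases hik : k ≤ i
  · left
    simpa [fun ω => ((hk ω).trans hik).not_gt] using hS false_mem_constWires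
  rcases Nat.even_or_odd' i with ⟨j, rfl | rfl⟩
  · exact .inr ⟨⟨j, by omega⟩, rfl⟩
  · left
    simp only [hc, decide_odd_lt]
    exact hm (mem_thresholds m j)

theorem computes_thresholds_countWires (l : List (Ω → Bool)) {S : Set (Ω → Bool)}
    (hS : constWires Ω ⊆ S) (hl : ∀ f ∈ l, f ∈ S) :
    Computes S (16 * l.length) (thresholds (countWires l)) := by
  induction hn : l.length using Nat.strong_induction_on generalizing l S with
  | _ n ih =>
  subst hn
  rcases l with _ | ⟨s, r⟩
  · refine .of_subset ?_
    rintro _ ⟨i, rfl⟩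
    simpa [countWires_nil] using hS false_mem_constWires
  have hlength := length_adderChain_snd s r
  have hadd := computes_adderChain s r (hl s (by simp)) fun f hf => hl f (by simp [hf])
  have hcarries := ih _ (by simp only [List.length_cons]; omega) (adderChain s r).2
    (S := S ∪ ({(adderChain s r).1} ∪ {f | f ∈ (adderChain s r).2})) (fun f hf => .inl (hS hf))
    (fun f hf => .inr (.inr hf)) rfl
  refine ((hadd.extend hcarries).trans (computes_thresholds_toNat_add_two_mul
    (k := (s :: r).length) (hS.trans Set.subset_union_left) (.inr (.inl (.inl rfl)))
    (Set.subset_union_right.trans Set.subset_union_right) (countWires_cons_eq_adderChain s r)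
    (countWires_le (s :: r)))).mono_cost ?_
  simp only [List.length_cons]
  omega

theorem computes_thresholds_card {κ : Type*} (s : Finset κ) (F : κ → Ω → Bool)
    {S : Set (Ω → Bool)} (hS : constWires Ω ⊆ S) (hF : ∀ e ∈ s, F e ∈ S) :
    Computes S (16 * #s) (thresholds fun ω => #{e ∈ s | F e ω}) := by
  simpa only [List.length_map, Finset.length_toList, funext (countWires_map_toList s F)] using
    computes_thresholds_countWires (s.toList.map F) hS (by simpa using hF)

end Counting

section SortedBits

variable {n : ℕ}

/-- The bits of `x` in increasing order. -/
def sortedBits (x : Fin n → Bool) (i : Fin n) : Bool := decide (i.rev.1 < #{j | x j})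

theorem monotone_sortedBits (x : Fin n → Bool) : Monotone (sortedBits x) := fun i j hij => by
  rw [Bool.le_iff_imp]
  simp only [sortedBits, decide_eq_true_eq]
  exact (Fin.val_le_of_le (Fin.rev_le_rev.2 hij)).trans_lt

theorem card_sortedBits (x : Fin n → Bool) : #{i | sortedBits x i} = #{i | x i} := by
  calc #{i | sortedBits x i} = #{i : Fin n | decide (i.1 < #{j | x j})} :=
        card_filter_comp_perm (fun i : Fin n => decide (i.1 < #{j | x j})) Fin.revPerm
    _ = #{i : Fin n | i.1 < #{j | x j}} := by simp only [decide_eq_true_eq]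
    _ = #{i | x i} := by
        rw [Fin.card_filter_val_lt, min_eq_right (card_finset_fin_le _)]

theorem computes_sortedBits (n : ℕ) :
    Computes (bitWires n) (16 * n) (Set.range fun i x => sortedBits (n := n) x i) := by
  have h := computes_thresholds_card Finset.univ (fun (i : Fin n) x => x i) (S := bitWires n)
    Set.subset_union_left fun i _ => .inr ⟨i, rfl⟩
  rw [Finset.card_fin] at h
  exact h.mono_right (Set.range_subset_iff.2 fun i => mem_thresholds _ _)

theorem HasMatching.hasCompaction {a b : ℕ} (h : HasMatching n a b) :
    HasCompaction n (a + 16 * n) b := by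
  obtain ⟨N, hb, ha, hN⟩ := h
  refine ⟨N.map id fun x => (x, sortedBits x), by rwa [SwapNet.length_map], ?_, fun x => ?_⟩
  · refine ((computes_sortedBits n).trans (SwapNet.computes_controls_map ha _ _ ?_)).mono_cost
      (add_comm _ _).le
    rintro f (hf | ⟨i, rfl⟩ | ⟨i, rfl⟩)
    · exact .inl (.inl (comp_mem_constWires _ hf))
    · exact .inl (.inr ⟨i, rfl⟩)
    · exact .inr ⟨i, rfl⟩
  · obtain ⟨σ, hσ, hσ_repairs⟩ := hN x (sortedBits x) (card_sortedBits x).symm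
    refine ⟨σ, ?_, ?_⟩
    · rw [← hσ]
      exact Equiv.ext fun p => SwapNet.perm_map_apply Function.injective_id _ N x p
    · rw [show x ∘ σ = sortedBits x from funext hσ_repairs.1]
      exact monotone_sortedBits x

end SortedBits

/-! ### Loose compaction of a grid -/

namespace SwapNet

variable {ι κ Ω : Type}

theorem controls_flatMap (N : κ → SwapNet ι Ω) (l : List κ) :
    controls (l.flatMap N) = ⋃ i ∈ l, (N i).controls := by
  ext c
  simp only [controls, List.mem_flatMap, Set.mem_iUnion, Set.mem_ofPred_eq]
  exact ⟨fun ⟨s, ⟨i, hi, hs⟩, hc⟩ => ⟨i, hi, s, hs, hc⟩,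
    fun ⟨i, hi, s, hs, hc⟩ => ⟨s, ⟨i, hi, hs⟩, hc⟩⟩

variable [DecidableEq ι]

theorem perm_flatMap_of_fixed {N : κ → SwapNet ι Ω} {ω : Ω} {p : ι} {l : List κ}
    (h : ∀ i ∈ l, (N i).perm ω p = p) : perm (l.flatMap N) ω p = p := by
  induction l with
  | nil => rfl
  | cons i l ih =>
    rw [List.forall_mem_cons] at h
    rw [List.flatMap_cons, perm_append, Equiv.Perm.mul_apply, ih h.2, h.1]

theorem perm_flatMap_of_mem {N : κ → SwapNet ι Ω} {ω : Ω} {p p' : ι} {l : List κ} (hl : l.Nodup)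
    {i : κ} (hi : i ∈ l) (hp : (N i).perm ω p = p') (h : ∀ j ≠ i, (N j).perm ω p = p)
    (h' : ∀ j ≠ i, (N j).perm ω p' = p') : perm (l.flatMap N) ω p = p' := by
  obtain ⟨s, t, rfl⟩ := List.append_of_mem hi
  obtain ⟨his, hit⟩ : i ∉ s ∧ i ∉ t := by
    rw [List.nodup_middle, List.nodup_cons, List.mem_append, not_or] at hl
    exact hl.1
  rw [List.flatMap_append, List.flatMap_cons, perm_append, perm_append, Equiv.Perm.mul_apply,
    Equiv.Perm.mul_apply, perm_flatMap_of_fixed fun j hj => h j fun e => hit (e ▸ hj), hp,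
    perm_flatMap_of_fixed fun j hj => h' j fun e => his (e ▸ hj)]

end SwapNet

section SideBySide

variable {n B q : ℕ} {Ω Ω' : Type}

/-- Copies of `N`, side by side on the parts `f i` of an array; the `i`-th copy reads its input
through `φ i`. -/
def sideBySide (N : SwapNet (Slot B) Ω') (f : Fin q → Fin B → Fin n) (φ : Fin q → Ω → Ω') :
    SwapNet (Slot n) Ω :=
  (List.finRange q).flatMap fun i => N.map (Sum.map (f i) id) (φ i)

theorem length_sideBySide (N : SwapNet (Slot B) Ω') (f : Fin q → Fin B → Fin n)
    (φ : Fin q → Ω → Ω') : List.length (sideBySide N f φ) = q * List.length N := by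
  simp [sideBySide, List.length_flatMap, SwapNet.length_map]

theorem controls_sideBySide (N : SwapNet (Slot B) Ω') (f : Fin q → Fin B → Fin n)
    (φ : Fin q → Ω → Ω') : (sideBySide N f φ).controls = ⋃ i, (· ∘ φ i) '' N.controls := by
  simp only [sideBySide, SwapNet.controls_flatMap, SwapNet.controls_map, List.mem_finRange,
    Set.iUnion_true]

variable {f : Fin q → Fin B → Fin n}

theorem sideBySide_perm_inl (hf : f.Injective2) {N : SwapNet (Slot B) Ω'} {φ : Fin q → Ω → Ω'}
    {ω : Ω} {σ : Fin q → Equiv.Perm (Fin B)} (hσ : ∀ i, N.perm (φ i ω) = (σ i).sumCongr 1)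
    (i : Fin q) (j : Fin B) :
    (sideBySide N f φ).perm ω (.inl (f i j)) = .inl (f i (σ i j)) := by
  have other_fixes : ∀ k ≠ i, ∀ j,
      (N.map (Sum.map (f k) id) (φ k)).perm ω (.inl (f i j)) = .inl (f i j) := fun k hk j =>
    SwapNet.perm_map_of_notMem _ _ _ fun
      | ⟨.inl j', h⟩ => hk (hf (Sum.inl_injective h)).1
      | ⟨.inr _, h⟩ => Sum.inr_ne_inl h
  refine SwapNet.perm_flatMap_of_mem (List.nodup_finRange q) (List.mem_finRange i) ?_
    (other_fixes · · j) (other_fixes · · _)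
  refine (SwapNet.perm_map_apply ((hf.right i).sumMap Function.injective_id) _ N ω
    (.inl j)).trans ?_
  rw [hσ]
  rfl

theorem sideBySide_perm_inr (hf : f.Injective2) {N : SwapNet (Slot B) Ω'} {φ : Fin q → Ω → Ω'}
    {ω : Ω} {σ : Fin q → Equiv.Perm (Fin B)} (hσ : ∀ i, N.perm (φ i ω) = (σ i).sumCongr 1)
    (d : ℕ) : (sideBySide N f φ).perm ω (.inr d) = .inr d :=
  SwapNet.perm_flatMap_of_fixed fun i _ => by
    refine (SwapNet.perm_map_apply ((hf.right i).sumMap Function.injective_id) _ N ω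
      (.inr d)).trans ?_
    rw [hσ]
    rfl

end SideBySide

theorem Computes.range_not {Ω ι : Type} [Fintype ι] {S : Set (Ω → Bool)} {F : ι → Ω → Bool}
    (h : ∀ i, F i ∈ S) : Computes S (Fintype.card ι) (Set.range fun i ω => !(F i ω)) := by
  simpa using Computes.range fun i => (Computes.of_mem (h i)).not

section Grid

variable {n q B : ℕ}

/-- Compacts every row of the grid `f`, marked elements first. -/
def rowPass (N : SwapNet (Slot B) (Fin B → Bool)) (f : Fin q → Fin B → Fin n) :
    SwapNet (Slot n) (Fin n → Bool) :=
  sideBySide N f fun i m j => !(m (f i j))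

/-- Whether row `i` is unmarked in column `θ` after the row pass. As the row is then compacted,
this says that it holds at most `θ` marks. -/
def rowKey (N : SwapNet (Slot B) (Fin B → Bool)) (f : Fin q → Fin B → Fin n) (θ : Fin B)
    (m : Fin n → Bool) (i : Fin q) : Bool :=
  !(extendBits m ((rowPass N f).perm m (.inl (f i θ))))

/-- Sorts the rows of the grid by `rowKey`; all columns use the same controls. -/
def columnPass (N : SwapNet (Slot B) (Fin B → Bool)) (N' : SwapNet (Slot q) (Fin q → Bool))
    (f : Fin q → Fin B → Fin n) (θ : Fin B) : SwapNet (Slot n) (Fin n → Bool) :=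
  sideBySide N' (fun j i => f i j) fun _ => rowKey N f θ

variable {f : Fin q → Fin B → Fin n} {N : SwapNet (Slot B) (Fin B → Bool)}
  {N' : SwapNet (Slot q) (Fin q → Bool)} {θ : Fin B} {a : ℕ}

theorem computes_controls_rowPass (hN : Computes (bitWires B) a N.controls) :
    Computes (bitWires n) (n + q * a) (rowPass N f).controls := by
  have negations : Computes (bitWires n) n (Set.range fun i (m : Fin n → Bool) => !(m i)) := by
    simpa using Computes.range_not fun i => (.inr ⟨i, rfl⟩ : (fun m => m i) ∈ bitWires n)
  refine negations.trans ?_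
  rw [rowPass, controls_sideBySide]
  have row (i : Fin q) : Computes (bitWires n ∪ Set.range fun i (m : Fin n → Bool) => !(m i)) a
      ((· ∘ fun (m : Fin n → Bool) j => !(m (f i j))) '' N.controls) := by
    refine (hN.comp _).mono_left ?_
    rintro _ ⟨g, hg | ⟨j, rfl⟩, rfl⟩
    · exact .inl (.inl (comp_mem_constWires _ hg))
    · exact .inr ⟨f i j, rfl⟩
  simpa using Computes.iUnion row

theorem computes_rowKey :
    Computes (bitWires n ∪ (rowPass N f).controls) (8 * (q * List.length N) + q)
      (Set.range fun i m => rowKey N f θ m i) := by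
  have h := (rowPass N f).computes_apply (fun p m => extendBits m p)
    (Set.subset_union_right (s := bitWires n)) (by
      rintro (i | d)
      · exact .inl (.inr ⟨i, rfl⟩)
      · exact .inl (.inl false_mem_constWires))
  rw [rowPass, length_sideBySide] at h
  refine h.trans ?_
  have keys := Computes.range_not fun i : Fin q => Set.mem_union_right
    (bitWires n ∪ (rowPass N f).controls) (Set.mem_range_self (f := fun p m =>
      extendBits m ((rowPass N f).perm m p)) (.inl (f i θ)))
  rwa [Fintype.card_fin] at keys

theorem computes_controls_columnPass (hN' : Computes (bitWires q) a N'.controls) :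
    Computes (bitWires n ∪ Set.range fun i m => rowKey N f θ m i) a
      (columnPass N N' f θ).controls := by
  rw [columnPass, controls_sideBySide]
  refine (hN'.comp (rowKey N f θ)).mono ?_ le_rfl (Set.iUnion_subset fun _ => subset_rfl)
  rintro _ ⟨g, hg | ⟨j, rfl⟩, rfl⟩
  · exact .inl (.inl (comp_mem_constWires _ hg))
  · exact .inr ⟨j, rfl⟩

theorem mul_le_card_of_antitone {y : Fin q → Fin B → Bool} (hrow : ∀ i, Antitone (y i))
    (hcol : Antitone fun i => y i θ) {i : Fin q} (hi : y i θ) :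
    (i.1 + 1) * (θ.1 + 1) ≤ #{p : Fin q × Fin B | y p.1 p.2} := by
  have hsub : Finset.Iic i ×ˢ Finset.Iic θ ⊆ ({p | y p.1 p.2} : Finset (Fin q × Fin B)) := by
    intro p hp
    rw [Finset.mem_product, Finset.mem_Iic, Finset.mem_Iic] at hp
    rw [Finset.mem_filter_univ]
    exact Bool.le_iff_imp.1 (hrow p.1 hp.2) (Bool.le_iff_imp.1 (hcol hp.1) hi)
  simpa using Finset.card_le_card hsub

theorem antitone_of_monotone_not {α : Type*} [Preorder α] {x : α → Bool}
    (h : Monotone fun i => !(x i)) : Antitone x := fun i j hij => by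
  simpa using compl_le_compl (h hij)

theorem grid_mark_sparse (hf : f.Injective2) {m : Fin n → Bool} {σ : Fin q → Equiv.Perm (Fin B)}
    {τ : Equiv.Perm (Fin q)} (hσ : ∀ i, Monotone fun j => !(m (f i (σ i j))))
    (hτ : Monotone fun i => !(m (f (τ i) (σ (τ i) θ)))) {i : Fin q} {j : Fin B} (hj : θ ≤ j)
    (hm : m (f (τ i) (σ (τ i) j))) : (i.1 + 1) * (θ.1 + 1) ≤ #{r | m r} := by
  have hrow (i : Fin q) : Antitone fun j => m (f (τ i) (σ (τ i) j)) :=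
    antitone_of_monotone_not (hσ (τ i))
  refine (mul_le_card_of_antitone hrow (antitone_of_monotone_not hτ)
    (Bool.le_iff_imp.1 (hrow i hj) hm)).trans ?_
  refine Finset.card_le_card_of_injOn (fun p => f (τ p.1) (σ (τ p.1) p.2))
    (fun p hp => by simpa using hp) ?_
  rintro ⟨i, j⟩ - ⟨i', j'⟩ - h
  obtain rfl := τ.injective (hf h).1
  exact Prod.ext rfl ((σ (τ i)).injective (hf h).2)

/-- The positions which may still carry a mark after both passes. -/
def residualPositions (f : Fin q → Fin B → Fin n) (θ : Fin B) (E : ℕ) : Finset (Fin n) :=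
  {r | ∀ i j, f i j = r → j < θ ∨ i.1 < E}

theorem card_residualPositions_le (hf : f.Injective2) (E : ℕ) :
    #(residualPositions f θ E) ≤ E * B + q * θ + (n - q * B) := by
  let early : Finset (Fin q × Fin B) := ({i | i.1 < E} : Finset (Fin q)) ×ˢ Finset.univ
  let left : Finset (Fin q × Fin B) := Finset.univ ×ˢ ({j | j.1 < θ.1} : Finset (Fin B))
  let outside : Finset (Fin n) := Finset.univ \ Finset.univ.image (Function.uncurry f)
  have hsub : residualPositions f θ E ⊆
      (early ∪ left).image (Function.uncurry f) ∪ outside := fun r hr => by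
    rw [residualPositions, Finset.mem_filter_univ] at hr
    by_cases hex : ∃ p, Function.uncurry f p = r
    · obtain ⟨⟨i, j⟩, rfl⟩ := hex
      refine Finset.mem_union_left _ (Finset.mem_image_of_mem _ ?_)
      simpa [early, left, or_comm] using hr i j rfl
    · exact Finset.mem_union_right _ (by simpa [outside] using hex)
  have hearly : #early ≤ E * B := by
    rw [Finset.card_product, Fin.card_filter_val_lt, Finset.card_fin]
    exact Nat.mul_le_mul_right B (min_le_right q E)
  have hleft : #left ≤ q * θ := by
    rw [Finset.card_product, Fin.card_filter_val_lt, Finset.card_fin]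
    exact Nat.mul_le_mul_left q (min_le_right B θ)
  have houtside : #outside = n - q * B := by
    rw [Finset.card_sdiff_of_subset (Finset.subset_univ _),
      Finset.card_image_of_injective _ hf.uncurry]
    simp
  calc #(residualPositions f θ E)
      ≤ #((early ∪ left).image (Function.uncurry f)) + #outside :=
        (Finset.card_le_card hsub).trans (Finset.card_union_le _ _)
    _ ≤ #early + #left + #outside :=
        Nat.add_le_add_right (Finset.card_image_le.trans (Finset.card_union_le _ _)) _
    _ ≤ E * B + q * θ + (n - q * B) := by rw [houtside]; gcongr

theorem extendBits_columnPass_rowPass (hf : f.Injective2)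
    (hN : ∀ x, ∃ σ : Equiv.Perm (Fin B), N.perm x = σ.sumCongr 1 ∧ Monotone (x ∘ σ))
    (hN' : ∀ x, ∃ σ : Equiv.Perm (Fin q), N'.perm x = σ.sumCongr 1 ∧ Monotone (x ∘ σ))
    {E : ℕ} {m : Fin n → Bool} (hm : #{r | m r} < (E + 1) * (θ.1 + 1)) {p : Slot n}
    (hp : ∀ r ∈ residualPositions f θ E, p ≠ .inl r) :
    extendBits m ((rowPass N f).perm m ((columnPass N N' f θ).perm m p)) = false := by
  choose σ hσ hσ_mono using fun i => hN fun j => !(m (f i j))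
  obtain ⟨τ, hτ, hτ_mono⟩ := hN' (rowKey N f θ m)
  have hf' : Function.Injective2 fun j i => f i j := fun _ _ _ _ h => (hf h).symm
  have hrow (i j) : (rowPass N f).perm m (.inl (f i j)) = .inl (f i (σ i j)) :=
    sideBySide_perm_inl hf hσ i j
  have hcol (i j) : (columnPass N N' f θ).perm m (.inl (f i j)) = .inl (f (τ i) j) :=
    sideBySide_perm_inl hf' (fun _ => hτ) j i
  rcases p with r | d
  · have hr : r ∉ residualPositions f θ E := fun h => hp r h rfl
    simp only [residualPositions, Finset.mem_filter_univ, not_forall, not_or, not_lt] at hr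
    obtain ⟨i, j, rfl, hj, hi⟩ := hr
    rw [hcol, hrow]
    by_contra hmark
    have hτ_mono' : Monotone fun i => !(m (f (τ i) (σ (τ i) θ))) := by
      simpa only [Function.comp_def, rowKey, hrow, extendBits, Sum.elim_inl] using hτ_mono
    have hsparse : (i.1 + 1) * (θ.1 + 1) ≤ #{r | m r} :=
      grid_mark_sparse hf hσ_mono hτ_mono' hj (by simpa [extendBits] using hmark)
    exact absurd hm ((Nat.mul_le_mul_right _ (Nat.succ_le_succ hi)).trans hsparse).not_gt
  · rw [columnPass, sideBySide_perm_inr hf' fun _ => hτ, rowPass, sideBySide_perm_inr hf hσ]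
    rfl

/-- Only `E` rows can hold more than `θ` of fewer than `(E + 1) * (θ + 1)` marks. -/
theorem HasCompaction.hasLooseCompaction {M θ E aB bB aq bq : ℕ} (hB : HasCompaction B aB bB)
    (hq : HasCompaction q aq bq) (hn : q * B ≤ n) (hθ : θ < B) (hM : M < (E + 1) * (θ + 1)) :
    ∃ n' ≤ E * B + q * θ + (n - q * B),
      HasLooseCompaction n M n' (q * aB + aq + 8 * (q * bB) + 2 * n) (q * bB + B * bq) := by
  obtain ⟨N, hbN, haN, hN⟩ := hB
  obtain ⟨N', hbN', haN', hN'⟩ := hq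
  let f : Fin q → Fin B → Fin n := fun i j => Fin.castLE hn (finProdFinEquiv (i, j))
  have hf : f.Injective2 := fun i i' j j' h =>
    Prod.mk.inj (finProdFinEquiv.injective (Fin.castLE_injective hn h))
  let P := residualPositions f ⟨θ, hθ⟩ E
  refine ⟨#P, card_residualPositions_le hf E, rowPass N f ++ columnPass N N' f ⟨θ, hθ⟩, ?_, ?_,
    Sum.map (fun k => (P.equivFin.symm k).1) id,
    (Subtype.val_injective.comp P.equivFin.symm.injective).sumMap Function.injective_id,
    fun m hm p hp => ?_⟩
  · rw [List.length_append, rowPass, columnPass, length_sideBySide, length_sideBySide]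
    gcongr
  · have hrow := computes_controls_rowPass (n := n) (f := f) haN
    have hkey := computes_rowKey (N := N) (f := f) (θ := ⟨θ, hθ⟩)
    have hcol := computes_controls_columnPass (N := N) (f := f) (θ := ⟨θ, hθ⟩) haN'
    have hkeycol := hkey.trans (hcol.mono_left
      (Set.union_subset_union_left _ Set.subset_union_left))
    rw [SwapNet.controls_append]
    refine (hrow.extend hkeycol).mono_cost ?_
    have hqn : q ≤ n := (Nat.le_mul_of_pos_right q (by omega)).trans hn
    have := Nat.mul_le_mul_left q hbN
    omega
  · rw [SwapNet.perm_append, Equiv.Perm.mul_apply]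
    refine extendBits_columnPass_rowPass hf hN hN' (hm.trans_lt hM) fun r hr => ?_
    simpa using hp (P.equivFin ⟨r, hr⟩)

end Grid

/-! ### Mixing lists and expanders from the union bound -/

theorem exists_forall_notMem_of_sum_card_lt {α β : Type*} [Fintype α] (s : Finset β)
    (bad : β → Finset α) (h : ∑ b ∈ s, (#(bad b) : ℝ) < Fintype.card α) :
    ∃ a, ∀ b ∈ s, a ∉ bad b := by
  classical
  by_contra! hcover
  have hsub : Finset.univ ⊆ s.biUnion bad := fun a _ => Finset.mem_biUnion.2 (hcover a)
  have hle : Fintype.card α ≤ ∑ b ∈ s, #(bad b) :=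
    (Finset.card_le_card hsub).trans Finset.card_biUnion_le
  exact absurd h (not_lt.2 (by exact_mod_cast hle))

theorem one_sub_inv_sq_nonneg {h : ℕ} (hh : 1 ≤ h) : 0 ≤ 1 - 1 / (h : ℝ) ^ 2 := by
  rw [sub_nonneg, div_le_one (by positivity)]
  exact one_le_pow₀ (by exact_mod_cast hh)

theorem card_compl_product_le {n h : ℕ} (hh : 1 ≤ h) {R B : Finset (Fin n)} (hR : n / h < #R)
    (hB : n / h < #B) : (#(R ×ˢ B)ᶜ : ℝ) ≤ (1 - 1 / (h : ℝ) ^ 2) * (n : ℝ) ^ 2 := by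
  have div_le {S : Finset (Fin n)} (hS : n / h < #S) : (n : ℝ) / h ≤ #S := by
    rw [div_le_iff₀ (by positivity)]
    exact_mod_cast ((Nat.div_lt_iff_lt_mul hh).1 hS).le
  have hprod : (n : ℝ) / h * (n / h) ≤ #R * #B := by
    gcongr
    exacts [div_le hR, div_le hB]
  rw [Finset.card_compl, Nat.cast_sub (Finset.card_le_univ _), Finset.card_product]
  simp only [Fintype.card_prod, Fintype.card_fin, Nat.cast_mul]
  calc (n * n - #R * #B : ℝ) ≤ n * n - n / h * (n / h) := by gcongr
    _ = (1 - 1 / (h : ℝ) ^ 2) * (n : ℝ) ^ 2 := by field_simp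

theorem exists_isMixing_of_lt {n h k : ℕ} (hh : 1 ≤ h)
    (hlt : (4 : ℝ) ^ n * ((1 - 1 / (h : ℝ) ^ 2) * (n : ℝ) ^ 2) ^ k < ((n : ℝ) ^ 2) ^ k) :
    ∃ E : List (Fin n × Fin n), E.length = k ∧ IsMixing E (n / h) := by
  let large : Finset (Finset (Fin n) × Finset (Fin n)) := {p | n / h < #p.1 ∧ n / h < #p.2}
  let avoiding (p : Finset (Fin n) × Finset (Fin n)) : Finset (Fin k → Fin n × Fin n) :=
    Fintype.piFinset fun _ => (p.1 ×ˢ p.2)ᶜ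
  have card_avoiding_le (p) (hp : p ∈ large) :
      (#(avoiding p) : ℝ) ≤ ((1 - 1 / (h : ℝ) ^ 2) * (n : ℝ) ^ 2) ^ k := by
    rw [Finset.mem_filter_univ] at hp
    rw [Fintype.card_piFinset_const, Nat.cast_pow]
    exact pow_le_pow_left₀ (Nat.cast_nonneg _) (card_compl_product_le hh hp.1 hp.2) _
  have card_large_le : (#large : ℝ) ≤ 4 ^ n := by
    have : #large ≤ 2 ^ n * 2 ^ n := (Finset.card_le_univ _).trans (by simp)
    calc (#large : ℝ) ≤ 2 ^ n * 2 ^ n := by exact_mod_cast this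
      _ = 4 ^ n := by rw [← mul_pow]; norm_num
  have hsum : ∑ p ∈ large, (#(avoiding p) : ℝ) < Fintype.card (Fin k → Fin n × Fin n) := by
    calc ∑ p ∈ large, (#(avoiding p) : ℝ)
        ≤ #large * ((1 - 1 / (h : ℝ) ^ 2) * (n : ℝ) ^ 2) ^ k := by
          rw [← nsmul_eq_mul]
          exact Finset.sum_le_card_nsmul _ _ _ card_avoiding_le
      _ ≤ 4 ^ n * ((1 - 1 / (h : ℝ) ^ 2) * (n : ℝ) ^ 2) ^ k := by
          refine mul_le_mul_of_nonneg_right card_large_le (pow_nonneg ?_ _)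
          exact mul_nonneg (one_sub_inv_sq_nonneg hh) (sq_nonneg _)
      _ < ((n : ℝ) ^ 2) ^ k := hlt
      _ = _ := by simp [sq]
  obtain ⟨e, he⟩ := exists_forall_notMem_of_sum_card_lt large avoiding hsum
  refine ⟨List.ofFn e, List.length_ofFn, fun R B hRB hR => ?_⟩
  have := he (R, B) ((Finset.mem_filter_univ _).2 ⟨hR, hRB ▸ hR⟩)
  simpa [avoiding, List.mem_ofFn] using this

theorem exists_isMixing {h : ℕ} (hh : 1 ≤ h) :
    ∃ D : ℕ, ∀ n : ℕ, ∃ E : List (Fin n × Fin n), E.length = D * n ∧ IsMixing E (n / h) := by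
  set δ : ℝ := 1 - 1 / (h : ℝ) ^ 2
  have hδ_nonneg : 0 ≤ δ := one_sub_inv_sq_nonneg hh
  have hδ_lt_one : δ < 1 := sub_lt_self _ (by positivity)
  obtain ⟨D, hD⟩ := exists_pow_lt_of_lt_one (show (0 : ℝ) < 1 / 4 by norm_num) hδ_lt_one
  refine ⟨D, fun n => ?_⟩
  rcases n.eq_zero_or_pos with rfl | hn
  · exact ⟨[], rfl, fun R _ _ hR => by simp [Finset.eq_empty_of_isEmpty R] at hR⟩
  refine exists_isMixing_of_lt hh ?_
  calc 4 ^ n * (δ * (n : ℝ) ^ 2) ^ (D * n) = (4 * δ ^ D) ^ n * ((n : ℝ) ^ 2) ^ (D * n) := by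
        rw [mul_pow δ, mul_pow 4 (δ ^ D), ← pow_mul δ, mul_assoc]
    _ < 1 * ((n : ℝ) ^ 2) ^ (D * n) := by
        gcongr
        exact pow_lt_one₀ (by positivity) (by linarith) hn.ne'
    _ = ((n : ℝ) ^ 2) ^ (D * n) := one_mul _

section Expander

variable {n m : ℕ}

/-- The vertices joined to `S` in the bipartite graph of left degree 8 in which `Γ (u, j)` is the
right end of the `j`-th edge at the left vertex `u`. -/
def neighbors (Γ : Fin n × Fin 8 → Fin m) (S : Finset (Fin n)) : Finset (Fin m) :=
  (S ×ˢ Finset.univ).image Γ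

/-- Small sets of left vertices have more than `6 = 3/4 * 8` times as many neighbours. The bound
`n / 3000000` on their size is what the union bound needs when `n ≤ 3 * m`. -/
def IsExpander (Γ : Fin n × Fin 8 → Fin m) : Prop :=
  ∀ S : Finset (Fin n), S.Nonempty → 3000000 * #S ≤ n → 6 * #S < #(neighbors Γ S)

theorem choose_mul_self_pow_le (n s : ℕ) : (n.choose s : ℝ) * (s : ℝ) ^ s ≤ (3 * n : ℝ) ^ s := by
  have hexp : (s : ℝ) ^ s / s.factorial ≤ 3 ^ s :=
    calc (s : ℝ) ^ s / s.factorial ≤ Real.exp s :=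
          Real.pow_div_factorial_le_exp _ (Nat.cast_nonneg s) s
      _ = Real.exp 1 ^ s := (Real.exp_one_pow s).symm
      _ ≤ 3 ^ s := by gcongr; linarith [Real.exp_one_lt_d9]
  calc (n.choose s : ℝ) * (s : ℝ) ^ s ≤ (n : ℝ) ^ s / s.factorial * (s : ℝ) ^ s := by
        gcongr
        exact Nat.choose_le_pow_div s n
    _ = (s : ℝ) ^ s / s.factorial * (n : ℝ) ^ s := by ring
    _ ≤ 3 ^ s * (n : ℝ) ^ s := by gcongr
    _ = (3 * n : ℝ) ^ s := (mul_pow _ _ _).symm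

theorem choose_mul_choose_mul_pow_le {s : ℕ} (hm : n ≤ 3 * m) (hsn : 3000000 * s ≤ n) :
    (n.choose s : ℝ) * (m.choose (6 * s) : ℝ) * (6 * s : ℝ) ^ (8 * s) ≤
      (1 / 4) ^ s * (m : ℝ) ^ (8 * s) := by
  rcases s.eq_zero_or_pos with rfl | hs
  · simp
  have hleft := choose_mul_self_pow_le n s
  have hright := choose_mul_self_pow_le m (6 * s)
  push_cast at hright
  have hm' : (n : ℝ) ≤ 3 * m := by exact_mod_cast hm
  have hsn' : 3000000 * (s : ℝ) ≤ n := by exact_mod_cast hsn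
  have hbase : (3 * n * (3 * m) ^ 6 * (6 * s) ^ 2 : ℝ) ≤ 1 / 4 * (m : ℝ) ^ 8 * s :=
    calc (3 * n * (3 * m) ^ 6 * (6 * s) ^ 2 : ℝ) = 78732 * n * s * ((m : ℝ) ^ 6 * s) := by ring
      _ ≤ 1 / 4 * m * m * ((m : ℝ) ^ 6 * s) := by
          refine mul_le_mul_of_nonneg_right ?_ (by positivity)
          nlinarith
      _ = 1 / 4 * (m : ℝ) ^ 8 * s := by ring
  have hpos : (0 : ℝ) < (s : ℝ) ^ s := by positivity
  rw [← mul_le_mul_iff_of_pos_right hpos]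
  calc (n.choose s : ℝ) * (m.choose (6 * s) : ℝ) * (6 * s : ℝ) ^ (8 * s) * (s : ℝ) ^ s
      = ((n.choose s : ℝ) * (s : ℝ) ^ s) * ((m.choose (6 * s) : ℝ) * (6 * s : ℝ) ^ (6 * s)) *
          (6 * s : ℝ) ^ (2 * s) := by
        rw [show 8 * s = 6 * s + 2 * s by ring, pow_add]; ring
    _ ≤ (3 * n : ℝ) ^ s * (3 * m : ℝ) ^ (6 * s) * (6 * s : ℝ) ^ (2 * s) := by gcongr
    _ = (3 * n * (3 * m) ^ 6 * (6 * s) ^ 2 : ℝ) ^ s := by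
        rw [pow_mul (3 * m : ℝ) 6 s, pow_mul (6 * s : ℝ) 2 s, ← mul_pow, ← mul_pow]
    _ ≤ (1 / 4 * (m : ℝ) ^ 8 * s) ^ s := by gcongr
    _ = (1 / 4) ^ s * (m : ℝ) ^ (8 * s) * (s : ℝ) ^ s := by rw [mul_pow, mul_pow, ← pow_mul]

theorem card_piFinset_ite_mem {α β : Type*} [Fintype α] [DecidableEq α] [Fintype β] (s : Finset α)
    (t : Finset β) : #(Fintype.piFinset fun a => if a ∈ s then t else Finset.univ) =
      #t ^ #s * Fintype.card β ^ (Fintype.card α - #s) := by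
  simp only [Fintype.card_piFinset, apply_ite Finset.card, Finset.prod_ite, Finset.prod_const,
    Finset.filter_mem_eq_inter, Finset.univ_inter, Finset.card_univ, Finset.filter_notMem_eq_sdiff,
    ← Finset.compl_eq_univ_sdiff, Finset.card_compl]

/-- The graphs in which all neighbours of `S` are in `T`. -/
def confinedGraphs (S : Finset (Fin n)) (T : Finset (Fin m)) : Finset (Fin n × Fin 8 → Fin m) :=
  Fintype.piFinset fun e => if e ∈ S ×ˢ Finset.univ then T else Finset.univ

theorem mem_confinedGraphs {Γ : Fin n × Fin 8 → Fin m} {S : Finset (Fin n)} {T : Finset (Fin m)} :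
    Γ ∈ confinedGraphs S T ↔ neighbors Γ S ⊆ T := by
  rw [confinedGraphs, Fintype.mem_piFinset, neighbors, Finset.image_subset_iff]
  exact forall_congr' fun e => by split_ifs with he <;> simp [he]

theorem sum_card_confinedGraphs_le {s : ℕ} (hm : n ≤ 3 * m) (hsn : 3000000 * s ≤ n) :
    ∑ p ∈ Finset.powersetCard s Finset.univ ×ˢ Finset.powersetCard (6 * s) Finset.univ,
      (#(confinedGraphs (n := n) (m := m) p.1 p.2) : ℝ) ≤ (1 / 4) ^ s * (m : ℝ) ^ (n * 8) := by
  have hcard : ∀ p ∈ Finset.powersetCard s (Finset.univ : Finset (Fin n)) ×ˢ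
      Finset.powersetCard (6 * s) (Finset.univ : Finset (Fin m)),
      (#(confinedGraphs p.1 p.2) : ℝ) = (6 * s : ℝ) ^ (8 * s) * (m : ℝ) ^ (n * 8 - 8 * s) := by
    intro p hp
    rw [Finset.mem_product, Finset.mem_powersetCard_univ, Finset.mem_powersetCard_univ] at hp
    rw [confinedGraphs, card_piFinset_ite_mem, Finset.card_product, hp.1, hp.2]
    simp [mul_comm s]
  rw [Finset.sum_congr rfl hcard, Finset.sum_const, Finset.card_product, Finset.card_powersetCard,
    Finset.card_powersetCard, Finset.card_fin, Finset.card_fin, nsmul_eq_mul, Nat.cast_mul]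
  calc (n.choose s * m.choose (6 * s) * ((6 * s) ^ (8 * s) * (m : ℝ) ^ (n * 8 - 8 * s)) : ℝ)
      = n.choose s * m.choose (6 * s) * (6 * s) ^ (8 * s) * (m : ℝ) ^ (n * 8 - 8 * s) := by ring
    _ ≤ (1 / 4) ^ s * (m : ℝ) ^ (8 * s) * (m : ℝ) ^ (n * 8 - 8 * s) := by
        gcongr ?_ * _
        exact choose_mul_choose_mul_pow_le hm hsn
    _ = (1 / 4) ^ s * (m : ℝ) ^ (n * 8) := by
        rw [mul_assoc, ← pow_add, Nat.add_sub_cancel' (by omega)]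

theorem exists_isExpander (hm : n ≤ 3 * m) : ∃ Γ : Fin n × Fin 8 → Fin m, IsExpander Γ := by
  rcases n.eq_zero_or_pos with rfl | hn
  · exact ⟨fun e => e.1.elim0, fun _ ⟨u, _⟩ => u.elim0⟩
  let sizes := Finset.Ico 1 (n / 3000000 + 1)
  let pairs (s : ℕ) : Finset (Finset (Fin n) × Finset (Fin m)) :=
    Finset.powersetCard s Finset.univ ×ˢ Finset.powersetCard (6 * s) Finset.univ
  have hgeom : ∑ s ∈ sizes, (1 / 4 : ℝ) ^ s < 1 :=
    (geom_sum_Ico_le_of_lt_one (by norm_num) (by norm_num)).trans_lt (by norm_num)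
  have hsum : ∑ p ∈ sizes.sigma pairs, (#(confinedGraphs p.2.1 p.2.2) : ℝ) <
      Fintype.card (Fin n × Fin 8 → Fin m) := by
    rw [Finset.sum_sigma]
    calc ∑ s ∈ sizes, ∑ p ∈ pairs s, (#(confinedGraphs p.1 p.2) : ℝ)
        ≤ ∑ s ∈ sizes, (1 / 4) ^ s * (m : ℝ) ^ (n * 8) := by
          refine Finset.sum_le_sum fun s hs => sum_card_confinedGraphs_le hm ?_
          have := (Finset.mem_Ico.1 hs).2
          omega
      _ = (∑ s ∈ sizes, (1 / 4 : ℝ) ^ s) * (m : ℝ) ^ (n * 8) := (Finset.sum_mul ..).symm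
      _ < 1 * (m : ℝ) ^ (n * 8) := by
          have : 0 < m := by omega
          gcongr
      _ = Fintype.card (Fin n × Fin 8 → Fin m) := by simp
  obtain ⟨Γ, hΓ⟩ := exists_forall_notMem_of_sum_card_lt _ _ hsum
  refine ⟨Γ, fun S hS hSn => ?_⟩
  by_contra! hfew
  obtain ⟨T, hST, hT⟩ := Finset.exists_superset_card_eq hfew (by rw [Fintype.card_fin]; omega)
  refine hΓ ⟨#S, S, T⟩ ?_ (mem_confinedGraphs.2 hST)
  have := hS.card_pos
  simp only [Finset.mem_sigma, sizes, pairs, Finset.mem_Ico, Finset.mem_product,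
    Finset.mem_powersetCard_univ, hT, and_self, and_true]
  omega

end Expander

/-! ### Loose compaction along an expander -/

section ExpanderMatching

variable {n m : ℕ}

/-- The edges joining `v` to the left vertices in `s`. -/
def activeEdges (Γ : Fin n × Fin 8 → Fin m) (s : Fin n → Bool) (v : Fin m) :
    Finset (Fin n × Fin 8) :=
  {e ∈ ({e | Γ e = v} : Finset (Fin n × Fin 8)) | s e.1}

/-- The edge `e` is the only one joining its right end to `s`. -/
def acceptsEdge (Γ : Fin n × Fin 8 → Fin m) (s : Fin n → Bool) (e : Fin n × Fin 8) : Bool :=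
  s e.1 && !(decide (1 < #(activeEdges Γ s (Γ e))))

/-- The edge `e` is the first accepted edge at its left end. -/
def selectsEdge (Γ : Fin n × Fin 8 → Fin m) (s : Fin n → Bool) (e : Fin n × Fin 8) : Bool :=
  acceptsEdge Γ s e && !(((List.finRange 8).filter (· < e.2)).any fun j => acceptsEdge Γ s (e.1, j))

/-- The vertices of `s` without an accepted edge. -/
def unmatchedPart (Γ : Fin n × Fin 8 → Fin m) (s : Fin n → Bool) (u : Fin n) : Bool :=
  s u && !((List.finRange 8).any fun j => acceptsEdge Γ s (u, j))

/-- The edges selected in the first `t` rounds, each of which starts from the vertices left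
unmatched by the previous one. -/
def matchingEdges (Γ : Fin n × Fin 8 → Fin m) : ℕ → (Fin n → Bool) → Fin n × Fin 8 → Bool
  | 0, _, _ => false
  | t + 1, s, e => matchingEdges Γ t s e || selectsEdge Γ ((unmatchedPart Γ)^[t] s) e

/-- The edges `μ` match the vertices of `s` outside `s'` to right vertices that have no edge to
`s'`. -/
structure IsPartialMatching (Γ : Fin n × Fin 8 → Fin m) (s s' : Fin n → Bool)
    (μ : Fin n × Fin 8 → Bool) : Prop where
  subset : ∀ u, s' u → s u
  left_mem : ∀ e, μ e → s e.1
  left_notMem : ∀ e, μ e → ¬ s' e.1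
  left_inj : ∀ e e', μ e → μ e' → e.1 = e'.1 → e = e'
  right_inj : ∀ e e', μ e → μ e' → Γ e = Γ e' → e = e'
  right_free : ∀ e e', μ e → s' e'.1 → Γ e' ≠ Γ e
  covers : ∀ u, s u → s' u ∨ ∃ j, μ (u, j)

variable {Γ : Fin n × Fin 8 → Fin m} {s : Fin n → Bool} {e e' : Fin n × Fin 8}

theorem mem_activeEdges {v : Fin m} : e ∈ activeEdges Γ s v ↔ Γ e = v ∧ s e.1 := by
  simp [activeEdges]

theorem acceptsEdge_iff : acceptsEdge Γ s e ↔ s e.1 ∧ #(activeEdges Γ s (Γ e)) ≤ 1 := by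
  simp [acceptsEdge]

theorem eq_of_acceptsEdge (h : acceptsEdge Γ s e) (h' : s e'.1) (hΓ : Γ e' = Γ e) : e' = e := by
  rw [acceptsEdge_iff, Finset.card_le_one] at h
  exact h.2 _ (mem_activeEdges.2 ⟨hΓ, h'⟩) _ (mem_activeEdges.2 ⟨rfl, h.1⟩)

theorem unmatchedPart_iff {u : Fin n} :
    unmatchedPart Γ s u ↔ s u ∧ ∀ j, ¬ acceptsEdge Γ s (u, j) := by
  simp [unmatchedPart]

theorem selectsEdge_iff :
    selectsEdge Γ s e ↔ acceptsEdge Γ s e ∧ ∀ j < e.2, ¬ acceptsEdge Γ s (e.1, j) := by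
  simp [selectsEdge]

theorem exists_selectsEdge {u : Fin n} {j : Fin 8} (h : acceptsEdge Γ s (u, j)) :
    ∃ j, selectsEdge Γ s (u, j) := by
  obtain ⟨j, hj, hmin⟩ := WellFounded.has_min wellFounded_lt {j | acceptsEdge Γ s (u, j)} ⟨j, h⟩
  exact ⟨j, selectsEdge_iff.2 ⟨hj, fun i hi hacc => hmin i hacc hi⟩⟩

theorem isPartialMatching_selectsEdge (Γ : Fin n × Fin 8 → Fin m) (s : Fin n → Bool) :
    IsPartialMatching Γ s (unmatchedPart Γ s) (selectsEdge Γ s) where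
  subset _ h := (unmatchedPart_iff.1 h).1
  left_mem _ h := (acceptsEdge_iff.1 (selectsEdge_iff.1 h).1).1
  left_notMem e h h' := (unmatchedPart_iff.1 h').2 e.2 (selectsEdge_iff.1 h).1
  left_inj := by
    rintro ⟨u, j⟩ ⟨_, j'⟩ h h' rfl
    rw [selectsEdge_iff] at h h'
    rcases lt_trichotomy j j' with hlt | rfl | hlt
    · exact absurd h.1 (h'.2 j hlt)
    · rfl
    · exact absurd h'.1 (h.2 j' hlt)
  right_inj e e' h h' hΓ := eq_of_acceptsEdge (selectsEdge_iff.1 h').1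
    (acceptsEdge_iff.1 (selectsEdge_iff.1 h).1).1 hΓ
  right_free e e' h h' hΓ := by
    obtain ⟨hs, hnone⟩ := unmatchedPart_iff.1 h'
    obtain rfl := eq_of_acceptsEdge (selectsEdge_iff.1 h).1 hs hΓ
    exact hnone e'.2 (selectsEdge_iff.1 h).1
  covers u hu := by
    by_cases hex : ∃ j, acceptsEdge Γ s (u, j)
    · obtain ⟨j, hj⟩ := hex
      exact .inr (exists_selectsEdge hj)
    · exact .inl (unmatchedPart_iff.2 ⟨hu, not_exists.1 hex⟩)

theorem IsPartialMatching.trans {s' s'' : Fin n → Bool} {μ ν : Fin n × Fin 8 → Bool}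
    (hμ : IsPartialMatching Γ s s' μ) (hν : IsPartialMatching Γ s' s'' ν) :
    IsPartialMatching Γ s s'' fun e => μ e || ν e where
  subset u hu := hμ.subset u (hν.subset u hu)
  left_mem e he := (Bool.or_eq_true_iff.1 he).elim (hμ.left_mem e)
    fun he => hμ.subset _ (hν.left_mem e he)
  left_notMem e he := (Bool.or_eq_true_iff.1 he).elim
    (fun he h => hμ.left_notMem e he (hν.subset _ h)) (hν.left_notMem e)
  left_inj e e' he he' hee := by
    rcases Bool.or_eq_true_iff.1 he with he | he <;> rcases Bool.or_eq_true_iff.1 he' with he' | he'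
    · exact hμ.left_inj e e' he he' hee
    · exact absurd (hee ▸ hν.left_mem e' he') (hμ.left_notMem e he)
    · exact absurd (hee ▸ hν.left_mem e he) (hμ.left_notMem e' he')
    · exact hν.left_inj e e' he he' hee
  right_inj e e' he he' hΓ := by
    rcases Bool.or_eq_true_iff.1 he with he | he <;> rcases Bool.or_eq_true_iff.1 he' with he' | he'
    · exact hμ.right_inj e e' he he' hΓ
    · exact absurd hΓ.symm (hμ.right_free e e' he (hν.left_mem e' he'))
    · exact absurd hΓ (hμ.right_free e' e he' (hν.left_mem e he))
    · exact hν.right_inj e e' he he' hΓ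
  right_free e e' he he' := (Bool.or_eq_true_iff.1 he).elim
    (fun he => hμ.right_free e e' he (hν.subset _ he')) fun he => hν.right_free e e' he he'
  covers u hu := by
    rcases hμ.covers u hu with hu' | ⟨j, hj⟩
    · exact (hν.covers u hu').imp_right fun ⟨j, hj⟩ => ⟨j, by simp [hj]⟩
    · exact .inr ⟨j, by simp [hj]⟩

theorem isPartialMatching_matchingEdges (Γ : Fin n × Fin 8 → Fin m) (s : Fin n → Bool) (t : ℕ) :
    IsPartialMatching Γ s ((unmatchedPart Γ)^[t] s) (matchingEdges Γ t s) := by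
  induction t with
  | zero => constructor <;> simp [matchingEdges]
  | succ t ih =>
    rw [Function.iterate_succ_apply']
    exact ih.trans (isPartialMatching_selectsEdge Γ _)

theorem sum_card_activeEdges (Γ : Fin n × Fin 8 → Fin m) (s : Fin n → Bool) :
    ∑ v ∈ neighbors Γ {u | s u}, #(activeEdges Γ s v) = 8 * #{u | s u} := by
  have hfiber := Finset.card_eq_sum_card_fiberwise (f := Γ)
    (s := ({u | s u} : Finset (Fin n)) ×ˢ (Finset.univ : Finset (Fin 8)))
    (t := neighbors Γ {u | s u}) fun e he => Finset.mem_image_of_mem _ he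
  rw [Finset.card_product, Finset.card_fin, mul_comm] at hfiber
  rw [hfiber]
  refine Finset.sum_congr rfl fun v _ => congrArg Finset.card (Finset.ext fun e => ?_)
  simp [mem_activeEdges, and_comm]

theorem two_le_card_activeEdges_add {v : Fin m} (hv : v ∈ neighbors Γ {u | s u}) :
    2 ≤ #(activeEdges Γ s v) + #{e ∈ ({e | acceptsEdge Γ s e} : Finset _) | Γ e = v} := by
  obtain ⟨e, he, rfl⟩ := Finset.mem_image.1 hv
  have hs : s e.1 := by simpa using he
  have hactive : 0 < #(activeEdges Γ s (Γ e)) :=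
    Finset.card_pos.2 ⟨e, mem_activeEdges.2 ⟨rfl, hs⟩⟩
  by_cases hlt : 1 < #(activeEdges Γ s (Γ e))
  · omega
  · have hacc : 0 < #{e' ∈ ({e | acceptsEdge Γ s e} : Finset _) | Γ e' = Γ e} :=
      Finset.card_pos.2 ⟨e, by simpa [acceptsEdge_iff, hs] using hlt⟩
    omega

theorem card_acceptsEdge_add_le (Γ : Fin n × Fin 8 → Fin m) (s : Fin n → Bool) :
    #{e | acceptsEdge Γ s e} + 8 * #{u | unmatchedPart Γ s u} ≤ 8 * #{u | s u} := by
  have hsub : ({e | acceptsEdge Γ s e} : Finset (Fin n × Fin 8)) ⊆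
      (({u | s u} : Finset (Fin n)) \ ({u | unmatchedPart Γ s u} : Finset (Fin n))) ×ˢ
        Finset.univ := fun e he => by
    rw [Finset.mem_filter_univ] at he
    have hmatched : unmatchedPart Γ s e.1 = false :=
      Bool.eq_false_iff.2 fun h => (unmatchedPart_iff.1 h).2 e.2 he
    simp [(acceptsEdge_iff.1 he).1, hmatched]
  have hle := Finset.card_le_card hsub
  have hsub' : ({u | unmatchedPart Γ s u} : Finset (Fin n)) ⊆ ({u | s u} : Finset (Fin n)) :=
    Finset.monotone_filter_right _ fun u _ hu => (unmatchedPart_iff.1 hu).1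
  rw [Finset.card_product, Finset.card_fin, Finset.card_sdiff_of_subset hsub'] at hle
  have := Finset.card_le_card hsub'
  omega

/-- Each vertex of `s` has 8 edges, so among the more than `6 * #s` neighbours of `s` more than
`4 * #s` are the right end of only one of them. -/
theorem card_unmatchedPart_le (hΓ : 6 * #{u | s u} < #(neighbors Γ {u | s u})) :
    2 * #{u | unmatchedPart Γ s u} ≤ #{u | s u} := by
  have haccepted : ∑ v ∈ neighbors Γ {u | s u},
      #{e ∈ ({e | acceptsEdge Γ s e} : Finset (Fin n × Fin 8)) | Γ e = v} =
        #{e | acceptsEdge Γ s e} :=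
    (Finset.card_eq_sum_card_fiberwise fun e he => Finset.mem_image_of_mem _
      (by simpa using (acceptsEdge_iff.1 (by simpa using he)).1)).symm
  have hcount := Finset.sum_le_sum fun v (hv : v ∈ neighbors Γ {u | s u}) =>
    two_le_card_activeEdges_add hv
  rw [Finset.sum_const, Finset.sum_add_distrib, sum_card_activeEdges, haccepted, smul_eq_mul]
    at hcount
  have := card_acceptsEdge_add_le Γ s
  omega

theorem IsExpander.two_pow_mul_card_unmatchedPart_le (hΓ : IsExpander Γ) {M : ℕ}
    (hM : 3000000 * M ≤ n) (hs : #{u | s u} ≤ M) (t : ℕ) :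
    2 ^ t * #{u | (unmatchedPart Γ)^[t] s u} ≤ M := by
  induction t with
  | zero =>
    rw [pow_zero, one_mul]
    exact hs
  | succ t ih =>
    rw [Function.iterate_succ_apply']
    set s' := (unmatchedPart Γ)^[t] s
    have halved : 2 * #{u | unmatchedPart Γ s' u} ≤ #{u | s' u} := by
      rcases Finset.eq_empty_or_nonempty ({u | s' u} : Finset (Fin n)) with hempty | hne
      · rw [Finset.filter_eq_empty_iff] at hempty
        have : #{u | unmatchedPart Γ s' u} = 0 := by
          rw [Finset.card_eq_zero, Finset.filter_eq_empty_iff]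
          exact fun u hu h => hempty hu (unmatchedPart_iff.1 h).1
        omega
      · have hle : #{u | s' u} ≤ M := (Nat.le_mul_of_pos_left _ (by positivity)).trans ih
        exact card_unmatchedPart_le (hΓ _ hne (by omega))
    calc 2 ^ (t + 1) * #{u | unmatchedPart Γ s' u}
        = 2 ^ t * (2 * #{u | unmatchedPart Γ s' u}) := by rw [pow_succ, mul_assoc]
      _ ≤ 2 ^ t * #{u | s' u} := Nat.mul_le_mul_left _ halved
      _ ≤ M := ih

theorem IsExpander.unmatchedPart_iterate_eq_false (hΓ : IsExpander Γ) {M t : ℕ}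
    (hM : 3000000 * M ≤ n) (hs : #{u | s u} ≤ M) (ht : n ≤ 2 ^ t) :
    (unmatchedPart Γ)^[t] s = fun _ => false := by
  funext u
  by_contra hu
  have hpos : 0 < #{u | (unmatchedPart Γ)^[t] s u} := Finset.card_pos.2 ⟨u, by simpa using hu⟩
  have : 2 ^ t ≤ M :=
    (Nat.le_mul_of_pos_right _ hpos).trans (hΓ.two_pow_mul_card_unmatchedPart_le hM hs t)
  have := u.pos
  omega

theorem computes_one_lt_card_activeEdges (Γ : Fin n × Fin 8 → Fin m) :
    Computes (bitWires n) (128 * n) (Set.range fun v s => decide (1 < #(activeEdges Γ s v))) := by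
  have one (v : Fin m) :
      Computes (bitWires n) (16 * #{e | Γ e = v}) {fun s => decide (1 < #(activeEdges Γ s v))} :=
    (computes_thresholds_card (S := bitWires n) _ (fun e s => s e.1) Set.subset_union_left
      fun e _ => .inr ⟨e.1, rfl⟩).mono_right (Set.singleton_subset_iff.2 (mem_thresholds _ 1))
  have all := Computes.iUnion one
  rw [Set.iUnion_singleton_eq_range, ← Finset.mul_sum,
    ← Finset.card_eq_sum_card_fiberwise fun _ _ => Finset.mem_coe.2 (Finset.mem_univ _)] at all
  refine all.mono_cost ?_
  simp only [Finset.card_univ, Fintype.card_prod, Fintype.card_fin]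
  omega

theorem computes_acceptsEdge (Γ : Fin n × Fin 8 → Fin m) :
    Computes (bitWires n) (144 * n) (Set.range fun e s => acceptsEdge Γ s e) := by
  refine ((computes_one_lt_card_activeEdges Γ).trans (.range fun e => (Computes.of_mem ?_).and
    (Computes.of_mem (f := fun s => decide (1 < #(activeEdges Γ s (Γ e)))) ?_).not)).mono_cost ?_
  · exact .inl (.inr ⟨e.1, rfl⟩)
  · exact .inr ⟨Γ e, rfl⟩
  · simp only [Fintype.card_prod, Fintype.card_fin]
    omega

theorem computes_any_acceptsEdge (Γ : Fin n × Fin 8 → Fin m) {L : List (Fin 8)} (hL : L.length ≤ 8)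
    (u : Fin n) : Computes (bitWires n ∪ Set.range fun e s => acceptsEdge Γ s e) 8
      {fun s => L.any fun j => acceptsEdge Γ s (u, j)} :=
  (Computes.any (k := 0) L (fun j s => acceptsEdge Γ s (u, j)) (.inl (.inl false_mem_constWires))
    fun j _ => .of_mem (.inr ⟨(u, j), rfl⟩)).mono_cost (by omega)

theorem computes_selectsEdge (Γ : Fin n × Fin 8 → Fin m) :
    Computes (bitWires n ∪ Set.range fun e s => acceptsEdge Γ s e) (80 * n)
      (Set.range fun e s => selectsEdge Γ s e) := by
  refine (Computes.range (k := 10) fun e => ?_).mono_cost ?_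
  · refine ((Computes.of_mem (f := fun s => acceptsEdge Γ s e) ?_).and
      (computes_any_acceptsEdge Γ ((List.length_filter_le _ _).trans List.length_finRange.le)
        e.1).not).mono_cost (by norm_num)
    exact .inr ⟨e, rfl⟩
  · simp only [Fintype.card_prod, Fintype.card_fin]
    omega

theorem computes_unmatchedPart (Γ : Fin n × Fin 8 → Fin m) :
    Computes (bitWires n ∪ Set.range fun e s => acceptsEdge Γ s e) (10 * n)
      (Set.range fun u s => unmatchedPart Γ s u) := by
  refine (Computes.range (k := 10) fun u => ?_).mono_cost ?_
  · refine ((Computes.of_mem ?_).and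
      (computes_any_acceptsEdge Γ List.length_finRange.le u).not).mono_cost (by norm_num)
    exact .inl (.inr ⟨u, rfl⟩)
  · rw [Fintype.card_fin, mul_comm]

theorem computes_matching_round (Γ : Fin n × Fin 8 → Fin m) :
    Computes (bitWires n) (234 * n) ((Set.range fun e s => selectsEdge Γ s e) ∪
      Set.range fun u s => unmatchedPart Γ s u) :=
  ((computes_acceptsEdge Γ).trans
    ((computes_selectsEdge Γ).union (computes_unmatchedPart Γ))).mono_cost (by omega)

theorem computes_matchingEdges (Γ : Fin n × Fin 8 → Fin m) (t : ℕ) :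
    Computes (bitWires n) (242 * n * t) ((Set.range fun e s => matchingEdges Γ t s e) ∪
      Set.range fun u s => (unmatchedPart Γ)^[t] s u) := by
  induction t with
  | zero =>
    refine .of_subset ?_
    rintro _ (⟨e, rfl⟩ | ⟨u, rfl⟩)
    · exact .inl false_mem_constWires
    · exact .inr ⟨u, rfl⟩
  | succ t ih =>
    have round := ((computes_matching_round Γ).comp (unmatchedPart Γ)^[t]).mono_left
      (S' := bitWires n ∪ ((Set.range fun e s => matchingEdges Γ t s e) ∪
        Set.range fun u s => (unmatchedPart Γ)^[t] s u)) (by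
        rintro _ ⟨g, hg | ⟨u, rfl⟩, rfl⟩
        · exact .inl (.inl (comp_mem_constWires _ hg))
        · exact .inr (.inr ⟨u, rfl⟩))
    have step := (ih.extend round).extend (.range (k := 1)
      (F := fun e s => matchingEdges Γ (t + 1) s e) fun e =>
        (Computes.of_mem (.inr (.inl (.inl ⟨e, rfl⟩)))).or
          (.of_mem (.inr (.inr ⟨_, .inl ⟨e, rfl⟩, rfl⟩))))
    refine step.mono subset_rfl ?_ ?_
    · simp only [Fintype.card_prod, Fintype.card_fin]
      linarith
    · rintro _ (⟨e, rfl⟩ | ⟨u, rfl⟩)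
      · exact .inr ⟨e, rfl⟩
      · refine .inl (.inr ⟨_, .inr ⟨u, rfl⟩, ?_⟩)
        funext s
        exact (congrFun (Function.iterate_succ_apply' (unmatchedPart Γ) t s) u).symm

/-- Exchanges the ends of the edges in `μ`; the right vertices are stored in dummy slots. -/
noncomputable def matchingNet (Γ : Fin n × Fin 8 → Fin m)
    (μ : (Fin n → Bool) → Fin n × Fin 8 → Bool) : SwapNet (Slot n) (Fin n → Bool) :=
  (Finset.univ : Finset (Fin n × Fin 8)).toList.flatMap fun e =>
    [((.inl e.1, .inr (Γ e).1), fun x => μ x e)]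

variable {μ : (Fin n → Bool) → Fin n × Fin 8 → Bool}

theorem length_matchingNet : List.length (matchingNet Γ μ) = 8 * n := by
  simp [matchingNet, List.length_flatMap, mul_comm]

theorem controls_matchingNet_subset :
    (matchingNet Γ μ).controls ⊆ Set.range fun e s => μ s e := by
  rw [matchingNet, SwapNet.controls_flatMap]
  refine Set.iUnion₂_subset fun e _ => ?_
  rintro _ ⟨_, hmem, rfl⟩
  exact ⟨e, by rw [List.mem_singleton.1 hmem]⟩

theorem perm_swapEnds_of_ne {x : Fin n → Bool} {p : Slot n}
    (h : μ x e → p ≠ .inl e.1 ∧ p ≠ .inr (Γ e).1) :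
    SwapNet.perm [((.inl e.1, .inr (Γ e).1), fun x => μ x e)] x p = p := by
  rw [SwapNet.perm_cons, SwapNet.perm_nil, mul_one]
  rcases he : μ x e
  · exact DFunLike.congr_fun (condSwap_of_false (c := fun x => μ x e) he) p
  · exact condSwap_apply_of_ne_of_ne (h he).1 (h he).2 _ _

theorem perm_matchingNet_of_fixed {x : Fin n → Bool} {p : Slot n}
    (h : ∀ e, μ x e → p ≠ .inl e.1 ∧ p ≠ .inr (Γ e).1) : (matchingNet Γ μ).perm x p = p :=
  SwapNet.perm_flatMap_of_fixed fun e _ => perm_swapEnds_of_ne (h e)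

theorem IsPartialMatching.perm_matchingNet_inl {x s' : Fin n → Bool}
    (hμ : IsPartialMatching Γ x s' (μ x)) (he : μ x e) :
    (matchingNet Γ μ).perm x (.inl e.1) = .inr (Γ e).1 := by
  refine SwapNet.perm_flatMap_of_mem (Finset.nodup_toList _)
    (Finset.mem_toList.2 (Finset.mem_univ e)) ?_
    (fun e' hne => perm_swapEnds_of_ne fun he' => ⟨fun h => ?_, Sum.inl_ne_inr⟩)
    fun e' hne => perm_swapEnds_of_ne fun he' => ⟨Sum.inr_ne_inl, fun h => ?_⟩
  · rw [SwapNet.perm_cons, SwapNet.perm_nil, mul_one]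
    exact (DFunLike.congr_fun (condSwap_of_true (c := fun x => μ x e) he) _).trans
      (Equiv.swap_apply_left _ _)
  · exact hne (hμ.left_inj e' e he' he (Sum.inl_injective h).symm)
  · exact hne (hμ.right_inj e' e he' he (Fin.ext (Sum.inr_injective h).symm))

theorem IsPartialMatching.extendBits_perm_matchingNet {x : Fin n → Bool}
    (hμ : IsPartialMatching Γ x (fun _ => false) (μ x)) {p : Slot n}
    (hp : ∀ v : Fin m, p ≠ .inr v.1) : extendBits x ((matchingNet Γ μ).perm x p) = false := by
  rcases p with u | d
  · by_cases hex : ∃ j, μ x (u, j)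
    · obtain ⟨j, hj⟩ := hex
      rw [hμ.perm_matchingNet_inl hj]
      rfl
    · rw [perm_matchingNet_of_fixed fun e he => ⟨?_, Sum.inl_ne_inr⟩]
      · change x u = false
        by_contra hu
        exact hex ((hμ.covers u (by simpa using hu)).resolve_left Bool.false_ne_true)
      · rintro h
        obtain rfl := Sum.inl_injective h
        exact hex ⟨e.2, he⟩
  · rw [perm_matchingNet_of_fixed fun e _ => ⟨Sum.inr_ne_inl, hp (Γ e)⟩]
    rfl

end ExpanderMatching

theorem hasLooseCompaction_of_expander {n m M : ℕ} (hm : n ≤ 3 * m) (hM : 3000000 * M ≤ n) :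
    HasLooseCompaction n M m (242 * n * Nat.clog 2 n) (8 * n) := by
  obtain ⟨Γ, hΓ⟩ := exists_isExpander hm
  refine ⟨matchingNet Γ (matchingEdges Γ (Nat.clog 2 n)), length_matchingNet.le,
    (computes_matchingEdges Γ _).mono_right
      (controls_matchingNet_subset.trans Set.subset_union_left),
    Sum.elim (fun i => .inr i.1) (fun d => .inr (m + d)), ?_, fun x hx p hp => ?_⟩
  · refine Function.Injective.sumElim (Sum.inr_injective.comp Fin.val_injective)
      (Sum.inr_injective.comp (add_right_injective m)) fun i d h => ?_
    have := Sum.inr_injective h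
    omega
  · refine IsPartialMatching.extendBits_perm_matchingNet ?_ hp
    rw [← hΓ.unmatchedPart_iterate_eq_false hM hx (Nat.le_pow_clog one_lt_two n)]
    exact isPartialMatching_matchingEdges Γ x _

/-! ### Iterated logarithmic levels of compaction -/

theorem isMixing_complete (n : ℕ) :
    ∃ E : List (Fin n × Fin n), E.length = n * n ∧ IsMixing E 0 := by
  refine ⟨(Finset.univ : Finset (Fin n × Fin n)).toList, by simp, fun R B h hR => ?_⟩
  obtain ⟨r, hr⟩ := Finset.card_pos.1 hR
  obtain ⟨b, hb⟩ := Finset.card_pos.1 (h ▸ hR)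
  exact ⟨(r, b), by simp, hr, hb⟩

theorem SwapNet.computes_controls_nil {ι Ω : Type} {S : Set (Ω → Bool)} :
    Computes S 0 (SwapNet.controls ([] : SwapNet ι Ω)) := by
  rw [SwapNet.controls_nil]
  exact .of_subset (Set.empty_subset _)

theorem hasLooseCompaction_zero (n : ℕ) : HasLooseCompaction n 0 0 0 0 := by
  refine ⟨[], le_rfl, SwapNet.computes_controls_nil, Sum.elim Fin.elim0 Sum.inr, ?_,
    fun x hx p _ => ?_⟩
  · exact Function.Injective.sumElim (fun i => i.elim0) Sum.inr_injective fun i => i.elim0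
  · rcases p with i | d
    · have := Finset.filter_eq_empty_iff.1 (Finset.card_eq_zero.1 (Nat.le_zero.1 hx))
        (Finset.mem_univ i)
      exact Bool.eq_false_iff.2 this
    · rfl

theorem hasMatching_zero : HasMatching 0 0 0 :=
  ⟨[], le_rfl, SwapNet.computes_controls_nil, fun _ _ _ =>
    ⟨1, by ext p; rcases p with i | d <;> rfl, fun i => i.elim0, fun i => i.elim0⟩⟩

theorem hasMatching_quadratic (n : ℕ) : HasMatching n (22 * (n * n) + 4 * n) (n * n) := by
  obtain ⟨E, hE, hmix⟩ := isMixing_complete n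
  have := HasMatching.of_hasLooseCompaction hmix (hasLooseCompaction_zero n) hasMatching_zero
  rw [hE] at this
  simpa using this

theorem mul_add_div_mul_le {c θ x y : ℝ} (hc : 0 ≤ c) (hθ : θ < 1) (hy : y ≤ θ * x) :
    c * x + c / (1 - θ) * y ≤ c / (1 - θ) * x := by
  have hpos : 0 < 1 - θ := sub_pos.2 hθ
  calc c * x + c / (1 - θ) * y ≤ c * x + c / (1 - θ) * (θ * x) := by gcongr
    _ = c / (1 - θ) * x := by field_simp; ring

/-- Loose compaction leaves a geometrically shrinking problem, so the costs of all stages add up to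
a constant multiple of those of the first. -/
theorem exists_hasMatching {n₀ D : ℕ} {μ : ℕ → ℕ} {A B θ : ℝ} {ℓ : ℕ → ℝ} (hA : 0 ≤ A) (hB : 0 ≤ B)
    (hθ₀ : 0 ≤ θ) (hθ : θ < 1) (hn₀ : 0 < n₀) (hℓ : Monotone ℓ) (hℓ₁ : ∀ n, 1 ≤ ℓ n)
    (hmix : ∀ n, ∃ E : List (Fin n × Fin n), E.length = D * n ∧ IsMixing E (μ n))
    (hloose : ∀ n ≥ n₀, ∃ n' a b, HasLooseCompaction n (2 * μ n) n' a b ∧ (n' : ℝ) ≤ θ * n ∧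
      (a : ℝ) ≤ A * (n * ℓ n) ∧ (b : ℝ) ≤ B * n) (n : ℕ) :
    ∃ a b, HasMatching n a b ∧
      (a : ℝ) ≤ (A + 16 * B + 22 * (D + n₀) + 4) / (1 - θ) * (n * ℓ n) ∧
      (b : ℝ) ≤ (D + n₀ + 2 * B) / (1 - θ) * n := by
  set α := A + 16 * B + 22 * (D + n₀) + 4
  set β := D + n₀ + 2 * B
  have hα₀ : 0 ≤ α := by positivity
  have hβ₀ : 0 ≤ β := by positivity
  induction n using Nat.strong_induction_on with
  | _ n ih =>
  have hnℓ : (n : ℝ) ≤ n * ℓ n := le_mul_of_one_le_right n.cast_nonneg (hℓ₁ n)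
  have hnℓ₀ : (0 : ℝ) ≤ n * ℓ n := n.cast_nonneg.trans hnℓ
  have hDn : (0 : ℝ) ≤ D * n := by positivity
  have hBn : 0 ≤ B * n := by positivity
  have hAn : 0 ≤ A * (n * ℓ n) := by positivity
  have hpad : (22 * (D + n₀) + 16 * B + 4) * (n : ℝ) ≤ (22 * (D + n₀) + 16 * B + 4) * (n * ℓ n) :=
    mul_le_mul_of_nonneg_left hnℓ (by positivity)
  rcases lt_or_ge n n₀ with hlt | hge
  · have hnn : (n : ℝ) * n ≤ n₀ * n := by gcongr
    refine ⟨_, _, hasMatching_quadratic n,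
      le_trans ?_ (mul_add_div_mul_le (y := 0) hα₀ hθ (by positivity)),
      le_trans ?_ (mul_add_div_mul_le (y := 0) hβ₀ hθ (by positivity))⟩ <;>
    · push_cast
      linarith
  · obtain ⟨E, hElen, hE⟩ := hmix n
    obtain ⟨n', a₁, b₁, hL, hn', ha₁, hb₁⟩ := hloose n hge
    have hn : (0 : ℝ) < n := by exact_mod_cast hn₀.trans_le hge
    have hlt : n' < n := by exact_mod_cast hn'.trans_lt (mul_lt_of_lt_one_left hn hθ)
    obtain ⟨a₂, b₂, hM, ha₂, hb₂⟩ := ih n' hlt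
    have hn₀n : (0 : ℝ) ≤ n₀ * n := by positivity
    refine ⟨_, _, .of_hasLooseCompaction hE hL hM, ?_, ?_⟩
    · have hshrink : n' * ℓ n' ≤ θ * (n * ℓ n) := by
        rw [← mul_assoc]
        exact mul_le_mul hn' (hℓ hlt.le) (zero_le_one.trans (hℓ₁ n')) (by positivity)
      refine le_trans ?_ (mul_add_div_mul_le hα₀ hθ hshrink)
      rw [hElen]
      push_cast
      linarith
    · refine le_trans ?_ (mul_add_div_mul_le hβ₀ hθ hn')
      rw [hElen]
      push_cast
      linarith

/-- The binary logarithm, rounded up, iterated `2 ^ k` times. -/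
def iterClog (k n : ℕ) : ℕ := (Nat.clog 2)^[2 ^ k] n

theorem clog_iterate_mono (m : ℕ) : Monotone (Nat.clog 2)^[m] :=
  Monotone.iterate (fun _ _ => Nat.clog_mono_right 2) m

theorem clog_iterate_le (m n : ℕ) : (Nat.clog 2)^[m] n ≤ n :=
  Function.iterate_le_id_of_le_id (fun _ => Nat.clog_le_of_le_pow Nat.lt_two_pow_self.le) m n

theorem clog_succ_le (n : ℕ) : Nat.clog 2 (n + 1) ≤ Nat.clog 2 n + 1 := by
  have hle := Nat.le_pow_clog one_lt_two n
  have hpos := Nat.one_le_two_pow (n := Nat.clog 2 n)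
  exact Nat.clog_le_of_le_pow (by rw [pow_succ]; omega)

theorem clog_iterate_succ_le (m n : ℕ) : (Nat.clog 2)^[m] (n + 1) ≤ (Nat.clog 2)^[m] n + 1 := by
  induction m generalizing n with
  | zero => exact le_rfl
  | succ m ih => exact (clog_iterate_mono m (clog_succ_le n)).trans (ih _)

theorem iterClog_mono (k : ℕ) : Monotone (iterClog k) := clog_iterate_mono (2 ^ k)

theorem iterClog_succ (k n : ℕ) : iterClog (k + 1) n = iterClog k (iterClog k n) := by
  rw [iterClog, pow_succ, mul_two, Function.iterate_add_apply, iterClog, iterClog]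

theorem iterClog_le_clog (k n : ℕ) : iterClog k n ≤ Nat.clog 2 n := by
  rw [iterClog, ← Nat.sub_add_cancel (Nat.one_le_two_pow (n := k)), Function.iterate_succ_apply]
  exact clog_iterate_le _ _

theorem mul_clog_add_one_le {h n : ℕ} (hn : 2 ^ (6 * h) ≤ n) : h * (Nat.clog 2 n + 1) ≤ n := by
  rcases Nat.eq_zero_or_pos h with rfl | hh
  · rw [zero_mul]
    exact Nat.zero_le n
  set c := Nat.clog 2 n
  have hc : 6 * h ≤ c := by
    simpa only [Nat.clog_pow 2 _ one_lt_two] using Nat.clog_mono_right 2 hn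
  have hlt : 2 ^ (c - 1) < n := Nat.pow_pred_clog_lt_self one_lt_two
    ((Nat.one_lt_two_pow (by omega)).trans_le hn)
  set i := (c - 1) / 2
  have hi₁ : i + 1 ≤ 2 ^ i := Nat.lt_two_pow_self
  calc h * (c + 1) ≤ h * (3 * (i + 1)) := Nat.mul_le_mul_left h (by omega)
    _ = 3 * h * (i + 1) := by ring
    _ ≤ 2 ^ i * 2 ^ i := Nat.mul_le_mul (by omega) hi₁
    _ = 2 ^ (2 * i) := by rw [two_mul, pow_add]
    _ ≤ 2 ^ (c - 1) := Nat.pow_le_pow_right two_pos (Nat.mul_div_le _ 2)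
    _ ≤ n := hlt.le

/-- Compaction by at most `β * n` swaps whose controls are computed with at most
`α * n * (1 + iterClog k n)` gates. -/
def CompactionLevel (k : ℕ) (α β : ℝ) : Prop :=
  ∀ n : ℕ, ∃ a b, HasCompaction n a b ∧ (a : ℝ) ≤ α * (n * (1 + iterClog k n)) ∧
    (b : ℝ) ≤ β * n

theorem CompactionLevel.mono {k : ℕ} {α β α' β' : ℝ} (h : CompactionLevel k α β) (hα : α ≤ α')
    (hβ : β ≤ β') : CompactionLevel k α' β' := fun n =>
  have ⟨a, b, hn, ha, hb⟩ := h n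
  ⟨a, b, hn, ha.trans (by gcongr), hb.trans (by gcongr)⟩

theorem compactionLevel_of_hasMatching {k : ℕ} {α β : ℝ}
    (h : ∀ n : ℕ, ∃ a b, HasMatching n a b ∧ (a : ℝ) ≤ α * (n * (1 + iterClog k n)) ∧
      (b : ℝ) ≤ β * n) : CompactionLevel k (α + 16) β := by
  intro n
  obtain ⟨a, b, hn, ha, hb⟩ := h n
  refine ⟨_, _, hn.hasCompaction, ?_, hb⟩
  have : (n : ℝ) ≤ n * (1 + iterClog k n) := le_mul_of_one_le_right n.cast_nonneg (by simp)
  push_cast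
  linarith

theorem monotone_one_add_iterClog (k : ℕ) : Monotone fun n : ℕ => (1 + iterClog k n : ℝ) :=
  fun _ _ h => by simpa using iterClog_mono k h

theorem exists_compactionLevel_zero : ∃ α β : ℝ, CompactionLevel 0 α β := by
  obtain ⟨D, hD⟩ := exists_isMixing (h := 6000000) (by norm_num)
  refine ⟨_, _, compactionLevel_of_hasMatching (exists_hasMatching (n₀ := 2) (A := 242) (B := 8)
    (θ := 1 / 2) (by norm_num) (by norm_num) (by norm_num) (by norm_num) two_pos
    (monotone_one_add_iterClog 0) (fun n => by simp) hD fun n hn => ?_)⟩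
  refine ⟨n / 2, _, _, hasLooseCompaction_of_expander (by omega) (by omega), ?_, ?_, ?_⟩
  · have : (n / 2 : ℕ) ≤ (n : ℝ) / 2 := Nat.cast_div_le
    linarith
  · rw [iterClog, pow_zero, Function.iterate_one]
    push_cast
    linarith
  · push_cast
    exact le_rfl

section LevelStep

variable {k h n : ℕ} {α β : ℝ}

theorem two_mul_div_lt_mul (hh : 0 < h) {B : ℕ} (hB : 0 < B) :
    2 * (n / (2 * h ^ 2)) < (n / (h * B) + 1) * (B / h + 1) := by
  have hn : n < h * B * (n / (h * B) + 1) := Nat.lt_mul_div_succ n (by positivity)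
  have hBh : B < h * (B / h + 1) := Nat.lt_mul_div_succ B hh
  refine lt_of_mul_lt_mul_right (a := h ^ 2 * B) ?_ (Nat.zero_le _)
  calc 2 * (n / (2 * h ^ 2)) * (h ^ 2 * B) = n / (2 * h ^ 2) * (2 * h ^ 2) * B := by ring
    _ ≤ n * B := Nat.mul_le_mul_right B (Nat.div_mul_le_self n _)
    _ < h * B * (n / (h * B) + 1) * (h * (B / h + 1)) := Nat.mul_lt_mul'' hn hBh
    _ = (n / (h * B) + 1) * (B / h + 1) * (h ^ 2 * B) := by ring

theorem mul_leftover_le {B : ℕ} (hB : 0 < B) (hBn : h * B ≤ n) :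
    (n / (h * B) * B + n / B * (B / h) + (n - n / B * B)) * h ≤ 3 * n := by
  have rows : n / (h * B) * B * h ≤ n := by
    rw [mul_assoc, mul_comm B]
    exact Nat.div_mul_le_self n _
  have columns : n / B * (B / h) * h ≤ n := by
    rw [mul_assoc]
    exact (Nat.mul_le_mul_left _ (Nat.div_mul_le_self B h)).trans (Nat.div_mul_le_self n B)
  have rest : (n - n / B * B) * h ≤ n := by
    rw [← Nat.mod_eq_sub_div_mul, mul_comm]
    exact (Nat.mul_le_mul_left h (Nat.mod_lt n hB).le).trans hBn
  rw [add_mul, add_mul]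
  omega

namespace CompactionLevel

theorem exists_hasCompaction_rows (hk : CompactionLevel k α β) (hα : 0 ≤ α) (hβ : 0 ≤ β) {q : ℕ}
    (hq : q * (iterClog k n + 1) ≤ n) : ∃ a b, HasCompaction (iterClog k n + 1) a b ∧
      (q * a : ℝ) ≤ α * (n * (2 + iterClog (k + 1) n)) ∧ (q * b : ℝ) ≤ β * n := by
  set B := iterClog k n + 1
  obtain ⟨a, b, hB, ha, hb⟩ := hk B
  have hq' : (q * B : ℝ) ≤ n := by exact_mod_cast hq
  have hlog : (1 + iterClog k B : ℝ) ≤ 2 + iterClog (k + 1) n := by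
    have : (iterClog k B : ℝ) ≤ iterClog (k + 1) n + 1 := by
      rw [iterClog_succ]
      exact_mod_cast clog_iterate_succ_le (2 ^ k) (iterClog k n)
    linarith
  refine ⟨a, b, hB, ?_, ?_⟩
  · calc (q * a : ℝ) ≤ q * (α * (B * (1 + iterClog k B))) := by gcongr
      _ = α * (q * B * (1 + iterClog k B)) := by ring
      _ ≤ α * (n * (2 + iterClog (k + 1) n)) := by gcongr
  · calc (q * b : ℝ) ≤ q * (β * B) := by gcongr
      _ = β * (q * B) := by ring
      _ ≤ β * n := by gcongr

theorem exists_hasCompaction_columns (hk : CompactionLevel k α β) (hα : 0 ≤ α) (hβ : 0 ≤ β)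
    {q : ℕ} (hq : q * (iterClog k n + 1) ≤ n) : ∃ a b, HasCompaction q a b ∧ (a : ℝ) ≤ α * n ∧
      ((iterClog k n + 1 : ℕ) * b : ℝ) ≤ β * n := by
  set B := iterClog k n + 1 with hB
  obtain ⟨a, b, hqc, ha, hb⟩ := hk q
  have hq' : (q * B : ℝ) ≤ n := by exact_mod_cast hq
  have hqn : q ≤ n := (Nat.le_mul_of_pos_right q (Nat.succ_pos _)).trans hq
  have hlog : (1 + iterClog k q : ℝ) ≤ B := by
    rw [hB, add_comm]
    exact_mod_cast Nat.succ_le_succ (iterClog_mono k hqn)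
  refine ⟨a, b, hqc, ?_, ?_⟩
  · calc (a : ℝ) ≤ α * (q * (1 + iterClog k q)) := ha
      _ ≤ α * (q * B) := by gcongr
      _ ≤ α * n := by gcongr
  · calc (B * b : ℝ) ≤ B * (β * q) := by gcongr
      _ = β * (q * B) := by ring
      _ ≤ β * n := by gcongr

theorem exists_hasLooseCompaction (hk : CompactionLevel k α β) (hα : 0 ≤ α) (hβ : 0 ≤ β)
    (hh : 2 ≤ h) (hn : h * (Nat.clog 2 n + 1) ≤ n) :
    ∃ n' a b, HasLooseCompaction n (2 * (n / (2 * h ^ 2))) n' a b ∧ (n' : ℝ) * h ≤ 3 * n ∧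
      (a : ℝ) ≤ (3 * α + 8 * β + 2) * (n * (1 + iterClog (k + 1) n)) ∧ (b : ℝ) ≤ 2 * β * n := by
  have hBn : h * (iterClog k n + 1) ≤ n :=
    (Nat.mul_le_mul_left h (Nat.succ_le_succ (iterClog_le_clog k n))).trans hn
  have hBpos : 0 < iterClog k n + 1 := Nat.succ_pos _
  have hq : n / (iterClog k n + 1) * (iterClog k n + 1) ≤ n := Nat.div_mul_le_self n _
  obtain ⟨aB, bB, hB, haB, hbB⟩ := hk.exists_hasCompaction_rows hα hβ hq
  obtain ⟨aq, bq, hcq, haq, hbq⟩ := hk.exists_hasCompaction_columns hα hβ hq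
  obtain ⟨n', hn', hloose⟩ := hB.hasLooseCompaction hcq hq (Nat.div_lt_self hBpos hh)
    (two_mul_div_lt_mul (by omega) hBpos)
  refine ⟨n', _, _, hloose, ?_, ?_, ?_⟩
  · exact_mod_cast (Nat.mul_le_mul_right h hn').trans (mul_leftover_le hBpos hBn)
  · have hL : (0 : ℝ) ≤ n * iterClog (k + 1) n := by positivity
    have hαL : 0 ≤ α * (n * iterClog (k + 1) n) := by positivity
    have hβL : 0 ≤ β * (n * iterClog (k + 1) n) := by positivity
    push_cast at haB hbB ⊢
    linarith
  · push_cast at hbB hbq ⊢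
    linarith

end CompactionLevel

end LevelStep

theorem exists_compactionLevel_succ {ρ : ℝ} (hρ : 4 < ρ) :
    ∃ D : ℕ, ∀ k α β, 0 ≤ α → 0 ≤ β → CompactionLevel k α β →
      CompactionLevel (k + 1) (ρ / 4 * (3 * α + 40 * β + 22 * D + 6) + 16)
        (ρ / 4 * (D + 4 * β)) := by
  have hρ₀ : 0 < ρ := by linarith
  have hθ₁ : 4 / ρ < 1 := (div_lt_one hρ₀).2 hρ
  set θ := 1 - 4 / ρ
  have hθ₀ : 0 < θ := sub_pos.2 hθ₁
  obtain ⟨h, hh⟩ := exists_nat_ge (max 2 (3 / θ))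
  have hh₂ : 2 ≤ h := by exact_mod_cast (le_max_left _ _).trans hh
  have hh₃ : 3 ≤ θ * h := (div_le_iff₀' hθ₀).1 ((le_max_right _ _).trans hh)
  have hh₀ : (0 : ℝ) < h := by positivity
  obtain ⟨D, hD⟩ := exists_isMixing (h := 2 * h ^ 2) (Nat.one_le_iff_ne_zero.2 (by positivity))
  refine ⟨D + 2 ^ (6 * h), fun k α β hα hβ hk => ?_⟩
  have matching := exists_hasMatching (n₀ := 2 ^ (6 * h)) (A := 3 * α + 8 * β + 2) (B := 2 * β)
    (by positivity) (by positivity) hθ₀.le (sub_lt_self 1 (by positivity)) (by positivity)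
    (monotone_one_add_iterClog (k + 1)) (fun n => by simp) hD fun n hn => by
      obtain ⟨n', a, b, hloose, hn', ha, hb⟩ :=
        hk.exists_hasLooseCompaction hα hβ hh₂ (mul_clog_add_one_le hn)
      refine ⟨n', a, b, hloose, le_of_mul_le_mul_right ?_ hh₀, ha, hb⟩
      calc (n' * h : ℝ) ≤ 3 * n := hn'
        _ ≤ θ * h * n := by gcongr
        _ = θ * n * h := by ring
  have hgeom : 1 - θ = 4 / ρ := sub_sub_cancel 1 _
  refine (compactionLevel_of_hasMatching matching).mono (le_of_eq ?_) (le_of_eq ?_)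
  all_goals
    rw [hgeom]
    push_cast
    field_simp
    ring

/-- The term `- (D + 1)` makes the bound inductive in spite of the additive constants of a step. -/
theorem compactionLevel_of_succ {ρ C₁ C₂ : ℝ} {D : ℕ} (hρ : 4 < ρ) (hC₁ : 40 * C₂ ≤ C₁)
    (hC₂ : D + 1 ≤ C₂) (hzero : CompactionLevel 0 C₁ (C₂ - (D + 1)))
    (hsucc : ∀ k α β, 0 ≤ α → 0 ≤ β → CompactionLevel k α β →
      CompactionLevel (k + 1) (ρ / 4 * (3 * α + 40 * β + 22 * D + 6) + 16)
        (ρ / 4 * (D + 4 * β))) (k : ℕ) :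
    CompactionLevel k (C₁ * ρ ^ k) (C₂ * ρ ^ k - (D + 1)) := by
  induction k with
  | zero => rwa [pow_zero, mul_one, mul_one]
  | succ k ih =>
    have hρk : (1 : ℝ) ≤ ρ ^ k := one_le_pow₀ (by linarith)
    have hC₁k : 40 * C₂ * (ρ ^ k * ρ) ≤ C₁ * (ρ ^ k * ρ) :=
      mul_le_mul_of_nonneg_right hC₁ (by positivity)
    refine (hsucc k _ _ ?_ ?_ ih).mono ?_ ?_
    · exact mul_nonneg (by linarith [D.cast_nonneg (α := ℝ)]) (by positivity)
    · nlinarith [D.cast_nonneg (α := ℝ)]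
    all_goals
      rw [pow_succ]
      nlinarith [D.cast_nonneg (α := ℝ)]

theorem exists_compactionLevel {ρ : ℝ} (hρ : 4 < ρ) :
    ∃ C : ℝ, 0 ≤ C ∧ ∀ k, CompactionLevel k (C * ρ ^ k) (C * ρ ^ k) := by
  obtain ⟨D, hsucc⟩ := exists_compactionLevel_succ hρ
  obtain ⟨α₀, β₀, hzero⟩ := exists_compactionLevel_zero
  have hα₀ := le_abs_self α₀
  have hβ₀ := le_abs_self β₀
  set C₂ : ℝ := |β₀| + D + 1
  set C₁ : ℝ := |α₀| + 40 * C₂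
  have hC₂₀ : D + 1 ≤ C₂ := by linarith [abs_nonneg β₀]
  have hC₁₀ : 40 * C₂ ≤ C₁ := by linarith [abs_nonneg α₀]
  refine ⟨C₁, by positivity, fun k => (compactionLevel_of_succ hρ hC₁₀ hC₂₀
    (hzero.mono (by linarith) (by linarith)) hsucc k).mono le_rfl ?_⟩
  have : C₂ * ρ ^ k ≤ C₁ * ρ ^ k := mul_le_mul_of_nonneg_right (by linarith) (by positivity)
  linarith

/-! ### Tight compaction circuits -/

section TightCompactor

variable {n w : ℕ}

/-- The input wires carrying an array of `n` keyed elements, and the constant wires. -/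
def arrayWires (n w : ℕ) : Set ((ArrayBit n w → Bool) → Bool) :=
  constWires _ ∪ Set.range fun q x => x q

/-- The keys of an array that is given by its bits. -/
def arrayKeys (x : ArrayBit n w → Bool) (i : Fin n) : Bool := x (i, none)

/-- Tight compaction of `n` elements of `w` bits by a circuit with at most `s` gates in which no
wire feeds more than three gate inputs and circuit outputs. -/
def HasTightCompactor (n w : ℕ) (s : ℝ) : Prop :=
  ∃ c : BoolCircuit (ArrayBit n w) (ArrayBit n w),
    (c.size : ℝ) ≤ s ∧ IsTightCompactor c ∧ ∀ u, c.fanOut u ≤ 3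

theorem HasTightCompactor.mono {s t : ℝ} (h : HasTightCompactor n w s) (hst : s ≤ t) :
    HasTightCompactor n w t :=
  let ⟨c, hc, htight, hfanOut⟩ := h
  ⟨c, hc.trans hst, htight, hfanOut⟩

theorem arrayToBits_comp (A : Fin n → KeyedElement w) (σ : Equiv.Perm (Fin n)) :
    (fun q : ArrayBit n w => arrayToBits A (σ q.1, q.2)) = arrayToBits fun i => A (σ i) := by
  funext ⟨i, o⟩
  cases o <;> rfl

theorem hasTightCompactor_of_computes (hn : 0 < n) {k : ℕ}
    (σ : (ArrayBit n w → Bool) → Equiv.Perm (Fin n))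
    (h : Computes (arrayWires n w) k (Set.range fun (q : ArrayBit n w) x => x (σ x q.1, q.2)))
    (hσ : ∀ x, Monotone (arrayKeys x ∘ σ x)) :
    HasTightCompactor n w (3 * (5 + k) + n * (w + 1)) := by
  have hconst : Computes (Set.range fun (q : ArrayBit n w) (x : ArrayBit n w → Bool) => x q) 5
      (constWires _) :=
    .constWires ⟨_, (⟨0, hn⟩, none), rfl⟩
  obtain ⟨c, hc, hc_eval⟩ := Computes.exists_circuit
    (fun (x : ArrayBit n w → Bool) (q : ArrayBit n w) => x (σ x q.1, q.2))
    (hconst.trans (h.mono_left (Set.union_comm _ _).subset))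
  obtain ⟨c', hc', hc'_eval, hfanOut⟩ := c.exists_fanOut_le
  refine ⟨c', ?_, fun A => ⟨σ (arrayToBits A), ?_, hσ (arrayToBits A)⟩, hfanOut⟩
  · rw [hc', Fintype.card_prod, Fintype.card_option, Fintype.card_fin, Fintype.card_fin]
    exact_mod_cast Nat.add_le_add_right (Nat.mul_le_mul_left 3 hc) _
  · rw [hc'_eval, hc_eval, arrayToBits_comp]

theorem SwapNet.computes_permutedArray {N : SwapNet (Slot n) (Fin n → Bool)} {a : ℕ}
    {σ : (Fin n → Bool) → Equiv.Perm (Fin n)} (hN : Computes (bitWires n) a N.controls)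
    (hσ : ∀ x, N.perm x = (σ x).sumCongr 1) :
    Computes (arrayWires n w) (a + (w + 1) * (8 * List.length N))
      (Set.range fun (q : ArrayBit n w) x => x (σ (arrayKeys x) q.1, q.2)) := by
  have hcontrols : Computes (arrayWires n w) a (N.map id arrayKeys).controls := by
    refine SwapNet.computes_controls_map hN id arrayKeys ?_
    rintro f (hf | ⟨i, rfl⟩)
    · exact .inl (comp_mem_constWires _ hf)
    · exact .inr ⟨(i, none), rfl⟩
  have hlayer (o : Option (Fin w)) :
      Computes (arrayWires n w ∪ (N.map id arrayKeys).controls) (8 * List.length N)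
        (Set.range fun p (x : ArrayBit n w → Bool) =>
          extendBits (fun i => x (i, o)) ((N.map id arrayKeys).perm x p)) := by
    rw [← SwapNet.length_map id arrayKeys N]
    refine SwapNet.computes_apply _
      (fun p (x : ArrayBit n w → Bool) => extendBits (fun i => x (i, o)) p)
      Set.subset_union_right ?_
    rintro (i | d)
    · exact .inl (.inr ⟨(i, o), rfl⟩)
    · exact .inl (.inl false_mem_constWires)
  refine (hcontrols.trans (.iUnion hlayer)).mono subset_rfl (by simp) ?_
  rintro _ ⟨⟨i, o⟩, rfl⟩
  refine Set.mem_iUnion.2 ⟨o, .inl i, funext fun x => ?_⟩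
  have hperm := SwapNet.perm_map_apply Function.injective_id arrayKeys N x (.inl i)
  rw [hσ] at hperm
  exact congrArg (extendBits fun i => x (i, o)) hperm

theorem HasCompaction.hasTightCompactor {a b : ℕ} (h : HasCompaction n a b) (hn : 0 < n)
    (w : ℕ) : HasTightCompactor n w (3 * (5 + (a + (w + 1) * (8 * b))) + n * (w + 1)) := by
  obtain ⟨N, hb, hN, hcompacts⟩ := h
  choose σ hσ hmono using hcompacts
  exact_mod_cast hasTightCompactor_of_computes hn (fun x => σ (arrayKeys x))
    ((SwapNet.computes_permutedArray hN hσ).mono_cost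
      (show _ ≤ a + (w + 1) * (8 * b) by gcongr)) fun x => hmono (arrayKeys x)

end TightCompactor

/-! ### Sorting short elements -/

section CountingSort

variable {Ω : Type} {S : Set (Ω → Bool)}

theorem computes_thresholds_ofBits {k : ℕ} (X : Fin k → Ω → Bool) (hS : constWires Ω ⊆ S)
    (hX : ∀ j, X j ∈ S) :
    Computes S (2 * 2 ^ k) (thresholds fun ω => Nat.ofBits fun j => X j ω) := by
  induction k with
  | zero =>
    refine .of_subset (Set.range_subset_iff.2 fun i => ?_)
    simpa using hS false_mem_constWires
  | succ k ih =>
    refine ((ih (fun j => X j.succ) fun j => hX j.succ).trans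
      (computes_thresholds_toNat_add_two_mul (hS.trans Set.subset_union_left) (.inl (hX 0))
        Set.subset_union_right (k := 2 ^ (k + 1) - 1) (fun ω => ?_) fun ω => ?_)).mono_cost ?_
    · exact (Nat.ofBits_succ _).trans (add_comm _ _)
    · exact Nat.le_sub_one_of_lt (Nat.ofBits_lt_two_pow _)
    · rw [Nat.sub_add_cancel Nat.one_le_two_pow, pow_succ]
      omega

theorem computes_odd {V : Ω → ℕ} {m : ℕ} (hV : ∀ ω, V ω < 2 * m) (hS : constWires Ω ⊆ S)
    (hVS : thresholds V ⊆ S) : Computes S (3 * m) {fun ω => decide (V ω % 2 = 1)} := by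
  have hdigit (u : ℕ) :
      Computes S 2 {fun ω => decide (2 * u < V ω) && !decide (2 * u + 1 < V ω)} :=
    (Computes.of_mem (hVS (mem_thresholds V _))).and (.not (.of_mem (hVS (mem_thresholds V _))))
  have h := Computes.any (List.range m) _ (hS false_mem_constWires) fun u _ => hdigit u
  rw [List.length_range, mul_comm] at h
  convert h using 2
  funext ω
  rw [Bool.eq_iff_iff]
  simp only [decide_eq_true_eq, List.any_eq_true, List.mem_range, Bool.and_eq_true,
    Bool.not_eq_true', decide_eq_false_iff_not]
  have := hV ω
  exact ⟨fun _ => ⟨V ω / 2, by omega⟩, by omega⟩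

theorem computes_testBit {k : ℕ} {V : Ω → ℕ} (hV : ∀ ω, V ω < 2 ^ k) (hS : constWires Ω ⊆ S)
    (hVS : thresholds V ⊆ S) :
    Computes S (3 * 2 ^ k) (Set.range fun (j : ℕ) ω => (V ω).testBit j) := by
  induction k generalizing V with
  | zero =>
    refine .of_subset (Set.range_subset_iff.2 fun j => ?_)
    simpa [fun ω => Nat.lt_one_iff.1 (hV ω)] using hS false_mem_constWires
  | succ k ih =>
    simp only [pow_succ'] at hV
    have hhalf : thresholds (fun ω => V ω / 2) ⊆ S := by
      rintro _ ⟨i, rfl⟩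
      convert hVS (mem_thresholds V (2 * i + 1)) using 2 with ω
      exact decide_eq_decide.2 (show i < V ω / 2 ↔ _ by omega)
    have hdigits := ih (fun ω => Nat.div_lt_of_lt_mul (hV ω)) hhalf
    refine ((computes_odd hV hS hVS).union hdigits).mono subset_rfl (by rw [pow_succ]; omega) ?_
    rintro _ ⟨_ | j, rfl⟩
    · exact .inl (funext fun ω => Nat.testBit_zero _)
    · exact .inr ⟨j, funext fun ω => (Nat.testBit_succ _ _).symm⟩

theorem lt_apply_sort_iff {n : ℕ} (f : Fin n → ℕ) (v : ℕ) (i : Fin n) :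
    v < f (Tuple.sort f i) ↔ i.rev.1 < #{j | v < f j} := by
  have hsort := Tuple.lt_card_le_iff_apply_le_of_monotone (f := f ∘ Tuple.sort f) (a := v) (j := i)
    (Tuple.monotone_sort f)
  have hperm : #{j | (f ∘ Tuple.sort f) j ≤ v} = #{j | f j ≤ v} := by
    simpa using card_filter_comp_perm (fun j => decide (f j ≤ v)) (Tuple.sort f)
  have hcompl := Finset.card_filter_add_card_filter_not (s := Finset.univ) fun j => f j ≤ v
  simp only [not_le, Finset.card_fin] at hcompl
  rw [← not_le, ← Function.comp_apply (f := f), ← hsort, hperm, Fin.val_rev]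
  omega

theorem computes_thresholds_sort {n N : ℕ} {V : Fin n → Ω → ℕ} (hV : ∀ i ω, V i ω < N)
    (hS : constWires Ω ⊆ S) (hVS : ∀ i, thresholds (V i) ⊆ S) :
    Computes S (N * (16 * n))
      (⋃ i, thresholds fun ω => V (Tuple.sort (fun j => V j ω) i) ω) := by
  have hcount (v : Fin N) : Computes S (16 * n) (thresholds fun ω => #{j | v.1 < V j ω}) := by
    simpa using computes_thresholds_card Finset.univ (fun j ω => decide (v.1 < V j ω)) hS
      fun j _ => hVS j (mem_thresholds _ _)
  refine ((Computes.of_subset (k := 0) subset_rfl).union (.iUnion hcount)).mono subset_rfl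
    (by simp) ?_
  simp only [Set.iUnion_subset_iff]
  rintro i _ ⟨v, rfl⟩
  rcases lt_or_ge v N with hv | hv
  · refine .inr (Set.mem_iUnion.2 ⟨⟨v, hv⟩, i.rev, funext fun ω => ?_⟩)
    exact decide_eq_decide.2 (lt_apply_sort_iff (fun j => V j ω) v i).symm
  · left
    simpa [fun j ω => ((hV j ω).trans_le hv).not_gt] using hS false_mem_constWires

end CountingSort

section ShortElements

variable {n w : ℕ}

/-- The bits of an element from the least to the most significant one: sorting by the resulting
numbers sorts by the keys, because the key is the leading bit. -/
def bitPlace : Fin (w + 1) → Option (Fin w) :=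
  Fin.lastCases (motive := fun _ => Option (Fin w)) none some

theorem bitPlace_last : bitPlace (Fin.last w) = none := by simp [bitPlace]

theorem surjective_bitPlace : Function.Surjective (bitPlace (w := w)) := by
  rintro (_ | j)
  · exact ⟨Fin.last w, bitPlace_last⟩
  · exact ⟨j.castSucc, by simp [bitPlace]⟩

/-- The number whose binary digits are the bits of the `i`-th element. -/
def elementCode (x : ArrayBit n w → Bool) (i : Fin n) : ℕ := Nat.ofBits fun k => x (i, bitPlace k)

theorem elementCode_lt (x : ArrayBit n w → Bool) (i : Fin n) : elementCode x i < 2 ^ (w + 1) :=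
  Nat.ofBits_lt_two_pow _

theorem testBit_elementCode (x : ArrayBit n w → Bool) (i : Fin n) (k : Fin (w + 1)) :
    (elementCode x i).testBit k = x (i, bitPlace k) :=
  Nat.testBit_ofBits_lt _ k.1 k.isLt

theorem arrayKeys_eq_decide (x : ArrayBit n w → Bool) (i : Fin n) :
    arrayKeys x i = decide (2 ^ w ≤ elementCode x i) := by
  have hkey : arrayKeys x i = (elementCode x i).testBit w := by
    simpa [bitPlace_last, arrayKeys] using (testBit_elementCode x i (Fin.last w)).symm
  have hlt := elementCode_lt x i
  rw [pow_succ] at hlt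
  rw [hkey, Nat.testBit_eq_decide_div_mod_eq, decide_eq_decide,
    Nat.mod_eq_of_lt (Nat.div_lt_of_lt_mul hlt), ← Nat.one_le_div_iff (by positivity)]
  have := Nat.div_lt_of_lt_mul hlt
  omega

/-- The permutation that sorts an array by the codes of its elements. -/
def codeSort (x : ArrayBit n w → Bool) : Equiv.Perm (Fin n) := Tuple.sort (elementCode x)

theorem monotone_arrayKeys_codeSort (x : ArrayBit n w → Bool) :
    Monotone (arrayKeys x ∘ codeSort x) := by
  intro i j hij
  have hcode : elementCode x (codeSort x i) ≤ elementCode x (codeSort x j) :=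
    Tuple.monotone_sort (elementCode x) hij
  simpa only [Function.comp_apply, arrayKeys_eq_decide, Bool.le_iff_imp, decide_eq_true_eq] using
    fun h => le_trans h hcode

theorem computes_codeSort (n w : ℕ) :
    Computes (arrayWires n w) (21 * n * 2 ^ (w + 1))
      (Set.range fun (q : ArrayBit n w) x => x (codeSort x q.1, q.2)) := by
  have hcodes : Computes (arrayWires n w) (n * (2 * 2 ^ (w + 1)))
      (⋃ i, thresholds fun x => elementCode x i) := by
    simpa using Computes.iUnion fun i : Fin n => show
      Computes (arrayWires n w) _ (thresholds fun x => elementCode x i) from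
        computes_thresholds_ofBits (fun k (x : ArrayBit n w → Bool) => x (i, bitPlace k))
          Set.subset_union_left fun k => .inr ⟨(i, bitPlace k), rfl⟩
  have hsort := computes_thresholds_sort (V := fun i (x : ArrayBit n w → Bool) => elementCode x i)
    (S := arrayWires n w ∪ ⋃ i, thresholds fun x => elementCode x i)
    (fun i x => elementCode_lt x i) (Set.subset_union_left.trans Set.subset_union_left)
    fun i => (Set.subset_iUnion (fun i => thresholds fun x => elementCode x i) i).trans
      Set.subset_union_right
  have hsorted := hcodes.trans hsort
  have hbits := Computes.iUnion fun i => computes_testBit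
    (V := fun x : ArrayBit n w → Bool => elementCode x (codeSort x i))
    (S := arrayWires n w ∪ ⋃ i, thresholds fun x => elementCode x (codeSort x i))
    (fun x => elementCode_lt x _) (Set.subset_union_left.trans Set.subset_union_left)
    ((Set.subset_iUnion (fun i => thresholds fun x => elementCode x (codeSort x i)) i).trans
      Set.subset_union_right)
  refine (hsorted.trans hbits).mono subset_rfl ?_ ?_
  · simp only [Finset.sum_const, Finset.card_fin, smul_eq_mul]
    ring_nf
    rfl
  · rintro _ ⟨⟨i, o⟩, rfl⟩
    obtain ⟨k, rfl⟩ := surjective_bitPlace o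
    exact Set.mem_iUnion.2 ⟨i, k, funext fun x => testBit_elementCode x (codeSort x i) k⟩

theorem hasTightCompactor_codeSort (hn : 0 < n) (w : ℕ) :
    HasTightCompactor n w (3 * (5 + 21 * n * 2 ^ (w + 1)) + n * (w + 1)) := by
  exact_mod_cast
    hasTightCompactor_of_computes hn codeSort (computes_codeSort n w) monotone_arrayKeys_codeSort

end ShortElements

/-! ### Iterated logarithms of natural numbers -/

theorem ceil_max_zero_logb_two {x : ℝ} (hx : 0 ≤ x) :
    ⌈max 0 (Real.logb 2 x)⌉₊ = Nat.clog 2 ⌈x⌉₊ := by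
  refine eq_of_forall_ge_iff fun m => ?_
  rw [Nat.ceil_le, Nat.clog_le_iff_le_pow one_lt_two, Nat.ceil_le, max_le_iff, Nat.cast_pow,
    Nat.cast_ofNat]
  rcases hx.eq_or_lt with rfl | hx
  · simp
  · rw [Real.logb_le_iff_le_rpow one_lt_two hx, Real.rpow_natCast]
    exact and_iff_right m.cast_nonneg

theorem iterLog_succ (i : ℕ) (x : ℝ) :
    iterLog (i + 1) x = max 0 (Real.logb 2 (iterLog i x)) := by
  simp only [iterLog, Function.iterate_succ_apply']

theorem iterLog_natCast_nonneg (i n : ℕ) : 0 ≤ iterLog i n := by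
  cases i with
  | zero => exact n.cast_nonneg
  | succ i => exact (le_max_left _ _).trans_eq (iterLog_succ i n).symm

theorem ceil_iterLog_natCast (i n : ℕ) : ⌈iterLog i n⌉₊ = (Nat.clog 2)^[i] n := by
  induction i with
  | zero => exact Nat.ceil_natCast n
  | succ i ih =>
    rw [iterLog_succ, ceil_max_zero_logb_two (iterLog_natCast_nonneg i n), ih,
      Function.iterate_succ_apply']

theorem iterLog_le_natCast_iff (i n m : ℕ) : iterLog i n ≤ m ↔ (Nat.clog 2)^[i] n ≤ m := by
  rw [← ceil_iterLog_natCast, Nat.ceil_le]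

theorem clog_iterate_antitone (n : ℕ) : Antitone fun i => (Nat.clog 2)^[i] n :=
  antitone_nat_of_succ_le fun i => by
    rw [Function.iterate_succ_apply']
    exact clog_iterate_le 1 _

theorem logStar_le_iff (n i : ℕ) : logStar n ≤ i ↔ (Nat.clog 2)^[i] n ≤ 1 := by
  rw [← iterLog_le_natCast_iff, Nat.cast_one]
  refine ⟨fun h => ?_, fun h => Nat.sInf_le h⟩
  have hlogStar : iterLog (logStar n) n ≤ (1 : ℕ) := by
    rw [Nat.cast_one]
    exact Nat.sInf_mem (exists_iterLog_le_one n)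
  rw [iterLog_le_natCast_iff] at hlogStar
  simpa using (iterLog_le_natCast_iff i n 1).2 ((clog_iterate_antitone n h).trans hlogStar)

theorem logStar_clog_iterate_le_iff (m n i : ℕ) :
    logStar ((Nat.clog 2)^[m] n : ℕ) ≤ i ↔ logStar n ≤ i + m := by
  rw [logStar_le_iff, logStar_le_iff, Function.iterate_add_apply]

theorem logStar_natCast_mono : Monotone fun n : ℕ => logStar n := fun m n hmn =>
  (logStar_le_iff m _).2 ((clog_iterate_mono _ hmn).trans ((logStar_le_iff n _).1 le_rfl))

theorem clog_iterate_logStar_sub_le {n w : ℕ} (hw : 1 ≤ w) :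
    (Nat.clog 2)^[logStar n - logStar w + 1] n ≤ w := by
  by_contra! hlt
  have hle : logStar w ≤ logStar ((Nat.clog 2)^[logStar n - logStar w + 1] n : ℕ) :=
    logStar_natCast_mono hlt.le
  have hpred : logStar ((Nat.clog 2)^[logStar n - logStar w + 1] n : ℕ) ≤ logStar w - 1 := by
    rw [logStar_clog_iterate_le_iff]
    omega
  have hzero := (logStar_le_iff _ 0).1 (hpred.trans (by omega))
  exact (hw.trans_lt hlt).not_ge hzero

theorem logStar_sub_le_of_iterLog_le {n w c : ℕ} (h : iterLog c n ≤ w) :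
    logStar n - logStar w ≤ c := by
  rw [iterLog_le_natCast_iff] at h
  exact Nat.sub_le_iff_le_add'.2 ((logStar_clog_iterate_le_iff c n _).1 (logStar_natCast_mono h))

theorem logStarFactor_eq (ε : ℝ) (n w : ℕ) :
    logStarFactor ε n w = max 1 (((logStar n - logStar w : ℕ) : ℝ) ^ (2 + ε)) := by
  have hsub : max 0 ((logStar n : ℝ) - (logStar w : ℝ)) = ((logStar n - logStar w : ℕ) : ℝ) := by
    rcases le_total (logStar w) (logStar n) with h | h
    · rw [Nat.cast_sub h, max_eq_right (sub_nonneg.2 (mod_cast h))]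
    · rw [Nat.sub_eq_zero_of_le h, Nat.cast_zero, max_eq_left (sub_nonpos.2 (mod_cast h))]
  rw [logStarFactor, hsub]

theorem logStarFactor_le_of_iterLog_le {ε : ℝ} (hε : 0 < ε) {n w c : ℕ} (h : iterLog c n ≤ w) :
    logStarFactor ε n w ≤ max 1 ((c : ℝ) ^ (2 + ε)) := by
  rw [logStarFactor_eq]
  gcongr
  exact logStar_sub_le_of_iterLog_le h

theorem two_pow_clog_succ_le (Δ : ℕ) : 2 ^ Nat.clog 2 (Δ + 1) ≤ 4 * max 1 Δ := by
  rcases Δ.eq_zero_or_pos with rfl | hΔ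
  · simp
  · have hlt : 2 ^ (Nat.clog 2 (Δ + 1)).pred < Δ + 1 :=
      Nat.pow_pred_clog_lt_self one_lt_two (by omega)
    have hpos : 0 < Nat.clog 2 (Δ + 1) := Nat.clog_pos one_lt_two (by omega)
    rw [← Nat.succ_pred_eq_of_pos hpos, pow_succ]
    omega

theorem pow_clog_le_logStarFactor {ε : ℝ} (hε : 0 < ε) (n w : ℕ) :
    ((2 : ℝ) ^ (2 + ε)) ^ Nat.clog 2 (logStar n - logStar w + 1) ≤
      (4 : ℝ) ^ (2 + ε) * logStarFactor ε n w := by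
  set Δ := logStar n - logStar w with hΔ
  have hpow : (2 : ℝ) ^ Nat.clog 2 (Δ + 1) ≤ 4 * max 1 (Δ : ℝ) := by
    exact_mod_cast two_pow_clog_succ_le Δ
  have hfactor : (max 1 (Δ : ℝ)) ^ (2 + ε) = logStarFactor ε n w := by
    rw [logStarFactor_eq, ← hΔ, (Real.monotoneOn_rpow_Ici_of_exponent_nonneg (by linarith)).map_max
      (Set.mem_Ici.2 zero_le_one) (Set.mem_Ici.2 Δ.cast_nonneg), Real.one_rpow]
  calc ((2 : ℝ) ^ (2 + ε)) ^ Nat.clog 2 (Δ + 1)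
      = ((2 : ℝ) ^ Nat.clog 2 (Δ + 1)) ^ (2 + ε) := Real.rpow_pow_comm zero_le_two _ _
    _ ≤ (4 * max 1 (Δ : ℝ)) ^ (2 + ε) := by gcongr
    _ = (4 : ℝ) ^ (2 + ε) * logStarFactor ε n w := by
        rw [Real.mul_rpow (by norm_num) (by positivity), hfactor]

/-! ### The size of tight compaction circuits -/

section Size

variable {n w : ℕ}

/-- The circuit without gates that outputs its input. -/
def idCircuit (ι : Type) : BoolCircuit ι ι := ⟨0, Fin.elim0, fun i => i.elim0, Sum.inl⟩

instance nonempty_boolCircuit (ι : Type) : Nonempty (BoolCircuit ι ι) := ⟨idCircuit ι⟩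

theorem hasTightCompactor_zero (w : ℕ) : HasTightCompactor 0 w 0 := by
  refine ⟨idCircuit _, Nat.cast_zero.le, fun A => ⟨1, funext fun q => q.1.elim0,
    fun i => i.elim0⟩, ?_⟩
  rintro (q | i)
  · exact q.1.elim0
  · exact Fin.elim0 i

theorem HasCompaction.hasTightCompactor_of_le {a b : ℕ} {P : ℝ} (h : HasCompaction n a b)
    (hn : 0 < n) (hw : 1 ≤ w) (ha : a ≤ P * (n * (w + w))) (hb : b ≤ P * n) :
    HasTightCompactor n w ((17 + 54 * P) * (n * w)) := by
  have hn' : (1 : ℝ) ≤ n := mod_cast hn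
  have hw' : (1 : ℝ) ≤ w := mod_cast hw
  have hnw : (n : ℝ) ≤ n * w := le_mul_of_one_le_right n.cast_nonneg hw'
  have hwb : (w + 1 : ℝ) * (8 * b) ≤ (w + w) * (8 * (P * n)) := by gcongr
  refine (h.hasTightCompactor hn w).mono ?_
  linarith

theorem CompactionLevel.hasTightCompactor {k : ℕ} {α : ℝ} (h : CompactionLevel k α α)
    (hα : 0 ≤ α) (hn : 0 < n) (hw : 1 ≤ w) (hk : iterClog k n ≤ w) :
    HasTightCompactor n w ((17 + 54 * α) * (n * w)) := by
  obtain ⟨a, b, hcompaction, ha, hb⟩ := h n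
  refine hcompaction.hasTightCompactor_of_le hn hw (ha.trans ?_) hb
  gcongr
  exact_mod_cast hw

theorem exists_hasTightCompactor_logStarFactor {ε : ℝ} (hε : 0 < ε) :
    ∃ C : ℝ, 0 ≤ C ∧ ∀ n w : ℕ, 0 < n → 1 ≤ w →
      HasTightCompactor n w (C * (n * w) * logStarFactor ε n w) := by
  have hρ : (4 : ℝ) < 2 ^ (2 + ε) :=
    calc (4 : ℝ) = 2 ^ (2 : ℝ) := by norm_num
      _ < 2 ^ (2 + ε) := Real.rpow_lt_rpow_of_exponent_lt one_lt_two (by linarith)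
  obtain ⟨C, hC, hlevel⟩ := exists_compactionLevel hρ
  refine ⟨17 + 54 * (C * 4 ^ (2 + ε)), by positivity, fun n w hn hw => ?_⟩
  set k := Nat.clog 2 (logStar n - logStar w + 1)
  have hk : iterClog k n ≤ w :=
    (clog_iterate_antitone n (Nat.le_pow_clog one_lt_two _)).trans (clog_iterate_logStar_sub_le hw)
  refine ((hlevel k).hasTightCompactor (by positivity) hn hw hk).mono ?_
  have hfactor : 1 ≤ logStarFactor ε n w := le_max_left _ _
  calc (17 + 54 * (C * ((2 : ℝ) ^ (2 + ε)) ^ k)) * (n * w)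
      ≤ (17 * logStarFactor ε n w + 54 * (C * (4 ^ (2 + ε) * logStarFactor ε n w))) * (n * w) := by
        gcongr
        · linarith
        · exact pow_clog_le_logStarFactor hε n w
    _ = (17 + 54 * (C * 4 ^ (2 + ε))) * (n * w) * logStarFactor ε n w := by ring

theorem hasTightCompactor_two_pow (hn : 0 < n) (hw : 1 ≤ w) :
    HasTightCompactor n w (142 * (n * w) * (2 ^ w / w)) := by
  refine (hasTightCompactor_codeSort hn w).mono ?_
  have hn' : (1 : ℝ) ≤ n := mod_cast hn
  have hw' : (0 : ℝ) < w := mod_cast hw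
  have hpow : (w + 1 : ℝ) ≤ 2 ^ w := mod_cast Nat.succ_le_of_lt Nat.lt_two_pow_self
  have hkey : (n : ℝ) * (w + 1) ≤ n * 2 ^ w := by gcongr
  have hone : (1 : ℝ) ≤ n * 2 ^ w := one_le_mul_of_one_le_of_one_le hn' (by linarith)
  calc (3 * (5 + 21 * n * 2 ^ (w + 1)) + n * (w + 1) : ℝ) ≤ 142 * (n * 2 ^ w) := by
        rw [pow_succ]
        linarith
    _ = 142 * (n * w) * (2 ^ w / w) := by field_simp

theorem exists_hasTightCompactor {ε : ℝ} (hε : 0 < ε) :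
    ∃ C : ℝ, 0 ≤ C ∧ ∀ n w : ℕ, 1 ≤ w →
      HasTightCompactor n w (C * (n * w) * min (logStarFactor ε n w) (2 ^ w / w)) := by
  obtain ⟨C, -, hC⟩ := exists_hasTightCompactor_logStarFactor hε
  refine ⟨max C 142, by positivity, fun n w hw => ?_⟩
  rcases n.eq_zero_or_pos with rfl | hn
  · simpa using hasTightCompactor_zero w
  · rcases min_choice (logStarFactor ε n w) ((2 : ℝ) ^ w / w) with hmin | hmin <;> rw [hmin]
    · have hfactor : 0 ≤ logStarFactor ε n w := zero_le_one.trans (le_max_left _ _)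
      exact (hC n w hn hw).mono (by gcongr; exact le_max_left _ _)
    · exact (hasTightCompactor_two_pow hn hw).mono (by gcongr; exact le_max_right _ _)

end Size

theorem two_pow_div_le {w w₀ : ℕ} (hw : 1 ≤ w) (h : w ≤ w₀) : (2 : ℝ) ^ w / w ≤ 2 ^ w₀ :=
  (div_le_self (by positivity) (mod_cast hw)).trans (pow_le_pow_right₀ one_le_two h)

theorem theorem2 :
    ∃ K : ℕ, ∀ ε : ℝ, 0 < ε →
      ∃ Φ : (n w : ℕ) → BoolCircuit (ArrayBit n w) (ArrayBit n w),
        (∀ n w : ℕ, 1 ≤ w → IsTightCompactor (Φ n w) ∧ ∀ s, (Φ n w).fanOut s ≤ K) ∧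
        (∃ C : ℝ, ∀ n w : ℕ, 1 ≤ w →
          ((Φ n w).size : ℝ) ≤
            C * ((n : ℝ) * (w : ℝ)) * min (logStarFactor ε n w) ((2 : ℝ) ^ w / (w : ℝ))) ∧
        (∀ c : ℕ, 1 ≤ c → ∃ C : ℝ, ∀ n w : ℕ, 1 ≤ w → iterLog c n ≤ (w : ℝ) →
          ((Φ n w).size : ℝ) ≤ C * ((n : ℝ) * (w : ℝ))) ∧
        (∀ w₀ : ℕ, ∃ C : ℝ, ∀ n w : ℕ, 1 ≤ w → w ≤ w₀ →
          ((Φ n w).size : ℝ) ≤ C * ((n : ℝ) * (w : ℝ))) := by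
  refine ⟨3, fun ε hε => ?_⟩
  obtain ⟨C, hC, hcompactor⟩ := exists_hasTightCompactor hε
  choose! Φ hsize htight hfanOut using hcompactor
  have hsize_le {n w : ℕ} (hw : 1 ≤ w) {F : ℝ}
      (hF : min (logStarFactor ε n w) ((2 : ℝ) ^ w / w) ≤ F) :
      ((Φ n w).size : ℝ) ≤ C * F * (n * w) :=
    calc ((Φ n w).size : ℝ) ≤ C * (n * w) * F := (hsize n w hw).trans (by gcongr)
      _ = C * F * (n * w) := by ring
  exact ⟨Φ, fun n w hw => ⟨htight n w hw, hfanOut n w hw⟩, ⟨C, hsize⟩,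
    fun c _ => ⟨_, fun n w hw hc =>
      hsize_le hw ((min_le_left _ _).trans (logStarFactor_le_of_iterLog_le hε hc))⟩,
    fun w₀ => ⟨_, fun n w hw hw₀ => hsize_le hw ((min_le_right _ _).trans (two_pow_div_le hw hw₀))⟩⟩
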